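/- **Setting.** Let $\Pi_d=\{0,1\}^d$. For $z\in\mathbb R^d$ let $\mathcal D(z)$ be the Boolean product distribution with natural (logit) parameters $z$, that is $\mathcal D(z;x)=\exp(x^{T}z)/\prod_{i\le d}(1+e^{z_i})$ for $x\in\Pi_d$. For a nonempty $S\subseteq\Pi_d$ write $\mathcal D(z;S)=\sum_{x\in S}\mathcal D(z;x)$, and let $\mathcal D_S(z)$ be the truncation, $\mathcal D_S(z;x)=\mathcal D(z;x)/\mathcal D(z;S)$ for $x\in S$ and $0$ otherwise. Say that $\mathcal D_S(z)$ is *anticoncentrated with parameter* $\lambda>0$ if $\mathbb P_{x\sim\mathcal D_S(z)}[\,w^{T}x\notin(c-\lambda,c+\lambda)\,]\ge\lambda$ for all $w\in\mathbb R^d$ with $\|w\|_2=1$ and all $c\in\mathbb R$. Algorithms are uniform randomised programs (one finite program for all inputs) for a real RAM, in which arithmetic operations, comparisons, $\exp$ and $\log$ on real numbers are exact and have unit cost, coins with a given real bias can be tossed, and there is no unit-cost rounding of reals to integers. The program has a sampling oracle that returns independent draws from $\mathcal D_S(z^*)$ and a membership oracle that tells whether $x\in S$, for any $x\in\Pi_d$;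 one call costs $d+1$ steps. **Theorem.** (a) There are an algorithm with input $d,\varepsilon,\alpha,\lambda$ and constants $K,k$ such that the following holds for all $d$, all $z^*\in\mathbb R^d$, all nonempty $S\subseteq\Pi_d$ and all real $\varepsilon,\alpha,\lambda>0$ for which $\mathcal D(z^*;S)\ge\alpha$ and $\mathcal D_S(z^*)$ is anticoncentrated with parameter $\lambda$. With probability at least $99\%$ the output $\bar z$ of the algorithm satisfies $$\|z^*-\bar z\|_2\le\varepsilon\qquad\text{and}\qquad D_{TV}(\mathcal D(z^*),\mathcal D(\bar z))\le K\varepsilon .$$ On every run, the number of truncated samples plus the number of membership queries is at most $$K\,\alpha^{-k}\lambda^{-k}\cdot\frac d{\varepsilon^2}\,\log^k\!\Bigl(2+\frac d{\varepsilon^2}\Bigr),$$ that is $\mathrm{poly}(1/\alpha,1/\lambda)\,\tilde O(d/\varepsilon^2)$, and the number of steps is at most $K(1+d+1/\varepsilon+1/\alpha+1/\lambda)^k$. (b) The dependence of the sample complexity on $d$ and $\varepsilon$ is optimal up to logarithmic factors, even when there is no truncation: there are constants $c,\lambda_0>0$ such that, for all $d$, $n$ and $0<\varepsilon\le\sqrt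 d$, if some (possibly randomised, computationally unbounded) estimator, given $n$ independent samples of $\mathcal D(z^*)$, outputs a point within $\ell_2$ distance $\varepsilon$ of $z^*$ with probability at least $99\%$, for every $z^*\in\mathbb R^d$ such that $\mathcal D(z^*)$ is anticoncentrated with parameter $\lambda_0$, then $n\ge c\,d/\varepsilon^2$. -/

import Mathlib

noncomputable section

/-! ### Boolean product distributions and their truncations -/

/-- The Boolean hypercube `{0,1}^d`; `true` stands for `1`. -/
abbrev Cube (d : ℕ) : Type := Fin d → Bool

/-- `ℝ^d` with the Euclidean norm. -/
abbrev Vec (d : ℕ) : Type := EuclideanSpace ℝ (Fin d)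

/-- The real number `0` or `1` encoded by a bit. -/
def bitVal (b : Bool) : ℝ := if b then 1 else 0

/-- A point of the hypercube, seen as a vector of `ℝ^d`. -/
def Cube.toVec {d : ℕ} (x : Cube d) : Vec d := WithLp.toLp 2 (fun i => bitVal (x i))

/-- `D(z; x) = exp(xᵀ z) / ∏ i, (1 + exp z_i)`: the probability of `x` under the Boolean product
distribution with natural (logit) parameter vector `z`. -/
def prodProb {d : ℕ} (z : Vec d) (x : Cube d) : ℝ :=
  Real.exp (inner ℝ x.toVec z) / ∏ i, (1 + Real.exp (z i))

/-- `D(z; S)`: the mass of `S` under the Boolean product distribution. -/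
def prodMass {d : ℕ} (z : Vec d) (S : Finset (Cube d)) : ℝ := ∑ x ∈ S, prodProb z x

/-- `D_S(z; x)`: the probability of `x` under the truncation to `S`. -/
def truncProb {d : ℕ} (z : Vec d) (S : Finset (Cube d)) (x : Cube d) : ℝ :=
  if x ∈ S then prodProb z x / prodMass z S else 0

theorem prodProb_pos {d : ℕ} (z : Vec d) (x : Cube d) : 0 < prodProb z x :=
  div_pos (Real.exp_pos _) (Finset.prod_pos fun i _ => by positivity)

theorem prodMass_pos {d : ℕ} (z : Vec d) {S : Finset (Cube d)} (hS : S.Nonempty) :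
    0 < prodMass z S :=
  Finset.sum_pos (fun x _ => prodProb_pos z x) hS

theorem truncProb_nonneg {d : ℕ} (z : Vec d) (S : Finset (Cube d)) (x : Cube d) :
    0 ≤ truncProb z S x := by
  unfold truncProb
  split_ifs
  · exact div_nonneg (prodProb_pos z x).le (Finset.sum_nonneg fun y _ => (prodProb_pos z y).le)
  · exact le_rfl

theorem sum_truncProb {d : ℕ} (z : Vec d) {S : Finset (Cube d)} (hS : S.Nonempty) :
    ∑ x, truncProb z S x = 1 := by
  simp only [truncProb, Finset.sum_ite_mem, Finset.univ_inter]
  rw [← Finset.sum_div]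
  exact div_self (prodMass_pos z hS).ne'

/-- The truncated Boolean product distribution `D_S(z)`. -/
def truncPMF {d : ℕ} (z : Vec d) (S : Finset (Cube d)) (hS : S.Nonempty) : PMF (Cube d) :=
  PMF.ofFintype (fun x => ENNReal.ofReal (truncProb z S x)) (by
    rw [← ENNReal.ofReal_sum_of_nonneg fun x _ => truncProb_nonneg z S x, sum_truncProb z hS,
      ENNReal.ofReal_one])

open Classical in
/-- Anticoncentration with parameter `lam`: for every unit vector `w` and every real `c`, a sample
`x` of `D_S(z)` has `wᵀ x ∉ (c - lam, c + lam)` with probability at least `lam`. -/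
def Anticoncentrated {d : ℕ} (z : Vec d) (S : Finset (Cube d)) (lam : ℝ) : Prop :=
  ∀ w : Vec d, ‖w‖ = 1 → ∀ c : ℝ,
    lam ≤ ∑ x with inner ℝ w x.toVec ∉ Set.Ioo (c - lam) (c + lam), truncProb z S x

/-- The total variation distance between two Boolean product distributions. -/
def tvDist {d : ℕ} (z z' : Vec d) : ℝ := (1 / 2) * ∑ x, |prodProb z x - prodProb z' x|

/-! ### A randomised real RAM with a sampling oracle and a membership oracle

A program is a finite piece of syntax that does not depend on the dimension or on the other inputs.
Its memory consists of registers that hold natural numbers, used as counters and addresses, and of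
real arrays `0, 1, 2, …`, each indexed by the natural numbers. Real arithmetic and comparisons are
exact and cost one step per operation. There is no unit-cost rounding: the value of a counter grows
by at most the time spent. -/

/-- Real-valued expressions. `cell a r` is the entry of array `a` whose index is the content of the
natural-number register `r`. The only constants are integers. -/
inductive RExpr : Type
  | const (q : ℤ)
  | cell (a r : ℕ)
  | ofNat (r : ℕ)
  | add (e f : RExpr)
  | sub (e f : RExpr)
  | mul (e f : RExpr)
  | div (e f : RExpr)
  | exp (e : RExpr)
  | log (e : RExpr)

/-- Programs. -/
inductive Prog : Type
  /-- do nothing -/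
  | skip
  /-- run one program after the other -/
  | seq (p q : Prog)
  /-- set register `r` to zero -/
  | zero (r : ℕ)
  /-- increment register `r` -/
  | succ (r : ℕ)
  /-- copy the content of register `r'` to register `r` -/
  | copy (r r' : ℕ)
  /-- round the value of `e` up to a natural number (negative values to zero) and store it in
  register `r`; this costs as many steps as that number, plus one -/
  | ceil (r : ℕ) (e : RExpr)
  /-- store the value of `e` in the entry of array `a` indexed by register `r` -/
  | assign (a r : ℕ) (e : RExpr)
  /-- run `p` if `e ≤ f`, and `q` otherwise -/
  | ifLE (e f : RExpr) (p q : Prog)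
  /-- repeat `p`, as many times as register `r` says when the loop is entered -/
  | loop (r : ℕ) (p : Prog)
  /-- toss a coin with success probability `e` (clipped to `[0,1]`), and store the outcome, `0` or
  `1`, in the entry of array `a` indexed by register `r` -/
  | coin (a r : ℕ) (e : RExpr)
  /-- draw a fresh sample from the sampling oracle and store its `d` bits in array `a` -/
  | sample (a : ℕ)
  /-- ask the membership oracle about the point given by the first `d` entries of array `b` (an
  entry `1` is read as the bit `1`, all else as `0`), and store the answer, `1` for yes and `0` for
  no, in the entry of array `a` indexed by register `r` -/
  | query (a r b : ℕ)

/-- The memory, together with counters for the resources used so far, which programs cannot read. -/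
structure RamState : Type where
  /-- natural-number registers -/
  reg : ℕ → ℕ
  /-- real arrays: `mem a i` is entry `i` of array `a` -/
  mem : ℕ → ℕ → ℝ
  /-- number of elementary steps so far -/
  time : ℕ
  /-- number of samples drawn so far -/
  samples : ℕ
  /-- number of membership queries asked so far -/
  queries : ℕ

namespace RamState

/-- Charge `t` steps. -/
def tick (s : RamState) (t : ℕ) : RamState := { s with time := s.time + t }

/-- Count one sample. -/
def countSample (s : RamState) : RamState := { s with samples := s.samples + 1 }

/-- Count one membership query. -/
def countQuery (s : RamState) : RamState := { s with queries := s.queries + 1 }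

/-- Store `n` in register `r`. -/
def setReg (s : RamState) (r n : ℕ) : RamState := { s with reg := Function.update s.reg r n }

/-- Store `v` in entry `i` of array `a`. -/
def setMem (s : RamState) (a i : ℕ) (v : ℝ) : RamState :=
  { s with mem := Function.update s.mem a (Function.update (s.mem a) i v) }

/-- Write the bits of `x` into the first `d` entries of array `a`. -/
def writeCube {d : ℕ} (s : RamState) (a : ℕ) (x : Cube d) : RamState :=
  { s with
    mem := Function.update s.mem a fun i => if h : i < d then bitVal (x ⟨i, h⟩) else s.mem a i }

open Classical in
/-- Read a point of the hypercube from the first `d` entries of array `a`. -/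
def readCube (d : ℕ) (s : RamState) (a : ℕ) : Cube d := fun i => decide (s.mem a i = 1)

/-- Read a vector of `ℝ^d` from the first `d` entries of array `a`. -/
def readVec (d : ℕ) (s : RamState) (a : ℕ) : Vec d := WithLp.toLp 2 (fun i => s.mem a i)

/-- The initial memory: register `0` holds `d`; entry `0` of the arrays `1`, `2`, `3` holds `ε`,
`α` and `lam`; all else is zero. -/
def init (d : ℕ) (ε α lam : ℝ) : RamState where
  reg := fun r => if r = 0 then d else 0
  mem := fun a i =>
    if i = 0 then (if a = 1 then ε else if a = 2 then α else if a = 3 then lam else 0) else 0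
  time := 0
  samples := 0
  queries := 0

end RamState

/-- The value of an expression. -/
def RExpr.eval (s : RamState) : RExpr → ℝ
  | const q => q
  | cell a r => s.mem a (s.reg r)
  | ofNat r => s.reg r
  | add e f => e.eval s + f.eval s
  | sub e f => e.eval s - f.eval s
  | mul e f => e.eval s * f.eval s
  | div e f => e.eval s / f.eval s
  | exp e => Real.exp (e.eval s)
  | log e => Real.log (e.eval s)

/-- The cost of evaluating an expression: its number of symbols. -/
def RExpr.cost : RExpr → ℕ
  | const _ => 1
  | cell _ _ => 1
  | ofNat _ => 1
  | add e f => e.cost + f.cost + 1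
  | sub e f => e.cost + f.cost + 1
  | mul e f => e.cost + f.cost + 1
  | div e f => e.cost + f.cost + 1
  | exp e => e.cost + 1
  | log e => e.cost + 1

/-- A coin with success probability `max 0 (min 1 p)`. -/
def coinPMF (p : ℝ) : PMF Bool :=
  PMF.ofFintype
    (fun b => ENNReal.ofReal (if b then max 0 (min 1 p) else 1 - max 0 (min 1 p))) (by
      have h0 : 0 ≤ max 0 (min 1 p) := le_max_left _ _
      have h1 : max 0 (min 1 p) ≤ 1 := max_le zero_le_one (min_le_left _ _)
      rw [Fintype.sum_bool, if_pos rfl, if_neg Bool.false_ne_true,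
        ← ENNReal.ofReal_add h0 (sub_nonneg.2 h1), add_sub_cancel, ENNReal.ofReal_one])

open Classical in
/-- The distribution of the final state of a program started in a given state, when the sampling
oracle draws independently from `μ` and the membership oracle answers for `S`. Samples and queries
cost `d + 1` steps each. -/
def Prog.run {d : ℕ} (μ : PMF (Cube d)) (S : Finset (Cube d)) : Prog → RamState → PMF RamState
  | skip, s => PMF.pure (s.tick 1)
  | seq p q, s => (p.run μ S s).bind (q.run μ S)
  | zero r, s => PMF.pure ((s.setReg r 0).tick 1)
  | succ r, s => PMF.pure ((s.setReg r (s.reg r + 1)).tick 1)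
  | copy r r', s => PMF.pure ((s.setReg r (s.reg r')).tick 1)
  | ceil r e, s => PMF.pure ((s.setReg r ⌈e.eval s⌉₊).tick (e.cost + ⌈e.eval s⌉₊ + 1))
  | assign a r e, s => PMF.pure ((s.setMem a (s.reg r) (e.eval s)).tick (e.cost + 1))
  | ifLE e f p q, s =>
      if e.eval s ≤ f.eval s then p.run μ S (s.tick (e.cost + f.cost + 1))
      else q.run μ S (s.tick (e.cost + f.cost + 1))
  | loop r p, s =>
      (fun ν : PMF RamState => ν.bind fun t => p.run μ S (t.tick 1))^[s.reg r]
        (PMF.pure (s.tick 1))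
  | coin a r e, s =>
      (coinPMF (e.eval s)).map fun b => (s.setMem a (s.reg r) (bitVal b)).tick (e.cost + 1)
  | sample a, s =>
      μ.map fun x => ((s.writeCube a x).tick (d + 1)).countSample
  | query a r b, s =>
      PMF.pure
        ((s.setMem a (s.reg r) (if s.readCube d b ∈ S then 1 else 0)).tick (d + 1)).countQuery

end

/-! Upper bound. Write `b = α * lam` and let `μ` be the mean of the truncated distribution. An
unbiased gradient of the truncated likelihood at `z` would need samples of D_S(z), hard to get when
D(z;S) is tiny. The algorithm uses the gradient multiplied by D(z;S): draw one `y` from D(z), and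
move along `x - y`, with `x` a truncated sample, only if `y ∈ S`. On `S`, the density of D(z) is
that of D_S(zs) times D(zs;S) exp(t) exp(v), where `v = ⟪x - μ, z - zs⟫` has mean zero and `t` is a
difference of cross-entropies (`prodProb_change`). Hence the drift towards `zs` is at least D(zs;S)
exp(t) times the mean of `exp v - 1 - v`, which anticoncentration bounds below
(`drift_lower_bound`).

The drift is useful unless `t` is very negative. The product distribution with mean `μ` minimises
the cross-entropy, and `zs` is within `-log α` of that minimum (`crossEntropy_sub_le`). So if `u`
approximates the logits of `μ`, then `zs` lies in the set `bregman u z ≤ 1 - log α`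
(`bregman_target_le`). Inside this set `t ≥ log α - 3`, and the drift is quadratic in `‖z - zs‖`
(`likelihood_descent`). Outside it, the gradient of the Bregman divergence points away from `zs` by
strong convexity, and a step against it needs no samples (`bregman_descent`). Projected descent that
picks its step by this test contracts the expected squared distance at one rate everywhere.
Chebyshev's inequality controls `u` and Markov's inequality the last iterate. A Hellinger
computation turns logit distance into total variation (`tvDist_le_norm`). The program is treated by
a logic for supports (`Ensures`), which also counts resources, and one for expectations
(`expect_loop_le`).

Lower bound. This is Assouad's argument on a cube of logits of half-side `2ε/√d`: flipping one sign
is undetectable with few samples, while an estimate within `ε` has at most a quarter of its signs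
wrong (`samples_ge_of_estimates_vertices`). All vertices are anticoncentrated because the
characteristic function of a unit projection is bounded away from one in modulus
(`anticoncentrated_univ`). -/

noncomputable section

/-! ### One-dimensional estimates -/

open Real in
/-- The log-partition function of one bit. -/
def softplus (t : ℝ) : ℝ := log (1 + exp t)

theorem exp_softplus (t : ℝ) : Real.exp (softplus t) = 1 + Real.exp t :=
  Real.exp_log (by positivity)

theorem hasDerivAt_softplus (t : ℝ) : HasDerivAt softplus (Real.sigmoid t) t := by
  have h : HasDerivAt (fun t => 1 + Real.exp t) (Real.exp t) t := by
    simpa using (Real.hasDerivAt_exp t).const_add 1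
  have h2 := h.log (by positivity)
  refine h2.congr_deriv ?_
  rw [Real.sigmoid_def, Real.exp_neg]
  field_simp
  ring

/-- The right side is the inverse of `(1 + exp t) * (1 + exp (-t))`. One of the two exponentials is
at most `1` and the other at most `exp B`, so this product is at most `3 + exp B`. -/
theorem exp_neg_div_four_le_sigmoid_deriv {B t : ℝ} (ht : |t| ≤ B) :
    Real.exp (-B) / 4 ≤ Real.sigmoid t * (1 - Real.sigmoid t) := by
  have hB : 0 ≤ B := (abs_nonneg t).trans ht
  have h1 : Real.exp t ≤ Real.exp B := Real.exp_le_exp.2 (le_of_abs_le ht)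
  have h2 : Real.exp (-t) ≤ Real.exp B := Real.exp_le_exp.2 ((neg_le_abs t).trans ht)
  have h3 : Real.exp t * Real.exp (-t) = 1 := by rw [← Real.exp_add]; simp
  have h4 : 1 ≤ Real.exp B := Real.one_le_exp hB
  have key : (1 + Real.exp t) * (1 + Real.exp (-t)) ≤ 4 * Real.exp B := by
    have : Real.exp t + Real.exp (-t) ≤ Real.exp B + 1 := by
      rcases le_total 0 t with h | h
      · have : Real.exp (-t) ≤ 1 := Real.exp_le_one_iff.2 (by linarith)
        linarith
      · have : Real.exp t ≤ 1 := Real.exp_le_one_iff.2 h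
        linarith
    nlinarith
  rw [← Real.sigmoid_neg, Real.sigmoid_def, Real.sigmoid_def, neg_neg, ← mul_inv,
    mul_comm (1 + _), Real.exp_neg, div_eq_mul_inv, ← mul_inv, mul_comm _ (4 : ℝ)]
  exact inv_anti₀ (by positivity) key

theorem abs_sigmoid_sub_le (s t : ℝ) : |Real.sigmoid s - Real.sigmoid t| ≤ |s - t| := by
  have := Convex.norm_image_sub_le_of_norm_deriv_le (f := Real.sigmoid) (s := Set.univ)
    (x := t) (y := s) (C := 1) (fun x _ => (Real.hasDerivAt_sigmoid x).differentiableAt)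
    (fun x _ => by
      have h0 := Real.sigmoid_pos x
      have h1 := Real.sigmoid_lt_one x
      rw [(Real.hasDerivAt_sigmoid x).deriv, Real.norm_eq_abs, abs_le]
      constructor <;> nlinarith) convex_univ trivial trivial
  simpa using this

theorem sigmoid_sub_ge {B s t : ℝ} (hs : |s| ≤ B) (ht : |t| ≤ B) (hst : s ≤ t) :
    Real.exp (-B) / 4 * (t - s) ≤ Real.sigmoid t - Real.sigmoid s := by
  have hd : ∀ x, HasDerivAt (fun t => Real.sigmoid t - Real.exp (-B) / 4 * t)
      (Real.sigmoid x * (1 - Real.sigmoid x) - Real.exp (-B) / 4) x := fun x =>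
    ((Real.hasDerivAt_sigmoid x).sub ((hasDerivAt_id x).const_mul (Real.exp (-B) / 4))).congr_deriv
      (by simp)
  have hmono : MonotoneOn (fun t => Real.sigmoid t - Real.exp (-B) / 4 * t) (Set.Icc (-B) B) := by
    refine monotoneOn_of_deriv_nonneg (convex_Icc _ _)
      (fun x _ => (hd x).continuousAt.continuousWithinAt)
      (fun x _ => (hd x).differentiableAt.differentiableWithinAt) fun x hx => ?_
    rw [(hd x).deriv, sub_nonneg]
    exact exp_neg_div_four_le_sigmoid_deriv (abs_le.2 (Set.mem_Icc.1 (interior_subset hx)))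
  have := hmono (abs_le.1 hs) (abs_le.1 ht) hst
  simp only at this
  linarith

/-- Strong convexity of the log-partition function on a bounded interval. -/
theorem softplus_strong_convex {B s t : ℝ} (hs : |s| ≤ B) (ht : |t| ≤ B) :
    softplus s + Real.sigmoid s * (t - s) + Real.exp (-B) / 8 * (t - s) ^ 2 ≤ softplus t := by
  set c := Real.exp (-B) / 8 with hc
  -- By `sigmoid_sub_ge` the derivative of `h` on the interval has the sign of `x - s`, so `h` is
  -- smallest at `s`.
  set h : ℝ → ℝ := fun t => softplus t - Real.sigmoid s * (t - s) - c * (t - s) ^ 2 with hh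
  have hd : ∀ x, HasDerivAt h (Real.sigmoid x - Real.sigmoid s - 2 * c * (x - s)) x := fun x => by
    have h1 := (hasDerivAt_id x).sub_const s
    have := ((hasDerivAt_softplus x).sub (h1.const_mul (Real.sigmoid s))).sub
      ((h1.pow 2).const_mul c)
    refine this.congr_deriv ?_
    simp only [id, mul_one]
    ring
  suffices h s ≤ h t by simp only [hh, sub_self] at this; linarith
  rw [abs_le] at hs ht
  rcases le_total s t with hst | hst
  · have : MonotoneOn h (Set.Icc s B) := by
      refine monotoneOn_of_deriv_nonneg (convex_Icc _ _)
        (fun x _ => (hd x).continuousAt.continuousWithinAt)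
        (fun x _ => (hd x).differentiableAt.differentiableWithinAt) fun x hx => ?_
      have hx := interior_subset hx
      rw [(hd x).deriv]
      have := sigmoid_sub_ge (B := B) (abs_le.2 hs) (abs_le.2 ⟨hs.1.trans hx.1, hx.2⟩) hx.1
      rw [hc]; linarith
    exact this ⟨le_rfl, hs.2⟩ ⟨hst, ht.2⟩ hst
  · have : AntitoneOn h (Set.Icc (-B) s) := by
      refine antitoneOn_of_deriv_nonpos (convex_Icc _ _)
        (fun x _ => (hd x).continuousAt.continuousWithinAt)
        (fun x _ => (hd x).differentiableAt.differentiableWithinAt) fun x hx => ?_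
      have hx := interior_subset hx
      rw [(hd x).deriv]
      have := sigmoid_sub_ge (B := B) (abs_le.2 ⟨hx.1, hx.2.trans hs.2⟩) (abs_le.2 hs) hx.2
      rw [hc]; linarith
    exact this ⟨ht.1, hst⟩ ⟨hs.1, le_rfl⟩ hst

/-- The growth is only linear as `v → -∞`, which is why a minimum appears. For `v ≥ -2`, squaring `1
+ v / 2 ≤ exp (v / 2)` gives the quadratic bound; below `-2` the term `-v` dominates. -/
theorem exp_sub_one_sub_ge {v s : ℝ} (hs : 0 ≤ s) (hv : s ≤ |v|) :
    min (s ^ 2 / 4) (s / 2) ≤ Real.exp v - 1 - v := by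
  rcases le_total (-2) v with h | h
  · have h1 : 1 + v / 2 ≤ Real.exp (v / 2) := by linarith [Real.add_one_le_exp (v / 2)]
    have h2 : Real.exp v = Real.exp (v / 2) ^ 2 := by rw [sq, ← Real.exp_add]; ring_nf
    have h3 : (1 + v / 2) ^ 2 ≤ Real.exp (v / 2) ^ 2 := pow_le_pow_left₀ (by linarith) h1 2
    have h4 : s ^ 2 ≤ v ^ 2 := by rw [← sq_abs v]; exact pow_le_pow_left₀ hs hv 2
    exact (min_le_left _ _).trans (by rw [h2]; nlinarith)
  · have : |v| = -v := abs_of_nonpos (by linarith)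
    exact (min_le_right _ _).trans (by linarith [Real.exp_pos v])

/-- The logarithm is `1/β`-Lipschitz on `[β, ∞)`, and raising `p` to `β` does not move it away from
`q`. -/
theorem abs_log_max_sub_log_le {β p q : ℝ} (hβ : 0 < β) (hq : β ≤ q) :
    |Real.log (max p β) - Real.log q| ≤ |p - q| / β := by
  have key : ∀ {a b : ℝ}, β ≤ a → β ≤ b → a ≤ b → Real.log b - Real.log a ≤ (b - a) / β := by
    intro a b ha hb hab
    have ha0 : 0 < a := hβ.trans_le ha
    rw [← Real.log_div (hβ.trans_le hb).ne' ha0.ne']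
    calc Real.log (b / a) ≤ b / a - 1 := Real.log_le_sub_one_of_pos (div_pos (hβ.trans_le hb) ha0)
      _ = (b - a) / a := by rw [sub_div, div_self ha0.ne']
      _ ≤ (b - a) / β := div_le_div_of_nonneg_left (by linarith) hβ ha
  have hm : |max p β - q| ≤ |p - q| := by
    have := abs_max_sub_max_le_abs p q β
    rwa [max_eq_left hq] at this
  refine le_trans ?_ (div_le_div_of_nonneg_right hm hβ.le)
  rcases le_total (max p β) q with h | h
  · rw [abs_sub_comm, abs_sub_comm (max p β) q, abs_of_nonneg (sub_nonneg.2 h),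
      abs_of_nonneg (sub_nonneg.2 (Real.log_le_log (lt_max_of_lt_right hβ) h))]
    exact key (le_max_right _ _) hq h
  · rw [abs_of_nonneg (sub_nonneg.2 h),
      abs_of_nonneg (sub_nonneg.2 (Real.log_le_log (hβ.trans_le hq) h))]
    exact key hq (le_max_right _ _) h

/-! ### Clipped logits and projection to an interval -/

/-- The logit of `p`, where `p` and `1 - p` are first increased to at least `β`. -/
def clippedLogit (β p : ℝ) : ℝ := Real.log (max p β / max (1 - p) β)

theorem clippedLogit_eq {β : ℝ} (hβ : 0 < β) (p : ℝ) :
    clippedLogit β p = Real.log (max p β) - Real.log (max (1 - p) β) :=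
  Real.log_div (by positivity) (by positivity)

theorem abs_clippedLogit_le {β p : ℝ} (hβ : 0 < β) (hβ1 : β ≤ 1) (h0 : 0 ≤ p) (h1 : p ≤ 1) :
    |clippedLogit β p| ≤ -Real.log β := by
  have key : ∀ {x}, x ≤ 1 → Real.log β ≤ Real.log (max x β) ∧ Real.log (max x β) ≤ 0 := by
    intro x hx
    exact ⟨Real.log_le_log hβ (le_max_right _ _),
      Real.log_nonpos (by positivity) (max_le hx hβ1)⟩
  have h1' := key h1
  have h2' := key (x := 1 - p) (by linarith)
  rw [clippedLogit_eq hβ, abs_le]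
  constructor <;> linarith

theorem abs_clippedLogit_sub_le {β p q : ℝ} (hβ : 0 < β) (h0 : β ≤ q) (h1 : q ≤ 1 - β) :
    |clippedLogit β p - clippedLogit β q| ≤ 2 / β * |p - q| := by
  have e1 := abs_log_max_sub_log_le (p := p) hβ h0
  have e2 := abs_log_max_sub_log_le (p := 1 - p) (q := 1 - q) hβ (by linarith)
  rw [show (1 - p) - (1 - q) = -(p - q) by ring, abs_neg] at e2
  rw [clippedLogit_eq hβ, clippedLogit_eq hβ, max_eq_left h0, max_eq_left (by linarith : β ≤ 1 - q)]
  have e3 : 2 / β * |p - q| = |p - q| / β + |p - q| / β := by ring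
  rw [e3]
  rw [abs_le] at *
  constructor <;> linarith

theorem sigmoid_clippedLogit {β q : ℝ} (hβ : 0 < β) (h0 : β ≤ q) (h1 : q ≤ 1 - β) :
    Real.sigmoid (clippedLogit β q) = q := by
  have hq : 0 < q := hβ.trans_le h0
  rw [clippedLogit, max_eq_left h0, max_eq_left (by linarith), Real.sigmoid_def, ← Real.log_inv,
    Real.exp_log (inv_pos.2 (div_pos hq (by linarith)))]
  field_simp
  ring

/-- Truncation of a real number to `[-B, B]`. -/
def clip (B t : ℝ) : ℝ := min (max t (-B)) B

theorem abs_clip_le {B : ℝ} (hB : 0 ≤ B) (t : ℝ) : |clip B t| ≤ B :=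
  abs_le.2 ⟨le_min (le_max_right _ _) (by linarith), min_le_right _ _⟩

/-- Projection never increases the distance to a target inside the interval, so the descent analysis
may ignore it. -/
theorem abs_clip_sub_le {B t w : ℝ} (hw : |w| ≤ B) : |clip B t - w| ≤ |t - w| := by
  have h := abs_le.1 hw
  have e : clip B w = w := by rw [clip, max_eq_left h.1, min_eq_left h.2]
  calc |clip B t - w| = |min (max t (-B)) B - min (max w (-B)) B| := by
        conv_lhs => rw [← e]
        rfl
    _ ≤ |max t (-B) - max w (-B)| := by simpa using abs_min_sub_min_le_max (max t (-B)) B (max w (-B)) B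
    _ ≤ |t - w| := abs_max_sub_max_le_abs t w (-B)

end

noncomputable section

/-! ### Boolean product distributions -/

theorem Fintype.sum_prod_apply {ι κ R : Type*} [CommSemiring R] [DecidableEq ι] [Fintype ι]
    [Fintype κ] (f : ι → κ → R) : ∑ x : ι → κ, ∏ i, f i (x i) = ∏ i, ∑ b, f i b := by
  rw [Finset.prod_univ_sum, Fintype.piFinset_univ]

theorem Cube.toVec_apply {d : ℕ} (x : Cube d) (i : Fin d) : x.toVec i = bitVal (x i) := rfl

theorem bitVal_nonneg (b : Bool) : 0 ≤ bitVal b := by cases b <;> simp [bitVal]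

theorem bitVal_le_one (b : Bool) : bitVal b ≤ 1 := by cases b <;> simp [bitVal]

theorem vec_inner_eq {d : ℕ} (u v : Vec d) : inner ℝ u v = ∑ i, u i * v i := by
  simp [PiLp.inner_apply, mul_comm]

theorem inner_toVec {d : ℕ} (x : Cube d) (z : Vec d) :
    inner ℝ x.toVec z = ∑ i, bitVal (x i) * z i := vec_inner_eq _ _

/-- The probability of the bit `b` under the Bernoulli distribution with logit `t`. -/
def bern (t : ℝ) (b : Bool) : ℝ := if b then Real.sigmoid t else 1 - Real.sigmoid t

theorem bern_nonneg (t : ℝ) (b : Bool) : 0 ≤ bern t b := by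
  unfold bern
  split_ifs
  · exact Real.sigmoid_nonneg t
  · linarith [Real.sigmoid_le_one t]

theorem bern_eq (t : ℝ) (b : Bool) : bern t b = Real.exp (bitVal b * t) / (1 + Real.exp t) := by
  cases b <;> simp [bern, bitVal, Real.sigmoid_def, Real.exp_neg] <;> field_simp <;> ring

theorem sum_bern (t : ℝ) : ∑ b, bern t b = 1 := by simp [bern]

theorem prodProb_eq_prod {d : ℕ} (z : Vec d) (x : Cube d) :
    prodProb z x = ∏ i, bern (z i) (x i) := by
  simp only [prodProb, bern_eq, Finset.prod_div_distrib, inner_toVec, Real.exp_sum]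

theorem sum_prodProb {d : ℕ} (z : Vec d) : ∑ x, prodProb z x = 1 := by
  simp only [prodProb_eq_prod, Fintype.sum_prod_apply (fun i b => bern (z i) b), sum_bern,
    Finset.prod_const_one]

theorem prodMass_le_one {d : ℕ} (z : Vec d) (S : Finset (Cube d)) : prodMass z S ≤ 1 := by
  rw [← sum_prodProb z]
  exact Finset.sum_le_sum_of_subset_of_nonneg (Finset.subset_univ _)
    fun x _ _ => (prodProb_pos z x).le

/-- The log-partition function of the Boolean product distribution. -/
def logPartition {d : ℕ} (z : Vec d) : ℝ := ∑ i, softplus (z i)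

theorem prodProb_eq_exp {d : ℕ} (z : Vec d) (x : Cube d) :
    prodProb z x = Real.exp (inner ℝ x.toVec z - logPartition z) := by
  simp only [prodProb, logPartition, Real.exp_sub, Real.exp_sum, exp_softplus]

/-- The mean vector of the truncated distribution. -/
def truncMean {d : ℕ} (z : Vec d) (S : Finset (Cube d)) : Vec d := ∑ x, truncProb z S x • x.toVec

theorem inner_truncMean {d : ℕ} (z : Vec d) (S : Finset (Cube d)) (w : Vec d) :
    inner ℝ (truncMean z S) w = ∑ x, truncProb z S x * inner ℝ x.toVec w := by
  simp [truncMean, sum_inner, inner_smul_left]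

theorem truncMean_apply {d : ℕ} (z : Vec d) (S : Finset (Cube d)) (i : Fin d) :
    truncMean z S i = ∑ x, truncProb z S x * bitVal (x i) := by
  simp [truncMean, Cube.toVec_apply]

theorem sum_truncProb_mul_inner_sub {d : ℕ} (z : Vec d) {S : Finset (Cube d)} (hS : S.Nonempty)
    (w : Vec d) : ∑ x, truncProb z S x * inner ℝ (x.toVec - truncMean z S) w = 0 := by
  simp only [inner_sub_left, mul_sub, Finset.sum_sub_distrib, ← Finset.sum_mul,
    sum_truncProb z hS, inner_truncMean, one_mul, sub_self]

theorem prodProb_eq_mass_mul_truncProb {d : ℕ} (z : Vec d) {S : Finset (Cube d)}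
    (hS : S.Nonempty) {x : Cube d} (hx : x ∈ S) :
    prodProb z x = prodMass z S * truncProb z S x := by
  rw [truncProb, if_pos hx, mul_div_cancel₀ _ (prodMass_pos z hS).ne']

theorem prodMass_mul_truncProb {d : ℕ} (z : Vec d) {S : Finset (Cube d)}
    (hS : S.Nonempty) (x : Cube d) :
    prodMass z S * truncProb z S x = if x ∈ S then prodProb z x else 0 := by
  split_ifs with hx
  · exact (prodProb_eq_mass_mul_truncProb z hS hx).symm
  · simp [truncProb, hx]

/-! ### Cross-entropy and change of measure -/

/-- The Kullback–Leibler divergence to `D(z)`, up to an additive constant, from a distribution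
with mean `μ`. -/
def crossEntropy {d : ℕ} (μ z : Vec d) : ℝ := logPartition z - inner ℝ μ z

/-- Change of measure from `D(z)` to `D_S(zs)`. -/
theorem prodProb_change {d : ℕ} (zs z : Vec d) {S : Finset (Cube d)} (hS : S.Nonempty)
    {x : Cube d} (hx : x ∈ S) :
    prodProb z x = prodMass zs S *
      Real.exp (crossEntropy (truncMean zs S) zs - crossEntropy (truncMean zs S) z) *
        (truncProb zs S x * Real.exp (inner ℝ (x.toVec - truncMean zs S) (z - zs))) := by
  have h := prodProb_eq_mass_mul_truncProb zs hS hx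
  have : prodProb z x = prodProb zs x *
      Real.exp (crossEntropy (truncMean zs S) zs - crossEntropy (truncMean zs S) z) *
        Real.exp (inner ℝ (x.toVec - truncMean zs S) (z - zs)) := by
    rw [prodProb_eq_exp, prodProb_eq_exp, ← Real.exp_add, ← Real.exp_add]
    congr 1
    simp only [crossEntropy, inner_sub_left, inner_sub_right]
    ring
  rw [this, h]
  ring

theorem sum_subset_truncProb {d : ℕ} (zs : Vec d) (S : Finset (Cube d)) (f : Cube d → ℝ) :
    ∑ x ∈ S, truncProb zs S x * f x = ∑ x, truncProb zs S x * f x :=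
  Finset.sum_subset (Finset.subset_univ _) fun x _ hx => by simp [truncProb, hx]

/-- Sum the change of measure over `S`. The exponent has mean zero, so its exponential has mean at
least `1`; as D(z;S) is at most `1`, this leaves `α * exp t ≤ 1`. -/
theorem crossEntropy_sub_le {d : ℕ} (zs z : Vec d) {S : Finset (Cube d)} (hS : S.Nonempty)
    {α : ℝ} (hα : 0 < α) (hm : α ≤ prodMass zs S) :
    crossEntropy (truncMean zs S) zs - crossEntropy (truncMean zs S) z ≤ -Real.log α := by
  set t := crossEntropy (truncMean zs S) zs - crossEntropy (truncMean zs S) z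
  have h1 : α * Real.exp t * 1 ≤ 1 := by
    calc α * Real.exp t * 1 ≤ prodMass zs S * Real.exp t *
          ∑ x ∈ S, truncProb zs S x * Real.exp (inner ℝ (x.toVec - truncMean zs S) (z - zs)) := by
          gcongr
          · exact mul_nonneg (prodMass_pos zs hS).le (Real.exp_pos _).le
          rw [sum_subset_truncProb]
          calc (1 : ℝ) = ∑ x, truncProb zs S x * (inner ℝ (x.toVec - truncMean zs S) (z - zs) + 1) := by
                simp only [mul_add, Finset.sum_add_distrib, sum_truncProb_mul_inner_sub zs hS,
                  mul_one, sum_truncProb zs hS, zero_add]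
            _ ≤ _ := by
                gcongr with x
                · exact truncProb_nonneg _ _ _
                · exact Real.add_one_le_exp _
      _ = prodMass z S := by
          rw [Finset.mul_sum, prodMass]
          exact Finset.sum_congr rfl fun x hx => (prodProb_change zs z hS hx).symm
      _ ≤ 1 := prodMass_le_one _ _
  have h2 : Real.exp t ≤ Real.exp (-Real.log α) := by
    rw [Real.exp_neg, Real.exp_log hα, ← one_div, le_div_iff₀ hα]
    linarith
  exact Real.exp_le_exp.1 h2

/-- The rejection-sampled gradient at `z` points away from `zs`. -/
theorem drift_lower_bound {d : ℕ} (zs z : Vec d) {S : Finset (Cube d)} (hS : S.Nonempty)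
    {lam : ℝ} (hlam : 0 < lam) (hanti : Anticoncentrated zs S lam) :
    prodMass zs S *
      Real.exp (crossEntropy (truncMean zs S) zs - crossEntropy (truncMean zs S) z) *
        (lam * min ((lam * ‖z - zs‖) ^ 2 / 4) (lam * ‖z - zs‖ / 2)) ≤
      ∑ x ∈ S, prodProb z x * inner ℝ (x.toVec - truncMean zs S) (z - zs) := by
  classical
  set Δ := z - zs with hΔ
  set μ := truncMean zs S with hμ
  set s := lam * ‖Δ‖ with hs
  have hs0 : 0 ≤ s := by positivity
  have hmin : 0 ≤ min (s ^ 2 / 4) (s / 2) := by positivity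
  have h1 : lam * min (s ^ 2 / 4) (s / 2) ≤
      ∑ x, truncProb zs S x * (Real.exp (inner ℝ (x.toVec - μ) Δ) - 1 -
        inner ℝ (x.toVec - μ) Δ) := by
    have hg : ∀ x : Cube d, 0 ≤ Real.exp (inner ℝ (x.toVec - μ) Δ) - 1 -
        inner ℝ (x.toVec - μ) Δ := fun x => by
      linarith [Real.add_one_le_exp (inner ℝ (x.toVec - μ) Δ)]
    by_cases h0 : Δ = 0
    · have : s = 0 := by simp [hs, h0]
      rw [this]
      simp only [ne_eq, OfNat.ofNat_ne_zero, not_false_eq_true, zero_pow, zero_div, min_self,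
        mul_zero]
      exact Finset.sum_nonneg fun x _ => mul_nonneg (truncProb_nonneg _ _ _) (hg x)
    · have hn : 0 < ‖Δ‖ := norm_pos_iff.2 h0
      set w : Vec d := ‖Δ‖⁻¹ • Δ with hw
      have hw1 : ‖w‖ = 1 := by rw [hw, norm_smul, norm_inv, norm_norm, inv_mul_cancel₀ hn.ne']
      -- The interval is centred at the projection of the mean, so outside it the exponent is at
      -- least `lam * ‖Δ‖` in absolute value.
      have ha := hanti w hw1 (inner ℝ w μ)
      calc lam * min (s ^ 2 / 4) (s / 2)
          ≤ (∑ x with inner ℝ w x.toVec ∉ Set.Ioo (inner ℝ w μ - lam) (inner ℝ w μ + lam),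
              truncProb zs S x) * min (s ^ 2 / 4) (s / 2) :=
            mul_le_mul_of_nonneg_right (by convert ha) hmin
        _ ≤ ∑ x with inner ℝ w x.toVec ∉ Set.Ioo (inner ℝ w μ - lam) (inner ℝ w μ + lam),
              truncProb zs S x * (Real.exp (inner ℝ (x.toVec - μ) Δ) - 1 -
                inner ℝ (x.toVec - μ) Δ) := by
            rw [Finset.sum_mul]
            refine Finset.sum_le_sum fun x hx => mul_le_mul_of_nonneg_left ?_
              (truncProb_nonneg _ _ _)
            refine exp_sub_one_sub_ge hs0 ?_
            have hx := (Finset.mem_filter.1 hx).2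
            have e : inner ℝ (x.toVec - μ) Δ = ‖Δ‖ * (inner ℝ w x.toVec - inner ℝ w μ) := by
              rw [← inner_sub_right, real_inner_comm, hw, inner_smul_left]
              simp [hn.ne']
            rw [e, abs_mul, abs_norm, hs, mul_comm]
            refine mul_le_mul_of_nonneg_left ?_ hn.le
            by_contra hlt
            push Not at hlt
            rw [abs_lt] at hlt
            exact hx ⟨by linarith, by linarith⟩
        _ ≤ _ := Finset.sum_le_sum_of_subset_of_nonneg (Finset.subset_univ _)
            fun x _ _ => mul_nonneg (truncProb_nonneg _ _ _) (hg x)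
  calc _ ≤ prodMass zs S * Real.exp (crossEntropy μ zs - crossEntropy μ z) *
        ∑ x, truncProb zs S x * (Real.exp (inner ℝ (x.toVec - μ) Δ) - 1 -
          inner ℝ (x.toVec - μ) Δ) :=
        mul_le_mul_of_nonneg_left h1 (mul_nonneg (prodMass_pos zs hS).le (Real.exp_pos _).le)
    -- The linear term was inserted to make every summand nonnegative; its mean is zero, so it can
    -- be dropped again.
    _ = prodMass zs S * Real.exp (crossEntropy μ zs - crossEntropy μ z) *
        ∑ x, truncProb zs S x * (Real.exp (inner ℝ (x.toVec - μ) Δ) - 1) := by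
        simp only [mul_sub (truncProb _ _ _) (_ - _), Finset.sum_sub_distrib, hμ,
          sum_truncProb_mul_inner_sub zs hS, sub_zero]
    _ ≤ prodMass zs S * Real.exp (crossEntropy μ zs - crossEntropy μ z) *
        ∑ x, truncProb zs S x * (Real.exp (inner ℝ (x.toVec - μ) Δ) * inner ℝ (x.toVec - μ) Δ) := by
        refine mul_le_mul_of_nonneg_left (Finset.sum_le_sum fun x _ =>
          mul_le_mul_of_nonneg_left ?_ (truncProb_nonneg _ _ _))
          (mul_nonneg (prodMass_pos zs hS).le (Real.exp_pos _).le)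
        -- Multiplying `1 - v ≤ exp (-v)` by `exp v` gives `exp v - 1 ≤ exp v * v`.
        set v : ℝ := inner ℝ (x.toVec - μ) Δ
        have h2 := Real.add_one_le_exp (-v)
        have h3 : Real.exp v * Real.exp (-v) = 1 := by rw [← Real.exp_add]; simp
        nlinarith [Real.exp_pos v]
    _ = _ := by
        rw [← sum_subset_truncProb, Finset.mul_sum]
        refine Finset.sum_congr rfl fun x hx => ?_
        rw [prodProb_change zs z hS hx]
        ring

/-! ### Total variation -/

/-- The affinity is `1 + exp` of the midpoint, divided by the geometric mean of the normalisers.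
After squaring, the claim reduces to `cosh x ≤ exp (x² / 2)` at `x = (s - t) / 2`. The constant does
not depend on where `s` and `t` lie. -/
theorem affinity_bern (s t : ℝ) :
    Real.exp (-(s - t) ^ 2 / 16) ≤ ∑ b, Real.sqrt (bern s b * bern t b) := by
  have hsum : ∑ b, Real.sqrt (bern s b * bern t b) =
      (1 + Real.exp ((s + t) / 2)) / Real.sqrt ((1 + Real.exp s) * (1 + Real.exp t)) := by
    simp only [Fintype.sum_bool, bern_eq, bitVal]
    simp only [Bool.false_eq_true, if_true, if_false, one_mul, zero_mul, Real.exp_zero]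
    rw [div_mul_div_comm, div_mul_div_comm, one_mul, ← Real.exp_add, Real.sqrt_div (by positivity),
      Real.sqrt_div zero_le_one, Real.sqrt_one, ← add_div, add_comm,
      show Real.sqrt (Real.exp (s + t)) = Real.exp ((s + t) / 2) from ?_]
    rw [Real.sqrt_eq_iff_mul_self_eq (by positivity) (by positivity), ← Real.exp_add]
    ring_nf
  rw [hsum, le_div_iff₀ (by positivity)]
  refine le_of_sq_le_sq ?_ (by positivity)
  rw [mul_pow, Real.sq_sqrt (by positivity), ← Real.exp_nat_mul]
  have hc := Real.cosh_le_exp_half_sq ((s - t) / 2)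
  rw [Real.cosh_eq] at hc
  have hc1 : 1 ≤ Real.exp (((s - t) / 2) ^ 2 / 2) := Real.one_le_exp (by positivity)
  set E := Real.exp (((s - t) / 2) ^ 2 / 2) with hE
  have e1 : Real.exp ((2 : ℕ) * (-(s - t) ^ 2 / 16)) = E⁻¹ := by
    rw [hE, ← Real.exp_neg]; congr 1; push_cast; ring
  rw [e1, inv_mul_le_iff₀ (by positivity)]
  set M := Real.exp ((s + t) / 2) with hM
  have e2 : Real.exp s = M * Real.exp ((s - t) / 2) := by rw [hM, ← Real.exp_add]; ring_nf
  have e3 : Real.exp t = M * Real.exp (-((s - t) / 2)) := by rw [hM, ← Real.exp_add]; ring_nf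
  have e4 : Real.exp ((s - t) / 2) * Real.exp (-((s - t) / 2)) = 1 := by
    rw [← Real.exp_add]; simp
  have hM0 : 0 < M := Real.exp_pos _
  rw [e2, e3]
  calc (1 + M * Real.exp ((s - t) / 2)) * (1 + M * Real.exp (-((s - t) / 2)))
      = 1 + 2 * M * ((Real.exp ((s - t) / 2) + Real.exp (-((s - t) / 2))) / 2) +
        M ^ 2 * (Real.exp ((s - t) / 2) * Real.exp (-((s - t) / 2))) := by ring
    _ ≤ E + 2 * M * E + M ^ 2 * E := by
        rw [e4]
        gcongr
    _ = E * (1 + M) ^ 2 := by ring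

/-- The Hellinger affinity of two Boolean product distributions. -/
theorem affinity_prodProb {d : ℕ} (z z' : Vec d) :
    Real.exp (-‖z - z'‖ ^ 2 / 16) ≤ ∑ x, Real.sqrt (prodProb z x * prodProb z' x) := by
  have h : ∀ x : Cube d, Real.sqrt (prodProb z x * prodProb z' x) =
      ∏ i, Real.sqrt (bern (z i) (x i) * bern (z' i) (x i)) := fun x => by
    rw [prodProb_eq_prod, prodProb_eq_prod, ← Finset.prod_mul_distrib, Real.sqrt_prod]
    exact fun i _ => mul_nonneg (bern_nonneg _ _) (bern_nonneg _ _)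
  simp only [h, Fintype.sum_prod_apply (fun i b => Real.sqrt (bern (z i) b * bern (z' i) b))]
  rw [EuclideanSpace.real_norm_sq_eq, ← Finset.sum_neg_distrib, Finset.sum_div, Real.exp_sum]
  refine Finset.prod_le_prod (fun i _ => (Real.exp_pos _).le) fun i _ => ?_
  exact affinity_bern _ _

/-- Le Cam's inequality between total variation and Hellinger affinity. -/
theorem sum_abs_sub_sq_le {ι : Type*} [Fintype ι] {p q : ι → ℝ} (hp : ∀ i, 0 ≤ p i)
    (hq : ∀ i, 0 ≤ q i) (hp1 : ∑ i, p i = 1) (hq1 : ∑ i, q i = 1) :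
    (∑ i, |p i - q i|) ^ 2 ≤ 4 * (1 - (∑ i, Real.sqrt (p i * q i)) ^ 2) := by
  set ρ := ∑ i, Real.sqrt (p i * q i)
  have e : ∀ i, |p i - q i| =
      |Real.sqrt (p i) - Real.sqrt (q i)| * (Real.sqrt (p i) + Real.sqrt (q i)) := fun i => by
    rw [← abs_of_nonneg (add_nonneg (Real.sqrt_nonneg (p i)) (Real.sqrt_nonneg (q i))), ← abs_mul,
      mul_comm, ← sq_sub_sq, Real.sq_sqrt (hp i), Real.sq_sqrt (hq i)]
  -- Cauchy–Schwarz on `|√p - √q| * (√p + √q)`; the two sums of squares are `2 - 2ρ` and `2 + 2ρ`.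
  have hcs := Finset.sum_mul_sq_le_sq_mul_sq Finset.univ
    (fun i => |Real.sqrt (p i) - Real.sqrt (q i)|) fun i => Real.sqrt (p i) + Real.sqrt (q i)
  have e1 : ∑ i, |Real.sqrt (p i) - Real.sqrt (q i)| ^ 2 = 2 - 2 * ρ := by
    have : ∀ i, |Real.sqrt (p i) - Real.sqrt (q i)| ^ 2 =
        p i + q i - 2 * Real.sqrt (p i * q i) := fun i => by
      rw [sq_abs, sub_sq, Real.sq_sqrt (hp i), Real.sq_sqrt (hq i), Real.sqrt_mul (hp i)]; ring
    simp only [this, Finset.sum_sub_distrib, Finset.sum_add_distrib, hp1, hq1, ← Finset.mul_sum]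
    norm_num [ρ]
  have e2 : ∑ i, (Real.sqrt (p i) + Real.sqrt (q i)) ^ 2 = 2 + 2 * ρ := by
    have : ∀ i, (Real.sqrt (p i) + Real.sqrt (q i)) ^ 2 =
        p i + q i + 2 * Real.sqrt (p i * q i) := fun i => by
      rw [add_sq, Real.sq_sqrt (hp i), Real.sq_sqrt (hq i), Real.sqrt_mul (hp i)]; ring
    simp only [this, Finset.sum_add_distrib, hp1, hq1, ← Finset.mul_sum]
    norm_num [ρ]
  simp only [e]
  rw [e1, e2] at hcs
  linarith

theorem tvDist_le_norm {d : ℕ} (z z' : Vec d) : tvDist z z' ≤ ‖z - z'‖ := by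
  have h := sum_abs_sub_sq_le (fun x => (prodProb_pos z x).le) (fun x => (prodProb_pos z' x).le)
    (sum_prodProb z) (sum_prodProb z')
  have h1 := affinity_prodProb z z'
  have h2 : 1 - ‖z - z'‖ ^ 2 / 8 ≤ (∑ x, Real.sqrt (prodProb z x * prodProb z' x)) ^ 2 := by
    calc 1 - ‖z - z'‖ ^ 2 / 8 ≤ Real.exp (-‖z - z'‖ ^ 2 / 16) ^ 2 := by
          rw [← Real.exp_nat_mul]
          have := Real.add_one_le_exp ((2 : ℕ) * (-‖z - z'‖ ^ 2 / 16))
          push_cast at this ⊢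
          linarith
      _ ≤ _ := pow_le_pow_left₀ (Real.exp_pos _).le h1 2
  have h3 : (∑ x, |prodProb z x - prodProb z' x|) ^ 2 ≤ (2 * ‖z - z'‖) ^ 2 := by
    nlinarith [sq_nonneg ‖z - z'‖]
  have h4 := abs_le_of_sq_le_sq h3 (by positivity)
  rw [tvDist]
  linarith [le_abs_self (∑ x, |prodProb z x - prodProb z' x|)]

end

noncomputable section

/-! ### Geometry of the truncated likelihood -/

theorem sum_prodProb_mul_bitVal {d : ℕ} (z : Vec d) (i : Fin d) :
    ∑ x, prodProb z x * bitVal (x i) = Real.sigmoid (z i) := by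
  have h : ∀ x : Cube d, prodProb z x * bitVal (x i) =
      ∏ j, bern (z j) (x j) * (if j = i then bitVal (x j) else 1) := fun x => by
    rw [Finset.prod_mul_distrib, Finset.prod_ite_eq' Finset.univ i (fun j => bitVal (x j)),
      if_pos (Finset.mem_univ _), prodProb_eq_prod]
  simp only [h, Fintype.sum_prod_apply (fun j b => bern (z j) b * if j = i then bitVal b else 1)]
  rw [Finset.prod_eq_single i]
  · simp [bern, bitVal]
  · intro j _ hj
    simp [hj, bern]
  · simp

theorem inner_single_toVec {d : ℕ} (i : Fin d) (x : Cube d) :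
    inner ℝ (EuclideanSpace.single i (1 : ℝ)) x.toVec = bitVal (x i) := by
  rw [EuclideanSpace.inner_single_left, Cube.toVec_apply, map_one, one_mul]

/-- Anticoncentration along a coordinate axis around `0`: a bit can leave the interval only by being
`1`. Centre `1` gives the companion bound from above. -/
theorem lam_le_truncMean {d : ℕ} {zs : Vec d} {S : Finset (Cube d)} {lam : ℝ}
    (hlam : 0 < lam) (hanti : Anticoncentrated zs S lam) (i : Fin d) :
    lam ≤ truncMean zs S i := by
  classical
  refine (hanti (EuclideanSpace.single i 1) (by simp) 0).trans ?_
  rw [truncMean_apply, Finset.sum_filter]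
  refine Finset.sum_le_sum fun x _ => ?_
  have h0 := truncProb_nonneg zs S x
  split_ifs with h
  · exact mul_nonneg h0 (bitVal_nonneg _)
  · cases hx : x i
    · exact absurd (by simp [inner_single_toVec, hx, bitVal, hlam]) h
    · simp [bitVal]

theorem truncMean_le {d : ℕ} {zs : Vec d} {S : Finset (Cube d)} (hS : S.Nonempty) {lam : ℝ}
    (hlam : 0 < lam) (hanti : Anticoncentrated zs S lam) (i : Fin d) :
    truncMean zs S i ≤ 1 - lam := by
  classical
  have h := hanti (EuclideanSpace.single i 1) (by simp) 1
  have e : 1 - truncMean zs S i = ∑ x, truncProb zs S x * (1 - bitVal (x i)) := by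
    simp only [mul_sub, Finset.sum_sub_distrib, mul_one, sum_truncProb zs hS, truncMean_apply]
  suffices lam ≤ 1 - truncMean zs S i by linarith
  rw [e]
  refine h.trans ?_
  rw [Finset.sum_filter]
  refine Finset.sum_le_sum fun x _ => ?_
  have h0 := truncProb_nonneg zs S x
  split_ifs with h
  · exact mul_nonneg h0 (sub_nonneg.2 (bitVal_le_one _))
  · cases hx : x i
    · simp [bitVal]
    · exact absurd (by simp [inner_single_toVec, hx, bitVal, hlam]) h

/-- The left side is the untruncated probability that `x ∈ S` and bit `i` is `1`. This transfers the
bounds on truncated means to the untruncated ones. -/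
theorem mass_mul_truncMean_le {d : ℕ} (zs : Vec d) {S : Finset (Cube d)} (hS : S.Nonempty)
    (i : Fin d) : prodMass zs S * truncMean zs S i ≤ Real.sigmoid (zs i) := by
  rw [truncMean_apply, Finset.mul_sum, ← sum_prodProb_mul_bitVal]
  refine Finset.sum_le_sum fun x _ => ?_
  rw [← mul_assoc, prodMass_mul_truncProb zs hS]
  refine mul_le_mul_of_nonneg_right ?_ (bitVal_nonneg _)
  split_ifs
  · exact le_rfl
  · exact (prodProb_pos zs x).le

theorem mass_mul_one_sub_truncMean_le {d : ℕ} (zs : Vec d) {S : Finset (Cube d)}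
    (hS : S.Nonempty) (i : Fin d) :
    prodMass zs S * (1 - truncMean zs S i) ≤ 1 - Real.sigmoid (zs i) := by
  have e : 1 - truncMean zs S i = ∑ x, truncProb zs S x * (1 - bitVal (x i)) := by
    simp only [mul_sub, Finset.sum_sub_distrib, mul_one, sum_truncProb zs hS, truncMean_apply]
  have e2 : 1 - Real.sigmoid (zs i) = ∑ x, prodProb zs x * (1 - bitVal (x i)) := by
    simp only [mul_sub, Finset.sum_sub_distrib, mul_one, sum_prodProb, sum_prodProb_mul_bitVal]
  rw [e, e2, Finset.mul_sum]
  refine Finset.sum_le_sum fun x _ => ?_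
  rw [← mul_assoc, prodMass_mul_truncProb zs hS]
  refine mul_le_mul_of_nonneg_right ?_ (sub_nonneg.2 (bitVal_le_one _))
  split_ifs
  · exact le_rfl
  · exact (prodProb_pos zs x).le

theorem neg_le_neg_log_of_le_sigmoid {β t : ℝ} (hβ : 0 < β) (h : β ≤ Real.sigmoid t) :
    -t ≤ -Real.log β := by
  rw [← Real.log_inv, ← Real.log_exp (-t)]
  refine Real.log_le_log (Real.exp_pos _) ?_
  rw [Real.sigmoid_def] at h
  have := inv_anti₀ hβ h
  rw [inv_inv] at this
  linarith

theorem abs_le_neg_log_of_sigmoid {β t : ℝ} (hβ : 0 < β) (h0 : β ≤ Real.sigmoid t)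
    (h1 : β ≤ 1 - Real.sigmoid t) : |t| ≤ -Real.log β := by
  rw [← Real.sigmoid_neg] at h1
  have := neg_le_neg_log_of_le_sigmoid hβ h0
  have := neg_le_neg_log_of_le_sigmoid hβ h1
  exact abs_le.2 ⟨by linarith, by linarith⟩

/-! ### A priori bounds, Bregman divergence and the two descent inequalities -/

/-- A truncated product distribution that satisfies the assumptions of the algorithm. -/
structure Admissible {d : ℕ} (zs : Vec d) (S : Finset (Cube d)) (α lam : ℝ) : Prop where
  dim_pos : 0 < d
  nonempty : S.Nonempty
  alpha_pos : 0 < α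
  lam_pos : 0 < lam
  mass : α ≤ prodMass zs S
  anti : Anticoncentrated zs S lam

/-- The vector of coordinatewise means of the product distribution with logits `z`. -/
def sigmoidVec {d : ℕ} (z : Vec d) : Vec d := WithLp.toLp 2 fun i => Real.sigmoid (z i)

/-- The Bregman divergence of the log-partition function. -/
def bregman {d : ℕ} (u z : Vec d) : ℝ :=
  ∑ i, (softplus (z i) - softplus (u i) - Real.sigmoid (u i) * (z i - u i))

theorem crossEntropy_eq_sum {d : ℕ} (μ z : Vec d) :
    crossEntropy μ z = ∑ i, (softplus (z i) - μ i * z i) := by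
  rw [crossEntropy, logPartition, vec_inner_eq, Finset.sum_sub_distrib]

theorem bregman_eq {d : ℕ} (u z : Vec d) :
    bregman u z = crossEntropy (sigmoidVec u) z - crossEntropy (sigmoidVec u) u := by
  rw [crossEntropy_eq_sum, crossEntropy_eq_sum, bregman, ← Finset.sum_sub_distrib]
  exact Finset.sum_congr rfl fun i _ => by simp only [sigmoidVec]; ring

theorem norm_sigmoidVec_sub_le {d : ℕ} (u v : Vec d) :
    ‖sigmoidVec u - sigmoidVec v‖ ≤ ‖u - v‖ := by
  rw [← sq_le_sq₀ (norm_nonneg _) (norm_nonneg _), EuclideanSpace.real_norm_sq_eq,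
    EuclideanSpace.real_norm_sq_eq]
  exact Finset.sum_le_sum fun i _ => sq_le_sq.2 (abs_sigmoid_sub_le _ _)

theorem bregman_lower_bound {d : ℕ} {B : ℝ} {u z : Vec d} (hu : ∀ i, |u i| ≤ B)
    (hz : ∀ i, |z i| ≤ B) : Real.exp (-B) / 8 * ‖z - u‖ ^ 2 ≤ bregman u z := by
  rw [EuclideanSpace.real_norm_sq_eq, Finset.mul_sum, bregman]
  refine Finset.sum_le_sum fun i _ => ?_
  have := softplus_strong_convex (hu i) (hz i)
  simp only [PiLp.sub_apply]
  linarith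

/-- Strong convexity of the log-partition function at `z`, seen from `w`. The divergence differs
from that function by an affine term, whose slope enters the gradient on the right. -/
theorem bregman_three_point {d : ℕ} {B : ℝ} (u : Vec d) {z w : Vec d} (hz : ∀ i, |z i| ≤ B)
    (hw : ∀ i, |w i| ≤ B) :
    bregman u z - bregman u w + Real.exp (-B) / 8 * ‖z - w‖ ^ 2 ≤
      ∑ i, (Real.sigmoid (z i) - Real.sigmoid (u i)) * (z i - w i) := by
  rw [EuclideanSpace.real_norm_sq_eq, Finset.mul_sum, bregman, bregman, ← Finset.sum_sub_distrib,
    ← Finset.sum_add_distrib]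
  refine Finset.sum_le_sum fun i _ => ?_
  have := softplus_strong_convex (hz i) (hw i)
  simp only [PiLp.sub_apply]
  linarith [show Real.exp (-B) / 8 * (z i - w i) ^ 2 = Real.exp (-B) / 8 * (w i - z i) ^ 2 by ring]

/-- The coordinatewise clipped logit. -/
def logitVec {d : ℕ} (β : ℝ) (p : Vec d) : Vec d := WithLp.toLp 2 fun i => clippedLogit β (p i)

namespace Admissible

variable {d : ℕ} {zs : Vec d} {S : Finset (Cube d)} {α lam : ℝ}

theorem alpha_le_one (h : Admissible zs S α lam) : α ≤ 1 := h.mass.trans (prodMass_le_one _ _)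

theorem lam_le_half (h : Admissible zs S α lam) : lam ≤ 1 / 2 := by
  have h1 := lam_le_truncMean h.lam_pos h.anti ⟨0, h.dim_pos⟩
  have h2 := truncMean_le h.nonempty h.lam_pos h.anti ⟨0, h.dim_pos⟩
  linarith

theorem beta_pos (h : Admissible zs S α lam) : 0 < α * lam := mul_pos h.alpha_pos h.lam_pos

theorem beta_le_lam (h : Admissible zs S α lam) : α * lam ≤ lam :=
  mul_le_of_le_one_left h.lam_pos.le h.alpha_le_one

theorem beta_le_alpha (h : Admissible zs S α lam) : α * lam ≤ α :=
  mul_le_of_le_one_right h.alpha_pos.le (h.lam_le_half.trans (by norm_num))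

theorem beta_le_half (h : Admissible zs S α lam) : α * lam ≤ 1 / 2 :=
  h.beta_le_lam.trans h.lam_le_half

theorem beta_le_mean (h : Admissible zs S α lam) (i : Fin d) : α * lam ≤ truncMean zs S i :=
  h.beta_le_lam.trans (lam_le_truncMean h.lam_pos h.anti i)

theorem mean_le (h : Admissible zs S α lam) (i : Fin d) : truncMean zs S i ≤ 1 - α * lam := by
  linarith [truncMean_le h.nonempty h.lam_pos h.anti i, h.beta_le_lam]

/-- Both outcomes of each bit have untruncated probability at least `α * lam`. On the resulting box
the strong convexity constant is `α * lam / 8`. -/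
theorem abs_le (h : Admissible zs S α lam) (i : Fin d) : |zs i| ≤ -Real.log (α * lam) := by
  refine abs_le_neg_log_of_sigmoid h.beta_pos ?_ ?_
  · exact (mul_le_mul h.mass (lam_le_truncMean h.lam_pos h.anti i) h.lam_pos.le
      (prodMass_pos _ h.nonempty).le).trans (mass_mul_truncMean_le zs h.nonempty i)
  · exact (mul_le_mul h.mass (by linarith [truncMean_le h.nonempty h.lam_pos h.anti i]) h.lam_pos.le
      (prodMass_pos _ h.nonempty).le).trans (mass_mul_one_sub_truncMean_le zs h.nonempty i)

theorem exp_neg_bound (h : Admissible zs S α lam) :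
    Real.exp (-(-Real.log (α * lam))) = α * lam := by rw [neg_neg, Real.exp_log h.beta_pos]

theorem one_sub_log_le (h : Admissible zs S α lam) : 1 - Real.log α ≤ 1 / (α * lam) := by
  have h1 := Real.log_le_sub_one_of_pos (inv_pos.2 h.alpha_pos)
  rw [Real.log_inv] at h1
  have h2 : α⁻¹ ≤ (α * lam)⁻¹ := inv_anti₀ h.beta_pos h.beta_le_alpha
  rw [one_div]
  linarith

/-- The logits of the mean of the truncated distribution. -/
abbrev meanLogit (zs : Vec d) (S : Finset (Cube d)) (α lam : ℝ) : Vec d :=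
  logitVec (α * lam) (truncMean zs S)

/-- The true means lie in the range where clipping is inactive, so `meanLogit` is the exact
minimiser of the cross-entropy. -/
theorem sigmoidVec_meanLogit (h : Admissible zs S α lam) :
    sigmoidVec (meanLogit zs S α lam) = truncMean zs S := by
  ext i
  exact sigmoid_clippedLogit h.beta_pos (h.beta_le_mean i) (h.mean_le i)

theorem abs_logitVec_le (h : Admissible zs S α lam) {p : Vec d} (h0 : ∀ i, 0 ≤ p i)
    (h1 : ∀ i, p i ≤ 1) (i : Fin d) : |logitVec (α * lam) p i| ≤ -Real.log (α * lam) :=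
  abs_clippedLogit_le h.beta_pos (h.beta_le_half.trans (by norm_num)) (h0 i) (h1 i)

theorem abs_meanLogit_le (h : Admissible zs S α lam) (i : Fin d) :
    |meanLogit zs S α lam i| ≤ -Real.log (α * lam) :=
  h.abs_logitVec_le (fun i => h.beta_pos.le.trans (h.beta_le_mean i))
    (fun i => (h.mean_le i).trans (by linarith [h.beta_pos])) i

theorem norm_logitVec_sub_le (h : Admissible zs S α lam) (p : Vec d) :
    ‖logitVec (α * lam) p - meanLogit zs S α lam‖ ≤ 2 / (α * lam) * ‖p - truncMean zs S‖ := by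
  have h0 := h.beta_pos
  rw [← sq_le_sq₀ (norm_nonneg _) (by positivity), mul_pow, EuclideanSpace.real_norm_sq_eq,
    EuclideanSpace.real_norm_sq_eq, Finset.mul_sum]
  refine Finset.sum_le_sum fun i _ => ?_
  rw [← mul_pow]
  refine sq_le_sq.2 ?_
  rw [abs_mul, abs_of_pos (by positivity : 0 < 2 / (α * lam))]
  exact abs_clippedLogit_sub_le h0 (h.beta_le_mean i) (h.mean_le i)

/-- The divergence from `meanLogit` to `zs` is the excess cross-entropy of `zs`, at most `-log α`;
strong convexity turns it into a distance, with `8 ≤ 3²`. -/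
theorem norm_meanLogit_sub_le (h : Admissible zs S α lam) :
    ‖meanLogit zs S α lam - zs‖ ≤ 3 / (α * lam) := by
  have h0 := h.beta_pos
  have h1 := bregman_lower_bound h.abs_meanLogit_le h.abs_le
  rw [h.exp_neg_bound, bregman_eq, h.sigmoidVec_meanLogit] at h1
  have h2 := crossEntropy_sub_le zs (meanLogit zs S α lam) h.nonempty h.alpha_pos h.mass
  have h3 := h.one_sub_log_le
  rw [norm_sub_rev, ← sq_le_sq₀ (norm_nonneg _) (by positivity), div_pow, le_div_iff₀ (by positivity)]
  rw [le_div_iff₀ h0] at h3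
  set b := α * lam
  nlinarith

variable {u : Vec d}

theorem norm_sub_le_of_near (h : Admissible zs S α lam)
    (hu : ‖u - meanLogit zs S α lam‖ ≤ α * lam / 4) : ‖u - zs‖ ≤ 4 / (α * lam) := by
  have h0 := h.beta_pos
  have h1 := h.beta_le_half
  have h2 : α * lam / 4 ≤ 1 / (α * lam) := by
    rw [le_div_iff₀ h0]; nlinarith
  calc ‖u - zs‖ = ‖(u - meanLogit zs S α lam) + (meanLogit zs S α lam - zs)‖ := by congr 1; abel
    _ ≤ 1 / (α * lam) + 3 / (α * lam) :=
      (norm_add_le _ _).trans (add_le_add (hu.trans h2) h.norm_meanLogit_sub_le)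
    _ = 4 / (α * lam) := by ring

/-- Accuracy `α * lam / 4` of `u` is chosen so that replacing `μ` by `sigmoidVec u` changes
cross-entropy differences only by a constant over the distances of order `1 / (α * lam)` that occur.
-/
theorem abs_inner_le_of_near (h : Admissible zs S α lam)
    (hu : ‖u - meanLogit zs S α lam‖ ≤ α * lam / 4) {C : ℝ} {w : Vec d}
    (hw : ‖w‖ ≤ C / (α * lam)) : |inner ℝ (sigmoidVec u - truncMean zs S) w| ≤ C / 4 := by
  have h0 := h.beta_pos
  calc |inner ℝ (sigmoidVec u - truncMean zs S) w| ≤ ‖sigmoidVec u - truncMean zs S‖ * ‖w‖ :=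
        abs_real_inner_le_norm _ _
    _ ≤ (α * lam / 4) * (C / (α * lam)) := by
        gcongr
        rw [← h.sigmoidVec_meanLogit]
        exact (norm_sigmoidVec_sub_le _ _).trans hu
    _ = C / 4 := by
        set b := α * lam
        field_simp

theorem crossEntropy_sub_eq (zs z u μ : Vec d) :
    crossEntropy μ zs - crossEntropy μ z =
      bregman u zs - bregman u z + inner ℝ (sigmoidVec u - μ) (zs - z) := by
  simp only [bregman_eq, crossEntropy, inner_sub_left, inner_sub_right]
  ring

/-- Of the threshold, `-log α` is the excess cross-entropy of `zs` relative to `u`, and `1` pays for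
the error of `u`. Membership of `zs` in this sublevel set is what makes steps towards `u` harmless
outside it. -/
theorem bregman_target_le (h : Admissible zs S α lam)
    (hu : ‖u - meanLogit zs S α lam‖ ≤ α * lam / 4) : bregman u zs ≤ 1 - Real.log α := by
  have h1 := crossEntropy_sub_le zs u h.nonempty h.alpha_pos h.mass
  rw [crossEntropy_sub_eq zs u u] at h1
  have h2 := h.abs_inner_le_of_near hu (C := 4) (w := zs - u)
    (by rw [norm_sub_rev]; exact h.norm_sub_le_of_near hu)
  have h3 : bregman u u = 0 := by simp [bregman]
  rw [h3] at h1
  linarith [(_root_.abs_le.1 h2).1]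

/-- The descent constant of the algorithm. -/
abbrev rate (α lam : ℝ) : ℝ := (α * lam) ^ 3 / 800

theorem rate_le (h : Admissible zs S α lam) : rate α lam ≤ α * lam / 8 := by
  have h0 := h.beta_pos
  have h1 := h.beta_le_half
  simp only [rate]
  set b := α * lam
  have : b ^ 3 ≤ b := by
    calc b ^ 3 = b * (b * b) := by ring
      _ ≤ b * (1 * 1) := by gcongr <;> linarith
      _ = b := by ring
  linarith

/-- Here `z` is outside and `zs` inside the sublevel set, so the divergence difference in
`bregman_three_point` is positive and can be dropped. -/
theorem bregman_descent (h : Admissible zs S α lam)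
    (hu : ‖u - meanLogit zs S α lam‖ ≤ α * lam / 4) {z : Vec d}
    (hz : ∀ i, |z i| ≤ -Real.log (α * lam)) (hbad : 1 - Real.log α < bregman u z) :
    rate α lam * ‖z - zs‖ ^ 2 ≤
      ∑ i, (Real.sigmoid (z i) - Real.sigmoid (u i)) * (z i - zs i) := by
  have h1 := bregman_three_point u hz h.abs_le
  rw [h.exp_neg_bound] at h1
  have h2 := h.bregman_target_le hu
  have h3 := mul_le_mul_of_nonneg_right h.rate_le (sq_nonneg ‖z - zs‖)
  linarith

/-- Inside the sublevel set, `z` is within `7 / (α * lam)` of `zs` and its cross-entropy is within a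
constant plus `-log α` of that of `zs`. The first fact makes the minimum in `drift_lower_bound`
quadratic; the second bounds the exponential factor below by `α / 21`. -/
theorem likelihood_descent (h : Admissible zs S α lam)
    (hub : ∀ i, |u i| ≤ -Real.log (α * lam))
    (hu : ‖u - meanLogit zs S α lam‖ ≤ α * lam / 4) {z : Vec d}
    (hz : ∀ i, |z i| ≤ -Real.log (α * lam)) (hgood : bregman u z ≤ 1 - Real.log α) :
    rate α lam * ‖z - zs‖ ^ 2 ≤
      ∑ x ∈ S, prodProb z x * inner ℝ (x.toVec - truncMean zs S) (z - zs) := by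
  have h0 := h.beta_pos
  have hα := h.alpha_pos
  have hlam := h.lam_pos
  refine le_trans ?_ (drift_lower_bound zs z h.nonempty hlam h.anti)
  have h1 := bregman_lower_bound hub hz
  rw [h.exp_neg_bound] at h1
  have h2 := h.one_sub_log_le
  have h3 : ‖z - u‖ ≤ 3 / (α * lam) := by
    rw [← sq_le_sq₀ (norm_nonneg _) (by positivity), div_pow, le_div_iff₀ (by positivity)]
    rw [le_div_iff₀ h0] at h2
    set b := α * lam
    nlinarith
  have h4 : ‖z - zs‖ ≤ 7 / (α * lam) := by
    calc ‖z - zs‖ = ‖(z - u) + (u - zs)‖ := by congr 1; abel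
      _ ≤ 3 / (α * lam) + 4 / (α * lam) :=
        (norm_add_le _ _).trans (add_le_add h3 (h.norm_sub_le_of_near hu))
      _ = 7 / (α * lam) := by ring
  -- The divergence costs `1 - log α` and the error of `u` costs `7 / 4`; the sum is below `3 - log
  -- α`.
  have h5 : Real.log α - 3 ≤
      crossEntropy (truncMean zs S) zs - crossEntropy (truncMean zs S) z := by
    rw [crossEntropy_sub_eq zs z u]
    have h6 := h.abs_inner_le_of_near hu (C := 7) (w := zs - z) (by rwa [norm_sub_rev])
    have h7 := bregman_lower_bound hub h.abs_le
    rw [h.exp_neg_bound] at h7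
    have h8 : 0 ≤ α * lam / 8 * ‖zs - u‖ ^ 2 := by positivity
    linarith [(_root_.abs_le.1 h6).1]
  have h6 : α / 21 ≤
      Real.exp (crossEntropy (truncMean zs S) zs - crossEntropy (truncMean zs S) z) := by
    refine le_trans ?_ (Real.exp_le_exp.2 h5)
    rw [Real.exp_sub, Real.exp_log hα]
    refine div_le_div_of_nonneg_left hα.le (Real.exp_pos _) ?_
    have := Real.exp_one_lt_d9
    calc Real.exp 3 = Real.exp 1 ^ 3 := by rw [← Real.exp_nat_mul]; norm_num
      _ ≤ 2.7182818286 ^ 3 := pow_le_pow_left₀ (Real.exp_pos _).le this.le 3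
      _ ≤ 21 := by norm_num
  have h7 : lam * ‖z - zs‖ ≤ 7 / α := by
    calc lam * ‖z - zs‖ ≤ lam * (7 / (α * lam)) := by gcongr
      _ = 7 / α := by field_simp
  set s := lam * ‖z - zs‖ with hs
  have hs0 : 0 ≤ s := by positivity
  have hα1 := h.alpha_le_one
  have h8 : α / 28 * s ^ 2 ≤ min (s ^ 2 / 4) (s / 2) := by
    refine le_min (by nlinarith [sq_nonneg s]) ?_
    rw [le_div_iff₀ hα] at h7
    nlinarith
  -- The factors collect to `(α * lam)³ / (21 * 28)`, which the `800` in `rate` rounds down.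
  calc rate α lam * ‖z - zs‖ ^ 2 ≤ α * (α / 21) * (lam * (α / 28 * s ^ 2)) := by
        rw [hs, rate]
        have : 0 ≤ (α * lam) ^ 3 * ‖z - zs‖ ^ 2 := by positivity
        nlinarith
    _ ≤ _ := by
        have := h.mass
        gcongr
        · exact mul_nonneg (prodMass_pos zs h.nonempty).le (Real.exp_pos _).le
        · exact (prodMass_pos zs h.nonempty).le

end Admissible

/-! ### One step of projected stochastic gradient descent -/

/-- The square is expanded after dropping the projection. The cross term is the descent inequality,
and the `d` gradient entries are at most `1` in size. -/
theorem Admissible.bregman_step {d : ℕ} {zs : Vec d} {S : Finset (Cube d)} {α lam : ℝ} {u : Vec d}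
    (h : Admissible zs S α lam) (hu : ‖u - meanLogit zs S α lam‖ ≤ α * lam / 4) {z : Vec d}
    (hz : ∀ i, |z i| ≤ -Real.log (α * lam)) (hbad : 1 - Real.log α < bregman u z)
    {η : ℝ} (hη : 0 ≤ η) :
    ∑ i, (clip (-Real.log (α * lam)) (z i + η * (Real.sigmoid (u i) - Real.sigmoid (z i)))
      - zs i) ^ 2 ≤ (1 - 2 * η * rate α lam) * ‖z - zs‖ ^ 2 + η ^ 2 * d := by
  have h1 := mul_le_mul_of_nonneg_left (h.bregman_descent hu hz hbad) (by positivity : 0 ≤ 2 * η)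
  have h2 : ∀ i, (clip (-Real.log (α * lam))
      (z i + η * (Real.sigmoid (u i) - Real.sigmoid (z i))) - zs i) ^ 2 ≤
      (z i - zs i) ^ 2 - 2 * η * ((Real.sigmoid (z i) - Real.sigmoid (u i)) * (z i - zs i)) +
        η ^ 2 := fun i => by
    refine (sq_le_sq.2 (abs_clip_sub_le (h.abs_le i))).trans ?_
    have h3 : (Real.sigmoid (u i) - Real.sigmoid (z i)) ^ 2 ≤ 1 := by
      rw [sq_le_one_iff_abs_le_one, _root_.abs_le]
      constructor <;> linarith [Real.sigmoid_pos (u i), Real.sigmoid_pos (z i),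
        Real.sigmoid_lt_one (u i), Real.sigmoid_lt_one (z i)]
    nlinarith [mul_le_mul_of_nonneg_left h3 (sq_nonneg η)]
  refine (Finset.sum_le_sum fun i _ => h2 i).trans ?_
  simp only [Finset.sum_add_distrib, Finset.sum_sub_distrib, ← Finset.mul_sum, Finset.sum_const,
    Finset.card_univ, Fintype.card_fin, nsmul_eq_mul]
  have e : ‖z - zs‖ ^ 2 = ∑ i, (z i - zs i) ^ 2 := by
    rw [EuclideanSpace.real_norm_sq_eq]; rfl
  rw [← e]
  linarith

-- One draw `y` and one query suffice: averaging over `x` replaces `x` by `μ`, and the acceptance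
-- indicator restricts the sum over `y` to `S`, which gives exactly the drift of
-- `likelihood_descent`. Waiting for an accepted `y` is never needed.
open Classical in
theorem Admissible.likelihood_step {d : ℕ} {zs : Vec d} {S : Finset (Cube d)} {α lam : ℝ}
    {u : Vec d} (h : Admissible zs S α lam) (hub : ∀ i, |u i| ≤ -Real.log (α * lam))
    (hu : ‖u - meanLogit zs S α lam‖ ≤ α * lam / 4) {z : Vec d}
    (hz : ∀ i, |z i| ≤ -Real.log (α * lam)) (hgood : bregman u z ≤ 1 - Real.log α)
    {η : ℝ} (hη : 0 ≤ η) :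
    ∑ y, prodProb z y * ∑ x, truncProb zs S x *
      ∑ i, (clip (-Real.log (α * lam))
        (z i + η * ((if y ∈ S then 1 else 0) * (bitVal (x i) - bitVal (y i)))) - zs i) ^ 2 ≤
      (1 - 2 * η * rate α lam) * ‖z - zs‖ ^ 2 + η ^ 2 * d := by
  have h1 := mul_le_mul_of_nonneg_left (h.likelihood_descent hub hu hz hgood)
    (by positivity : 0 ≤ 2 * η)
  have e : ‖z - zs‖ ^ 2 = ∑ i, (z i - zs i) ^ 2 := by
    rw [EuclideanSpace.real_norm_sq_eq]; rfl
  have h2 : ∀ x y : Cube d, ∑ i, (clip (-Real.log (α * lam))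
        (z i + η * ((if y ∈ S then 1 else 0) * (bitVal (x i) - bitVal (y i)))) - zs i) ^ 2 ≤
      ‖z - zs‖ ^ 2 + η ^ 2 * d +
        2 * η * (if y ∈ S then 1 else 0) * inner ℝ (x.toVec - y.toVec) (z - zs) := by
    intro x y
    have h3 : ∀ i, (clip (-Real.log (α * lam))
        (z i + η * ((if y ∈ S then 1 else 0) * (bitVal (x i) - bitVal (y i)))) - zs i) ^ 2 ≤
        (z i - zs i) ^ 2 + η ^ 2 +
          2 * η * (if y ∈ S then 1 else 0) * ((bitVal (x i) - bitVal (y i)) * (z i - zs i)) := by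
      intro i
      refine (sq_le_sq.2 (abs_clip_sub_le (h.abs_le i))).trans ?_
      have h3 : ((if y ∈ S then (1 : ℝ) else 0) * (bitVal (x i) - bitVal (y i))) ^ 2 ≤ 1 := by
        rw [sq_le_one_iff_abs_le_one, abs_mul]
        refine mul_le_one₀ (by split_ifs <;> simp) (abs_nonneg _) ?_
        rw [_root_.abs_le]
        constructor <;> linarith [bitVal_nonneg (x i), bitVal_nonneg (y i), bitVal_le_one (x i),
          bitVal_le_one (y i)]
      nlinarith [mul_le_mul_of_nonneg_left h3 (sq_nonneg η)]
    refine (Finset.sum_le_sum fun i _ => h3 i).trans ?_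
    simp only [Finset.sum_add_distrib, ← Finset.mul_sum, Finset.sum_const,
      Finset.card_univ, Fintype.card_fin, nsmul_eq_mul, vec_inner_eq, PiLp.sub_apply,
      Cube.toVec_apply, e]
    linarith
  calc _ ≤ ∑ y, prodProb z y * ∑ x, truncProb zs S x * (‖z - zs‖ ^ 2 + η ^ 2 * d +
        2 * η * (if y ∈ S then 1 else 0) * inner ℝ (x.toVec - y.toVec) (z - zs)) := by
        gcongr with y _ x _
        · exact (prodProb_pos z y).le
        · exact truncProb_nonneg _ _ _
        · exact h2 x y
    _ = ∑ y, prodProb z y * (‖z - zs‖ ^ 2 + η ^ 2 * d -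
        2 * η * (if y ∈ S then 1 else 0) * inner ℝ (y.toVec - truncMean zs S) (z - zs)) := by
        refine Finset.sum_congr rfl fun y _ => ?_
        congr 1
        have : ∀ x : Cube d, truncProb zs S x * (‖z - zs‖ ^ 2 + η ^ 2 * d +
            2 * η * (if y ∈ S then 1 else 0) * inner ℝ (x.toVec - y.toVec) (z - zs)) =
            truncProb zs S x * (‖z - zs‖ ^ 2 + η ^ 2 * d -
              2 * η * (if y ∈ S then 1 else 0) * inner ℝ (y.toVec - truncMean zs S) (z - zs)) +
            2 * η * (if y ∈ S then 1 else 0) *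
              (truncProb zs S x * inner ℝ (x.toVec - truncMean zs S) (z - zs)) := fun x => by
          simp only [inner_sub_left]
          ring
        simp only [this, Finset.sum_add_distrib, ← Finset.sum_mul, sum_truncProb zs h.nonempty,
          ← Finset.mul_sum, sum_truncProb_mul_inner_sub zs h.nonempty]
        ring
    _ = ‖z - zs‖ ^ 2 + η ^ 2 * d -
        2 * η * ∑ x ∈ S, prodProb z x * inner ℝ (x.toVec - truncMean zs S) (z - zs) := by
        simp only [mul_sub (prodProb _ _), Finset.sum_sub_distrib, ← Finset.sum_mul, sum_prodProb,
          one_mul]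
        congr 1
        rw [← Finset.sum_subset (Finset.subset_univ S), Finset.mul_sum]
        · refine Finset.sum_congr rfl fun x hx => ?_
          rw [if_pos hx]; ring
        · intro x _ hx
          simp [hx]
    _ ≤ _ := by linarith

end

noncomputable section

/-! ### Expectations under probability mass functions -/

namespace PMF

variable {β γ : Type*}

/-- The expectation of a nonnegative function. -/
def expect (ν : PMF β) (f : β → ENNReal) : ENNReal := ∑' b, ν b * f b

theorem expect_pure (b : β) (f : β → ENNReal) : (pure b).expect f = f b := by
  rw [expect, tsum_eq_single b]
  · simp
  · intro c hc
    simp [hc]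

theorem expect_bind (ν : PMF β) (k : β → PMF γ) (f : γ → ENNReal) :
    (ν.bind k).expect f = ν.expect fun b => (k b).expect f := by
  simp only [expect, bind_apply, ← ENNReal.tsum_mul_right, ← ENNReal.tsum_mul_left, mul_assoc]
  exact ENNReal.tsum_comm

theorem expect_map (ν : PMF β) (g : β → γ) (f : γ → ENNReal) :
    (ν.map g).expect f = ν.expect fun b => f (g b) := by
  rw [map, expect_bind]
  simp only [Function.comp, expect_pure]

theorem expect_mono {ν : PMF β} {f g : β → ENNReal} (h : ∀ b ∈ ν.support, f b ≤ g b) :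
    ν.expect f ≤ ν.expect g := by
  refine ENNReal.tsum_le_tsum fun b => ?_
  by_cases hb : b ∈ ν.support
  · exact mul_le_mul_right (h b hb) _
  · simp [(ν.apply_eq_zero_iff b).2 hb]

theorem expect_const (ν : PMF β) (c : ENNReal) : ν.expect (fun _ => c) = c := by
  rw [expect, ENNReal.tsum_mul_right, ν.tsum_coe, one_mul]

theorem expect_le {ν : PMF β} {f : β → ENNReal} {c : ENNReal} (h : ∀ b ∈ ν.support, f b ≤ c) :
    ν.expect f ≤ c :=
  (expect_mono h).trans_eq (ν.expect_const c)

theorem expect_affine (ν : PMF β) (f : β → ENNReal) (a b : ENNReal) :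
    ν.expect (fun x => a * f x + b) = a * ν.expect f + b := by
  conv_rhs => rw [← ν.expect_const b]
  simp only [expect, mul_add, ENNReal.tsum_add, ← ENNReal.tsum_mul_left]
  congr 2 with x
  ring

theorem expect_fintype [Fintype β] (ν : PMF β) (f : β → ENNReal) :
    ν.expect f = ∑ b, ν b * f b := tsum_fintype _

open Classical in
theorem le_toOuterMeasure (ν : PMF β) (A : Set β) {c c' : ENNReal} (hc : 1 - c = c')
    (h : ν.expect (fun b => if b ∈ A then 0 else 1) ≤ c) : c' ≤ ν.toOuterMeasure A := by
  have h1 : 1 = ν.toOuterMeasure A + ν.expect (fun b => if b ∈ A then 0 else 1) := by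
    rw [toOuterMeasure_apply, expect, ← ENNReal.tsum_add, ← ν.tsum_coe]
    refine tsum_congr fun b => ?_
    by_cases hb : b ∈ A <;> simp [hb]
  rw [← hc]
  refine tsub_le_iff_right.2 ?_
  exact h1.le.trans (add_le_add le_rfl h)

end PMF

/-! ### Program logic for the real RAM -/

namespace Prog

variable {d : ℕ} (μ : PMF (Cube d)) (S : Finset (Cube d))

/-- The state after `n` further iterations of a loop with body `p`. -/
def iter (p : Prog) (n : ℕ) (s : RamState) : PMF RamState :=
  (fun ν : PMF RamState => ν.bind fun t => p.run μ S (t.tick 1))^[n] (PMF.pure s)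

theorem run_loop (r : ℕ) (p : Prog) (s : RamState) :
    (loop r p).run μ S s = p.iter μ S (s.reg r) (s.tick 1) := rfl

theorem iter_zero (p : Prog) (s : RamState) : p.iter μ S 0 s = PMF.pure s := rfl

theorem iter_succ (p : Prog) (n : ℕ) (s : RamState) :
    p.iter μ S (n + 1) s = (p.iter μ S n s).bind fun t => p.run μ S (t.tick 1) := by
  rw [iter, Function.iterate_succ_apply']
  rfl

/-- Peels off the first iteration instead of the last, as the induction on the remaining coins in
`expect_coinLoop_le` requires. -/
theorem iter_succ' (p : Prog) (n : ℕ) (s : RamState) :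
    p.iter μ S (n + 1) s = (p.run μ S (s.tick 1)).bind (p.iter μ S n) := by
  induction n generalizing s with
  | zero => rw [iter_succ, iter_zero, PMF.pure_bind]; exact (PMF.bind_pure _).symm
  | succ n ih =>
    rw [iter_succ, ih, PMF.bind_bind]
    congr 1
    funext t
    rw [iter_succ]

/-- All runs of `p` from `s` end in a state that satisfies `Q`. -/
def Ensures (p : Prog) (s : RamState) (Q : RamState → Prop) : Prop :=
  ∀ t ∈ (p.run μ S s).support, Q t

variable {μ S} {p q : Prog} {s : RamState} {Q : RamState → Prop}

theorem Ensures.mono {Q' : RamState → Prop} (h : p.Ensures μ S s Q) (hQ : ∀ t, Q t → Q' t) :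
    p.Ensures μ S s Q' := fun t ht => hQ t (h t ht)

theorem Ensures.and {Q' : RamState → Prop} (h : p.Ensures μ S s Q) (h' : p.Ensures μ S s Q') :
    p.Ensures μ S s fun t => Q t ∧ Q' t := fun t ht => ⟨h t ht, h' t ht⟩

theorem ensures_seq (h : p.Ensures μ S s fun t => q.Ensures μ S t Q) :
    (seq p q).Ensures μ S s Q := by
  intro t ht
  obtain ⟨u, hu, ht⟩ := (PMF.mem_support_bind_iff _ _ _).1 ht
  exact h u hu t ht

theorem ensures_skip (h : Q (s.tick 1)) : skip.Ensures μ S s Q := by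
  intro t ht
  rwa [(PMF.mem_support_pure_iff _ _).1 ht]

theorem ensures_zero {r : ℕ} (h : Q ((s.setReg r 0).tick 1)) : (zero r).Ensures μ S s Q := by
  intro t ht
  rwa [(PMF.mem_support_pure_iff _ _).1 ht]

theorem ensures_succ {r : ℕ} (h : Q ((s.setReg r (s.reg r + 1)).tick 1)) :
    (succ r).Ensures μ S s Q := by
  intro t ht
  rwa [(PMF.mem_support_pure_iff _ _).1 ht]

theorem ensures_copy {r r' : ℕ} (h : Q ((s.setReg r (s.reg r')).tick 1)) :
    (copy r r').Ensures μ S s Q := by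
  intro t ht
  rwa [(PMF.mem_support_pure_iff _ _).1 ht]

theorem ensures_ceil {r : ℕ} {e : RExpr}
    (h : Q ((s.setReg r ⌈e.eval s⌉₊).tick (e.cost + ⌈e.eval s⌉₊ + 1))) :
    (ceil r e).Ensures μ S s Q := by
  intro t ht
  rwa [(PMF.mem_support_pure_iff _ _).1 ht]

theorem ensures_assign {a r : ℕ} {e : RExpr}
    (h : Q ((s.setMem a (s.reg r) (e.eval s)).tick (e.cost + 1))) :
    (assign a r e).Ensures μ S s Q := by
  intro t ht
  rwa [(PMF.mem_support_pure_iff _ _).1 ht]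

theorem ensures_ifLE {e f : RExpr}
    (hp : e.eval s ≤ f.eval s → p.Ensures μ S (s.tick (e.cost + f.cost + 1)) Q)
    (hq : ¬ e.eval s ≤ f.eval s → q.Ensures μ S (s.tick (e.cost + f.cost + 1)) Q) :
    (ifLE e f p q).Ensures μ S s Q := by
  intro t ht
  rw [Prog.run] at ht
  split_ifs at ht with h
  · exact hp h t ht
  · exact hq h t ht

theorem ensures_coin {a r : ℕ} {e : RExpr}
    (h : ∀ b, Q ((s.setMem a (s.reg r) (bitVal b)).tick (e.cost + 1))) :
    (coin a r e).Ensures μ S s Q := by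
  intro t ht
  obtain ⟨b, _, rfl⟩ := (PMF.mem_support_map_iff _ _ _).1 ht
  exact h b

theorem ensures_sample {a : ℕ} (h : ∀ x : Cube d, Q (((s.writeCube a x).tick (d + 1)).countSample)) :
    (sample a).Ensures μ S s Q := by
  intro t ht
  obtain ⟨b, _, rfl⟩ := (PMF.mem_support_map_iff _ _ _).1 ht
  exact h b

open Classical in
theorem ensures_query {a r b : ℕ}
    (h : Q (((s.setMem a (s.reg r) (if s.readCube d b ∈ S then 1 else 0)).tick (d + 1)).countQuery)) :
    (query a r b).Ensures μ S s Q := by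
  intro t ht
  rwa [(PMF.mem_support_pure_iff _ _).1 ht]

theorem ensures_iter (I : ℕ → RamState → Prop) {n : ℕ}
    (hI : ∀ k < n, ∀ t, I k t → p.Ensures μ S (t.tick 1) (I (k + 1))) (h0 : I 0 s) :
    ∀ t ∈ (p.iter μ S n s).support, I n t := by
  induction n with
  | zero =>
    intro t ht
    rwa [(PMF.mem_support_pure_iff _ _).1 ht]
  | succ n ih =>
    intro t ht
    rw [iter_succ] at ht
    obtain ⟨u, hu, ht⟩ := (PMF.mem_support_bind_iff _ _ _).1 ht
    exact hI n n.lt_succ_self u (ih (fun k hk => hI k (hk.trans n.lt_succ_self)) u hu) t ht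

theorem ensures_loop {r : ℕ} (I : ℕ → RamState → Prop)
    (hI : ∀ k < s.reg r, ∀ t, I k t → p.Ensures μ S (t.tick 1) (I (k + 1))) (h0 : I 0 (s.tick 1)) :
    (loop r p).Ensures μ S s (I (s.reg r)) :=
  ensures_iter I hI h0

theorem expect_seq (f : RamState → ENNReal) :
    ((seq p q).run μ S s).expect f = (p.run μ S s).expect fun t => (q.run μ S t).expect f :=
  PMF.expect_bind _ _ _

theorem expect_seq_le {f : RamState → ENNReal} {c : ENNReal}
    (h : p.Ensures μ S s fun t => (q.run μ S t).expect f ≤ c) :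
    ((seq p q).run μ S s).expect f ≤ c := by
  rw [expect_seq]
  exact PMF.expect_le h

/-- A potential that changes affinely in expectation along the iterations of a loop. -/
theorem expect_loop_le {r : ℕ} (I : ℕ → RamState → Prop) (Ψ : ℕ → RamState → ENNReal)
    {a b : ENNReal} (e : ℕ → ENNReal)
    (hI : ∀ k t, I k t → p.Ensures μ S (t.tick 1) (I (k + 1)))
    (hE : ∀ k t, I k t → (p.run μ S (t.tick 1)).expect (Ψ (k + 1)) ≤ a * Ψ k t + b)
    (he : ∀ k, a * e k + b ≤ e (k + 1)) (h0 : I 0 (s.tick 1)) (he0 : Ψ 0 (s.tick 1) ≤ e 0) :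
    ((loop r p).run μ S s).expect (Ψ (s.reg r)) ≤ e (s.reg r) := by
  rw [run_loop]
  generalize s.reg r = n
  induction n with
  | zero => rwa [iter_zero, PMF.expect_pure]
  | succ n ih =>
    rw [iter_succ, PMF.expect_bind]
    calc _ ≤ (p.iter μ S n (s.tick 1)).expect fun t => a * Ψ n t + b :=
          PMF.expect_mono fun t ht => hE n t (ensures_iter I (fun k _ => hI k) h0 t ht)
      _ = a * (p.iter μ S n (s.tick 1)).expect (Ψ n) + b := PMF.expect_affine _ _ _ _
      _ ≤ a * e n + b := by gcongr
      _ ≤ e (n + 1) := he n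

/-! Frames and costs -/

/-- `p` does not write to array `a`. -/
def KeepsMem (a : ℕ) : Prog → Prop
  | seq p q => p.KeepsMem a ∧ q.KeepsMem a
  | assign a' _ _ => a' ≠ a
  | ifLE _ _ p q => p.KeepsMem a ∧ q.KeepsMem a
  | loop _ p => p.KeepsMem a
  | coin a' _ _ => a' ≠ a
  | sample a' => a' ≠ a
  | query a' _ _ => a' ≠ a
  | _ => True

/-- `p` does not write to register `r`. -/
def KeepsReg (r : ℕ) : Prog → Prop
  | seq p q => p.KeepsReg r ∧ q.KeepsReg r
  | zero r' => r' ≠ r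
  | succ r' => r' ≠ r
  | copy r' _ => r' ≠ r
  | ceil r' _ => r' ≠ r
  | ifLE _ _ p q => p.KeepsReg r ∧ q.KeepsReg r
  | loop _ p => p.KeepsReg r
  | _ => True

/-- Makes frame conditions syntactic, so that for concrete programs `simp` settles them. -/
theorem KeepsMem.ensures {a : ℕ} (h : p.KeepsMem a) (s : RamState) :
    p.Ensures μ S s fun t => t.mem a = s.mem a := by
  induction p generalizing s with
  | skip => exact ensures_skip rfl
  | seq p q hp hq =>
    exact ensures_seq ((hp h.1 s).mono fun t ht => (hq h.2 t).mono fun u hu => hu.trans ht)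
  | zero r => exact ensures_zero rfl
  | succ r => exact ensures_succ rfl
  | copy r r' => exact ensures_copy rfl
  | ceil r e => exact ensures_ceil rfl
  | assign a' r e => exact ensures_assign (Function.update_of_ne h.symm _ _)
  | ifLE e f p q hp hq => exact ensures_ifLE (fun _ => hp h.1 _) fun _ => hq h.2 _
  | loop r p hp =>
    exact ensures_loop (fun _ t => t.mem a = s.mem a)
      (fun k _ t ht => (hp h (t.tick 1)).mono fun u hu => hu.trans ht) rfl
  | coin a' r e => exact ensures_coin fun b => Function.update_of_ne h.symm _ _
  | sample a' => exact ensures_sample fun x => Function.update_of_ne h.symm _ _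
  | query a' r b => exact ensures_query (Function.update_of_ne h.symm _ _)

theorem KeepsReg.ensures {r : ℕ} (h : p.KeepsReg r) (s : RamState) :
    p.Ensures μ S s fun t => t.reg r = s.reg r := by
  induction p generalizing s with
  | skip => exact ensures_skip rfl
  | seq p q hp hq =>
    exact ensures_seq ((hp h.1 s).mono fun t ht => (hq h.2 t).mono fun u hu => hu.trans ht)
  | zero r => exact ensures_zero (Function.update_of_ne h.symm _ _)
  | succ r => exact ensures_succ (Function.update_of_ne h.symm _ _)
  | copy r r' => exact ensures_copy (Function.update_of_ne h.symm _ _)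
  | ceil r e => exact ensures_ceil (Function.update_of_ne h.symm _ _)
  | assign a' r e => exact ensures_assign rfl
  | ifLE e f p q hp hq => exact ensures_ifLE (fun _ => hp h.1 _) fun _ => hq h.2 _
  | loop r' p hp =>
    exact ensures_loop (fun _ t => t.reg r = s.reg r)
      (fun k _ t ht => (hp h (t.tick 1)).mono fun u hu => hu.trans ht) rfl
  | coin a' r e => exact ensures_coin fun b => rfl
  | sample a' => exact ensures_sample fun x => rfl
  | query a' r b => exact ensures_query rfl

/-- `p` runs no `ceil`, and every register that counts a loop of `p` satisfies `L` and is not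
written to by `p`. -/
def Static (L : ℕ → Prop) : Prog → Prop
  | seq p q => p.Static L ∧ q.Static L
  | zero r => ¬ L r
  | succ r => ¬ L r
  | copy r _ => ¬ L r
  | ceil _ _ => False
  | ifLE _ _ p q => p.Static L ∧ q.Static L
  | loop r p => L r ∧ p.Static L
  | _ => True

/-- A bound on the number of steps of `p`, when register `r` contains `R r`. -/
def timeBound (d : ℕ) (R : ℕ → ℕ) : Prog → ℕ
  | seq p q => p.timeBound d R + q.timeBound d R
  | assign _ _ e => e.cost + 1
  | ifLE e f p q => e.cost + f.cost + 1 + (p.timeBound d R + q.timeBound d R)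
  | loop r p => R r * (p.timeBound d R + 1) + 1
  | coin _ _ e => e.cost + 1
  | sample _ => d + 1
  | query _ _ _ => d + 1
  | _ => 1

/-- A bound on the number of samples and queries of `p`, when register `r` contains `R r`. -/
def oracleBound (R : ℕ → ℕ) : Prog → ℕ
  | seq p q => p.oracleBound R + q.oracleBound R
  | ifLE _ _ p q => p.oracleBound R + q.oracleBound R
  | loop r p => R r * p.oracleBound R
  | sample _ => 1
  | query _ _ _ => 1
  | _ => 0

/-- Loop counters are never overwritten, so every iteration count is known from the start and costs
can be read off the syntax. `ceil` is excluded because its cost depends on the data. -/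
theorem Static.ensures {L : ℕ → Prop} {R : ℕ → ℕ} (h : p.Static L) (s : RamState)
    (hs : ∀ r, L r → s.reg r = R r) :
    p.Ensures μ S s fun t => (∀ r, L r → t.reg r = R r) ∧ t.time ≤ s.time + p.timeBound d R ∧
      t.samples + t.queries ≤ s.samples + s.queries + p.oracleBound R := by
  -- This depends on `s`, so the induction carries it along, and each induction hypothesis asks for
  -- it anew.
  have upd : ∀ {r n : ℕ}, ¬ L r → ∀ r', L r' → Function.update s.reg r n r' = R r' :=
    fun {r n} hr r' hr' => by
      rw [Function.update_of_ne, hs r' hr']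
      rintro rfl
      exact hr hr'
  induction p generalizing s with
  | skip => exact ensures_skip ⟨hs, by simp [RamState.tick, timeBound], by simp [RamState.tick]⟩
  | seq p q hp hq =>
    refine ensures_seq ((hp h.1 s hs upd).mono fun t ht => ?_)
    refine (hq h.2 t ht.1 ?_).mono fun u hu => ⟨hu.1, ?_, ?_⟩
    · intro r n hr r' hr'
      rw [Function.update_of_ne, ht.1 r' hr']
      rintro rfl
      exact hr hr'
    · have := hu.2.1; have := ht.2.1; simp only [timeBound]; omega
    · have := hu.2.2; have := ht.2.2; simp only [oracleBound]; omega
  | zero r => exact ensures_zero ⟨upd h, by simp [RamState.tick, RamState.setReg, timeBound],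
      by simp [RamState.tick, RamState.setReg]⟩
  | succ r => exact ensures_succ ⟨upd h, by simp [RamState.tick, RamState.setReg, timeBound],
      by simp [RamState.tick, RamState.setReg]⟩
  | copy r r' => exact ensures_copy ⟨upd h, by simp [RamState.tick, RamState.setReg, timeBound],
      by simp [RamState.tick, RamState.setReg]⟩
  | ceil r e => exact h.elim
  | assign a' r e => exact ensures_assign ⟨hs, by simp [RamState.tick, RamState.setMem, timeBound],
      by simp [RamState.tick, RamState.setMem]⟩
  | ifLE e f p q hp hq =>
    refine ensures_ifLE (fun _ => (hp h.1 (s.tick (e.cost + f.cost + 1)) hs upd).mono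
      fun t ht => ⟨ht.1, ?_, ?_⟩)
      fun _ => (hq h.2 (s.tick (e.cost + f.cost + 1)) hs upd).mono
      fun t ht => ⟨ht.1, ?_, ?_⟩ <;>
    · have h1 := ht.2.1
      have h2 := ht.2.2
      simp only [RamState.tick] at h1 h2
      simp only [timeBound, oracleBound]
      omega
  | loop r p hp =>
    have hr := hs r h.1
    have := ensures_loop (μ := μ) (S := S) (p := p) (s := s) (r := r)
      (fun k t => (∀ r, L r → t.reg r = R r) ∧ t.time ≤ s.time + 1 + k * (p.timeBound d R + 1) ∧
        t.samples + t.queries ≤ s.samples + s.queries + k * p.oracleBound R)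
      (fun k _ t ht => (hp h.2 (t.tick 1) ht.1 ?_).mono fun u hu => ⟨hu.1, ?_, ?_⟩)
      ⟨hs, by simp [RamState.tick], by simp [RamState.tick]⟩
    · refine this.mono fun t ht => ⟨ht.1, ?_, ?_⟩
      · have := ht.2.1
        rw [hr] at this
        simp only [timeBound]
        omega
      · have := ht.2.2
        rw [hr] at this
        simpa only [oracleBound] using this
    · intro r n hr r' hr'
      rw [Function.update_of_ne]
      · exact ht.1 r' hr'
      · rintro rfl
        exact hr hr'
    · have h1 := hu.2.1
      have h2 := ht.2.1
      simp only [RamState.tick] at h1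
      rw [add_mul]
      omega
    · have h1 := hu.2.2
      have h2 := ht.2.2
      simp only [RamState.tick] at h1
      rw [add_mul]
      omega
  | coin a' r e => exact ensures_coin fun b => ⟨hs,
      by simp [RamState.tick, RamState.setMem, timeBound], by simp [RamState.tick, RamState.setMem]⟩
  | sample a' => exact ensures_sample fun x => ⟨hs,
      by simp [RamState.tick, RamState.countSample, RamState.writeCube, timeBound],
      by simp [RamState.tick, RamState.countSample, RamState.writeCube, oracleBound]; omega⟩
  | query a' r b => exact ensures_query ⟨hs,
      by simp [RamState.tick, RamState.countQuery, RamState.setMem, timeBound],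
      by simp [RamState.tick, RamState.countQuery, RamState.setMem, oracleBound]; omega⟩

end Prog

end

noncomputable section

/-! ### Loops over the coordinates -/

namespace Prog

/-- Run `body` for the values `0, …, d - 1` of register `3`. -/
def forEach (body : Prog) : Prog := seq (zero 3) (loop 0 (seq body (succ 3)))

section

variable {d : ℕ} {μ : PMF (Cube d)} {S : Finset (Cube d)} {s : RamState}

/-- The invariant speaks of real arrays only. Registers other than the index `3`, and arrays that
the body leaves alone, are tracked automatically. -/
theorem ensures_forEach {body : Prog} (hk : ∀ r, body.KeepsReg r)
    (I : ℕ → (ℕ → ℕ → ℝ) → Prop) (h0 : I 0 s.mem)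
    (hI : ∀ k < s.reg 0, ∀ t : RamState, t.reg 3 = k → (∀ r ≠ 3, t.reg r = s.reg r) →
      (∀ a, body.KeepsMem a → t.mem a = s.mem a) → I k t.mem →
      body.Ensures μ S t fun u => I (k + 1) u.mem) :
    (forEach body).Ensures μ S s fun t => (∀ r ≠ 3, t.reg r = s.reg r) ∧
      (∀ a, body.KeepsMem a → t.mem a = s.mem a) ∧ I (s.reg 0) t.mem := by
  refine ensures_seq (ensures_zero ?_)
  have hn : ((s.setReg 3 0).tick 1).reg 0 = s.reg 0 := by simp [RamState.tick, RamState.setReg]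
  have := ensures_loop (μ := μ) (S := S) (p := seq body (succ 3)) (s := (s.setReg 3 0).tick 1)
    (r := 0)
    (fun k t => t.reg 3 = k ∧ (∀ r ≠ 3, t.reg r = s.reg r) ∧
      (∀ a, body.KeepsMem a → t.mem a = s.mem a) ∧ I k t.mem) ?_ ?_
  · rw [hn] at this
    exact this.mono fun t ht => ht.2
  · rw [hn]
    rintro k hk' t ⟨h3, hr, hm, hi⟩
    refine ensures_seq ?_
    have e1 := hI k hk' (t.tick 1) h3 hr hm hi
    intro u hu
    have hreg : ∀ r, u.reg r = t.reg r := fun r => (hk r).ensures (t.tick 1) u hu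
    refine ensures_succ ⟨?_, fun r hr' => ?_, fun a ha => ?_, e1 u hu⟩
    · simp [RamState.tick, RamState.setReg, hreg, h3]
    · simp [RamState.tick, RamState.setReg, hr', hreg, hr r hr']
    · exact (ha.ensures (t.tick 1) u hu).trans (hm a ha)
  · refine ⟨?_, fun r hr => Function.update_of_ne hr _ _, fun a _ => rfl, h0⟩
    simp [RamState.tick, RamState.setReg]

/-- Add the values of `e` into entry `0` of array `a`. -/
def sumLoop (a : ℕ) (e : RExpr) : Prog :=
  seq (assign a 9 (.const 0)) (forEach (assign a 9 (.add (.cell a 9) e)))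

theorem ensures_sumLoop {a : ℕ} {e : RExpr} (h9 : s.reg 9 = 0) (g : ℕ → ℝ)
    (he : ∀ k < s.reg 0, ∀ t : RamState, t.reg 3 = k → (∀ r ≠ 3, t.reg r = s.reg r) →
      (∀ b ≠ a, t.mem b = s.mem b) → e.eval t = g k) :
    (sumLoop a e).Ensures μ S s fun t => (∀ r ≠ 3, t.reg r = s.reg r) ∧
      (∀ b ≠ a, t.mem b = s.mem b) ∧ t.mem a 0 = ∑ k ∈ Finset.range (s.reg 0), g k := by
  refine ensures_seq (ensures_assign ?_)
  have hfr : ∀ b ≠ a, (s.setMem a (s.reg 9) ((RExpr.const 0).eval s)).mem b = s.mem b :=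
    fun b hb => Function.update_of_ne hb _ _
  refine (ensures_forEach (body := assign a 9 (.add (.cell a 9) e)) (fun r => trivial)
    (fun k m => m a 0 = ∑ k ∈ Finset.range k, g k) ?_ ?_).mono
    fun t ht => ⟨ht.1, fun b hb => (ht.2.1 b hb.symm).trans (hfr b hb), ht.2.2⟩
  · simp [RamState.tick, RamState.setMem, h9, RExpr.eval]
  · intro k hk t h3 hr hm hi
    have h9' : t.reg 9 = 0 := (hr 9 (by decide)).trans h9
    refine ensures_assign ?_
    rw [Finset.sum_range_succ, ← he k hk t h3 hr fun b hb => (hm b hb.symm).trans (hfr b hb), ← hi]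
    simp [RamState.tick, RamState.setMem, h9', RExpr.eval]

/-! ### Coins -/

/-- The probability of `y`, given that its first `k` bits are those of `y₀` and that the others are
independent with distributions `p i`. -/
def partialWeight (p : Fin d → Bool → ENNReal) (k : ℕ) (y₀ y : Cube d) : ENNReal :=
  ∏ i : Fin d, if i.val < k then (if y i = y₀ i then 1 else 0) else p i (y i)

/-- The martingale property of revealing bit `k`: averaging over its value restores the weight with
one bit fewer revealed. -/
theorem sum_partialWeight_succ (p : Fin d → Bool → ENNReal) (k : Fin d) (y₀ y : Cube d) :
    ∑ b, p k b * partialWeight p (k + 1) (Function.update y₀ k b) y =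
      partialWeight p k y₀ y := by
  have h1 : ∀ b, partialWeight p (k + 1) (Function.update y₀ k b) y =
      (if y k = b then 1 else 0) * ∏ i ∈ Finset.univ.erase k,
        if i.val < k.val then (if y i = y₀ i then 1 else 0) else p i (y i) := fun b => by
    rw [partialWeight, ← Finset.mul_prod_erase _ _ (Finset.mem_univ k)]
    congr 1
    · simp
    · refine Finset.prod_congr rfl fun i hi => ?_
      have hne := Finset.ne_of_mem_erase hi
      have hv : i.val ≠ k.val := fun h => hne (Fin.ext h)
      rw [Function.update_of_ne hne]
      by_cases h : i.val < k.val
      · simp [h, h.trans k.val.lt_succ_self]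
      · rw [if_neg h, if_neg (by omega)]
  have h2 : partialWeight p k y₀ y = p k (y k) * ∏ i ∈ Finset.univ.erase k,
        if i.val < k.val then (if y i = y₀ i then 1 else 0) else p i (y i) := by
    rw [partialWeight, ← Finset.mul_prod_erase _ _ (Finset.mem_univ k)]
    simp
  simp only [h1, ← mul_assoc, ← Finset.sum_mul, h2]
  congr 1
  simp

theorem partialWeight_zero (p : Fin d → Bool → ENNReal) (y₀ y : Cube d) :
    partialWeight p 0 y₀ y = ∏ i, p i (y i) := by simp [partialWeight]

theorem sum_partialWeight_last (p : Fin d → Bool → ENNReal) (y₀ : Cube d) (G : Cube d → ENNReal) :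
    ∑ y, partialWeight p d y₀ y * G y = G y₀ := by
  rw [Finset.sum_eq_single y₀]
  · simp [partialWeight]
  · intro y _ hy
    obtain ⟨i, hi⟩ := Function.ne_iff.1 hy
    rw [partialWeight, Finset.prod_eq_zero (Finset.mem_univ i), zero_mul]
    simp [hi]
  · simp

theorem coinPMF_sigmoid (t : ℝ) (b : Bool) :
    coinPMF (Real.sigmoid t) b = ENNReal.ofReal (bern t b) := by
  rw [coinPMF, PMF.ofFintype_apply, min_eq_right (Real.sigmoid_le_one t),
    max_eq_right (Real.sigmoid_nonneg t), bern]

/-- Fill array `a` with independent coins of bias `e`. -/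
def coinLoop (a : ℕ) (e : RExpr) : Prog := forEach (coin a 3 e)

theorem expect_coinLoop_le {a : ℕ} {e : RExpr} (z : Vec d) (hd : s.reg 0 = d)
    (he : ∀ k : Fin d, ∀ t : RamState, t.reg 3 = k → (∀ r ≠ 3, t.reg r = s.reg r) →
      (∀ b ≠ a, t.mem b = s.mem b) → e.eval t = Real.sigmoid (z k))
    {F : RamState → ENNReal} {G : Cube d → ENNReal}
    (hF : ∀ (y : Cube d) (t : RamState), (∀ r ≠ 3, t.reg r = s.reg r) →
      (∀ b ≠ a, t.mem b = s.mem b) → (∀ i : Fin d, t.mem a i = bitVal (y i)) → F t ≤ G y) :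
    ((coinLoop a e).run μ S s).expect F ≤ ∑ y, ENNReal.ofReal (prodProb z y) * G y := by
  set p : Fin d → Bool → ENNReal := fun i b => ENNReal.ofReal (bern (z i) b) with hp
  -- With `k` bits of `y₀` tossed and `n` to come, the remaining expectation is bounded by the
  -- conditional average of `G`; `sum_partialWeight_succ` is the induction step.
  have main : ∀ n k, k + n = d → ∀ (t : RamState) (y₀ : Cube d), t.reg 3 = k →
      (∀ r ≠ 3, t.reg r = s.reg r) → (∀ b ≠ a, t.mem b = s.mem b) →
      (∀ i : Fin d, i.val < k → t.mem a i = bitVal (y₀ i)) →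
      ((seq (coin a 3 e) (succ 3)).iter μ S n t).expect F ≤
        ∑ y, partialWeight p k y₀ y * G y := by
    intro n
    induction n with
    | zero =>
      intro k hk t y₀ h3 hr hm hb
      obtain rfl : k = d := by omega
      rw [iter_zero, PMF.expect_pure, sum_partialWeight_last]
      exact hF y₀ t hr hm fun i => hb i i.2
    | succ n ih =>
      intro k hk t y₀ h3 hr hm hb
      have hkd : k < d := by omega
      have hev : e.eval (t.tick 1) = Real.sigmoid (z ⟨k, hkd⟩) := he ⟨k, hkd⟩ _ h3 hr hm
      rw [iter_succ', PMF.expect_bind, expect_seq, Prog.run, PMF.expect_map, hev,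
        PMF.expect_fintype]
      have h1 : ∀ b, (((succ 3).run μ S (((t.tick 1).setMem a ((t.tick 1).reg 3) (bitVal b)).tick
          (e.cost + 1))).expect fun u => ((seq (coin a 3 e) (succ 3)).iter μ S n u).expect F) ≤
          ∑ y, partialWeight p (k + 1) (Function.update y₀ ⟨k, hkd⟩ b) y * G y := by
        intro b
        rw [Prog.run, PMF.expect_pure]
        refine ih (k + 1) (by omega) _ _ ?_ ?_ ?_ ?_
        · simp [RamState.tick, RamState.setReg, RamState.setMem, h3]
        · intro r hr'
          simp [RamState.tick, RamState.setReg, RamState.setMem, hr', hr r hr']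
        · intro b' hb'
          simp [RamState.tick, RamState.setReg, RamState.setMem, hb', hm b' hb']
        · intro i hi
          by_cases hik : i.val = k
          · obtain rfl : i = ⟨k, hkd⟩ := Fin.ext hik
            simp [RamState.tick, RamState.setReg, RamState.setMem, h3]
          · have hne : i ≠ ⟨k, hkd⟩ := fun h => hik (congrArg Fin.val h)
            simp only [RamState.tick, RamState.setReg, RamState.setMem, h3,
              Function.update_self, Function.update_of_ne hik, Function.update_of_ne hne]
            exact hb i (by omega)
      calc _ ≤ ∑ b, p ⟨k, hkd⟩ b *
            ∑ y, partialWeight p (k + 1) (Function.update y₀ ⟨k, hkd⟩ b) y * G y := by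
            refine Finset.sum_le_sum fun b _ => ?_
            rw [coinPMF_sigmoid]
            exact mul_le_mul_right (h1 b) _
        _ = ∑ y, partialWeight p k y₀ y * G y := by
            simp only [Finset.mul_sum]
            rw [Finset.sum_comm]
            refine Finset.sum_congr rfl fun y _ => ?_
            rw [← sum_partialWeight_succ p ⟨k, hkd⟩ y₀ y, Finset.sum_mul]
            exact Finset.sum_congr rfl fun b _ => (mul_assoc _ _ _).symm
  rw [coinLoop, forEach, expect_seq, Prog.run, PMF.expect_pure, run_loop]
  have hn : ((s.setReg 3 0).tick 1).reg 0 = d := by simp [RamState.tick, RamState.setReg, hd]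
  rw [hn]
  refine (main d 0 (zero_add d) _ (fun _ => false) ?_ ?_ ?_ ?_).trans_eq ?_
  · simp [RamState.tick, RamState.setReg]
  · intro r hr
    simp [RamState.tick, RamState.setReg, hr]
  · intro b _
    rfl
  · intro i hi
    omega
  · refine Finset.sum_congr rfl fun y _ => ?_
    rw [partialWeight_zero, prodProb_eq_prod,
      ENNReal.ofReal_prod_of_nonneg fun i _ => bern_nonneg _ _]

theorem expect_sample (a : ℕ) {zs : Vec d} (hS : S.Nonempty) (f : RamState → ENNReal) :
    ((sample a).run (truncPMF zs S hS) S s).expect f =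
      ∑ x, ENNReal.ofReal (truncProb zs S x) *
        f (((s.writeCube a x).tick (d + 1)).countSample) := by
  rw [Prog.run, PMF.expect_map, PMF.expect_fintype]
  rfl

end

end Prog

/-! ### The algorithm -/

namespace RExpr

/-- `log (1 + exp e)` -/
def softplus (e : RExpr) : RExpr := log (add (const 1) (exp e))

/-- `1 / (1 + exp (-e))` -/
def sigmoid (e : RExpr) : RExpr := div (const 1) (add (const 1) (exp (sub (const 0) e)))

/-- the accuracy `ε` -/
def eps : RExpr := cell 1 9

/-- the product `α * lam` -/
def beta : RExpr := mul (cell 2 9) (cell 3 9)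

/-- the bound `-log (α * lam)` on the entries of the parameter vector -/
def bound : RExpr := sub (const 0) (log beta)

/-- `d / ε ^ 2` -/
def ratio : RExpr := div (ofNat 0) (mul eps eps)

/-- `(α * lam) ^ 6` -/
def beta6 : RExpr := mul (mul (mul beta beta) (mul beta beta)) (mul beta beta)

/-- the number of samples for the initial estimate -/
def sampleCount : RExpr := div (mul (const 1638400) ratio) beta6

/-- the number of gradient steps -/
def stepCount : RExpr :=
  div (mul (mul (const 128000000) ratio)
    (log (div (mul (const 12800) (add (const 2) ratio)) (mul beta beta)))) beta6

/-- the step size -/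
def stepSize : RExpr :=
  div (mul (mul beta (mul beta beta)) (mul eps eps)) (mul (const 320000) (ofNat 0))

/-- one summand of the Bregman divergence -/
def bregmanTerm : RExpr :=
  sub (sub (softplus (cell 0 3)) (softplus (cell 6 3)))
    (mul (sigmoid (cell 6 3)) (sub (cell 0 3) (cell 6 3)))

end RExpr

/-- The memory contains the input. -/
structure HasInput (d : ℕ) (ε α lam : ℝ) (s : RamState) : Prop where
  reg0 : s.reg 0 = d
  -- Register `9` is never written to and serves as the address of entry `0`.
  reg9 : s.reg 9 = 0
  eps_eq : s.mem 1 0 = ε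
  alpha_eq : s.mem 2 0 = α
  lam_eq : s.mem 3 0 = lam

namespace HasInput

variable {d : ℕ} {ε α lam : ℝ} {s t : RamState}

theorem of_eq (h : HasInput d ε α lam s) (h0 : t.reg 0 = s.reg 0) (h9 : t.reg 9 = s.reg 9)
    (h1 : t.mem 1 = s.mem 1) (h2 : t.mem 2 = s.mem 2) (h3 : t.mem 3 = s.mem 3) :
    HasInput d ε α lam t :=
  ⟨h0.trans h.reg0, h9.trans h.reg9, h1 ▸ h.eps_eq, h2 ▸ h.alpha_eq, h3 ▸ h.lam_eq⟩

theorem ensures {μ : PMF (Cube d)} {S : Finset (Cube d)} {p : Prog} (h : HasInput d ε α lam s)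
    (h0 : p.KeepsReg 0) (h9 : p.KeepsReg 9) (h1 : p.KeepsMem 1) (h2 : p.KeepsMem 2)
    (h3 : p.KeepsMem 3) : p.Ensures μ S s (HasInput d ε α lam) := fun t ht =>
  h.of_eq (h0.ensures s t ht) (h9.ensures s t ht) (h1.ensures s t ht) (h2.ensures s t ht)
    (h3.ensures s t ht)

theorem eval_eps (h : HasInput d ε α lam s) : RExpr.eps.eval s = ε := by
  simp [RExpr.eps, RExpr.eval, h.reg9, h.eps_eq]

theorem eval_beta (h : HasInput d ε α lam s) : RExpr.beta.eval s = α * lam := by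
  simp [RExpr.beta, RExpr.eval, h.reg9, h.alpha_eq, h.lam_eq]

theorem eval_bound (h : HasInput d ε α lam s) : RExpr.bound.eval s = -Real.log (α * lam) := by
  simp [RExpr.bound, RExpr.eval, h.eval_beta]

theorem eval_ratio (h : HasInput d ε α lam s) : RExpr.ratio.eval s = d / ε ^ 2 := by
  simp [RExpr.ratio, RExpr.eval, h.eval_eps, h.reg0, sq]

theorem eval_beta6 (h : HasInput d ε α lam s) : RExpr.beta6.eval s = (α * lam) ^ 6 := by
  simp only [RExpr.beta6, RExpr.eval, h.eval_beta]
  ring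

theorem eval_sampleCount (h : HasInput d ε α lam s) :
    RExpr.sampleCount.eval s = 1638400 * (d / ε ^ 2) / (α * lam) ^ 6 := by
  simp [RExpr.sampleCount, RExpr.eval, h.eval_ratio, h.eval_beta6]

theorem eval_stepCount (h : HasInput d ε α lam s) :
    RExpr.stepCount.eval s = 128000000 * (d / ε ^ 2) *
      Real.log (12800 * (2 + d / ε ^ 2) / (α * lam) ^ 2) / (α * lam) ^ 6 := by
  simp [RExpr.stepCount, RExpr.eval, h.eval_ratio, h.eval_beta6, h.eval_beta, sq]

theorem eval_stepSize (h : HasInput d ε α lam s) :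
    RExpr.stepSize.eval s = (α * lam) ^ 3 * ε ^ 2 / (320000 * d) := by
  simp only [RExpr.stepSize, RExpr.eval, h.eval_eps, h.eval_beta, h.reg0]
  push_cast
  ring_nf

end HasInput

namespace Prog

/-- Add `e` to the current entry of array `0`, and truncate the result. -/
def updateBody (e : RExpr) : Prog :=
  seq (assign 0 3 (.add (.cell 0 3) e))
    (seq (ifLE (.cell 0 3) (.sub (.const 0) .bound) (assign 0 3 (.sub (.const 0) .bound)) skip)
      (ifLE .bound (.cell 0 3) (assign 0 3 .bound) skip))

/-- A projected step of the vector in array `0`. -/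
def updateLoop (e : RExpr) : Prog := forEach (updateBody e)

/-- Increase the current entry of array `a` to at least `α * lam`. -/
def raiseCell (a : ℕ) : Prog := ifLE (.cell a 3) .beta (assign a 3 .beta) skip

/-- The initial estimate: add up the samples. -/
def sumSamples : Prog := seq (sample 5) (forEach (assign 6 3 (.add (.cell 6 3) (.cell 5 3))))

/-- The initial estimate: take the logit of the mean. -/
def initBody : Prog :=
  seq (assign 8 3 (.div (.cell 6 3) (.ofNat 1)))
    (seq (assign 7 3 (.sub (.const 1) (.cell 8 3)))
      (seq (raiseCell 8) (seq (raiseCell 7)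
        (seq (assign 6 3 (.log (.div (.cell 8 3) (.cell 7 3)))) (assign 0 3 (.cell 6 3))))))

/-- A step along the rejection-sampled gradient of the likelihood. -/
def likelihoodStep : Prog :=
  -- Array `0` is the iterate `z`, array `5` receives `y`, entry `0` of array `8` the answer of the
  -- query, and array `4` the truncated sample `x`.
  seq (coinLoop 5 (.sigmoid (.cell 0 3)))
    (seq (query 8 9 5)
      (seq (sample 4)
        (updateLoop (.mul .stepSize (.mul (.cell 8 9) (.sub (.cell 4 3) (.cell 5 3)))))))

/-- A step towards the initial estimate, along the gradient of the Bregman divergence. -/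
def bregmanStep : Prog :=
  updateLoop (.mul .stepSize (.sub (.sigmoid (.cell 6 3)) (.sigmoid (.cell 0 3))))

/-- One step of stochastic gradient descent. -/
def sgdStep : Prog :=
  seq (sumLoop 7 .bregmanTerm)
    (ifLE (.cell 7 9) (.sub (.const 1) (.log (.cell 2 9))) likelihoodStep bregmanStep)

/-- The numbers of iterations. -/
def chooseCounts : Prog :=
  -- Rounding up a positive count gives at least one, which the bound in `d / ε²` would not cover
  -- for very large `ε`. So samples are skipped when the whole box is within `ε`, and steps are
  -- skipped when the initial estimate is accurate enough.
  seq (ifLE (.div (.mul (.const 4) (.ofNat 0)) (.mul .beta .beta)) (.mul .eps .eps)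
      (zero 1) (ceil 1 .sampleCount))
    (ifLE (.div (.const 8) .beta) .eps (zero 2) (ceil 2 .stepCount))

/-- The algorithm, after the numbers of iterations have been chosen. -/
def estimate : Prog := seq (loop 1 sumSamples) (seq (forEach initBody) (loop 2 sgdStep))

/-- The algorithm. -/
def learn : Prog := seq chooseCounts estimate

end Prog

end

noncomputable section

/-! ### Correctness of the gradient steps -/

theorem RamState.readVec_apply {d : ℕ} (s : RamState) (a : ℕ) (i : Fin d) :
    s.readVec d a i = s.mem a i := rfl

theorem RamState.readVec_congr {d a : ℕ} {s t : RamState} (h : t.mem a = s.mem a) :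
    t.readVec d a = s.readVec d a := by
  simp only [RamState.readVec, h]

theorem RExpr.eval_softplus (e : RExpr) (s : RamState) :
    e.softplus.eval s = _root_.softplus (e.eval s) := by
  simp [RExpr.softplus, RExpr.eval, _root_.softplus]

theorem RExpr.eval_sigmoid (e : RExpr) (s : RamState) :
    e.sigmoid.eval s = Real.sigmoid (e.eval s) := by
  simp [RExpr.sigmoid, RExpr.eval, Real.sigmoid_def]

namespace Prog

variable {d : ℕ} {μ : PMF (Cube d)} {S : Finset (Cube d)} {s : RamState} {ε α lam : ℝ} {u : Vec d}

theorem ensures_updateBody (h : HasInput d ε α lam s) (e : RExpr) :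
    (updateBody e).Ensures μ S s fun t => t.mem 0 = Function.update (s.mem 0) (s.reg 3)
      (clip (-Real.log (α * lam)) (s.mem 0 (s.reg 3) + e.eval s)) := by
  set B := -Real.log (α * lam) with hB
  have hbd : ∀ {t : RamState}, HasInput d ε α lam t → RExpr.bound.eval t = B :=
    fun ht => ht.eval_bound
  refine ensures_seq (ensures_assign ?_)
  set v := s.mem 0 (s.reg 3) + e.eval s with hv
  have hev : ((RExpr.cell 0 3).add e).eval s = v := rfl
  rw [hev]
  set s₁ := (s.setMem 0 (s.reg 3) v).tick (((RExpr.cell 0 3).add e).cost + 1) with hs₁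
  have h₁ : HasInput d ε α lam s₁ := h.of_eq rfl rfl rfl rfl rfl
  have r₁ : s₁.reg 3 = s.reg 3 := rfl
  have m₁ : s₁.mem 0 = Function.update (s.mem 0) (s.reg 3) v := rfl
  have key : ∀ t : RamState, HasInput d ε α lam t ∧ t.reg 3 = s.reg 3 ∧
      t.mem 0 = Function.update (s.mem 0) (s.reg 3) (max v (-B)) →
      (ifLE .bound (.cell 0 3) (assign 0 3 .bound) skip).Ensures μ S t fun t =>
        t.mem 0 = Function.update (s.mem 0) (s.reg 3) (clip B v) := by
    rintro t ⟨ht, hr, hm⟩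
    have hc : (RExpr.cell 0 3).eval t = max v (-B) := by
      simp [RExpr.eval, hr, hm]
    refine ensures_ifLE (fun hle => ensures_assign ?_) fun hle => ensures_skip ?_
    · rw [hc, hbd ht] at hle
      have hb : RExpr.bound.eval (t.tick (RExpr.bound.cost + (RExpr.cell 0 3).cost + 1)) = B :=
        ht.eval_bound
      rw [hb]
      simp only [RamState.tick, RamState.setMem, Function.update_self, hr, hm,
        Function.update_idem, clip, min_eq_right hle]
    · rw [hc, hbd ht] at hle
      simp only [RamState.tick, hm, clip, min_eq_left (le_of_not_ge hle)]
  have hc : (RExpr.cell 0 3).eval s₁ = v := by simp [RExpr.eval, r₁, m₁]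
  have hb : ((RExpr.const 0).sub .bound).eval s₁ = -B := by
    simp [RExpr.eval, hbd h₁]
  refine ensures_seq (ensures_ifLE (fun hle => ensures_assign (key _ ⟨?_, ?_, ?_⟩))
    fun hle => ensures_skip (key _ ⟨?_, ?_, ?_⟩))
  · exact h₁.of_eq rfl rfl rfl rfl rfl
  · exact r₁
  · rw [hc, hb] at hle
    have hb' : ((RExpr.const 0).sub .bound).eval
        (s₁.tick ((RExpr.cell 0 3).cost + ((RExpr.const 0).sub .bound).cost + 1)) = -B := hb
    rw [hb', max_eq_right hle]
    simp only [RamState.tick, RamState.setMem, Function.update_self, r₁, m₁,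
      Function.update_idem]
  · exact h₁.of_eq rfl rfl rfl rfl rfl
  · exact r₁
  · rw [hc, hb] at hle
    rw [max_eq_left (le_of_not_ge hle)]
    simp only [RamState.tick, m₁]

theorem updateBody_keepsReg (e : RExpr) (r : ℕ) : (updateBody e).KeepsReg r := by
  simp [updateBody, KeepsReg]

theorem updateBody_keepsMem (e : RExpr) {a : ℕ} (ha : a ≠ 0) : (updateBody e).KeepsMem a := by
  simp [updateBody, KeepsMem, ha.symm]

/-- When entry `k` is reached it still has its old value, so updating in place equals a simultaneous
step as long as `e` reads array `0` only at the current index. -/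
theorem ensures_updateLoop (h : HasInput d ε α lam s) {e : RExpr} (g : Fin d → ℝ)
    (he : ∀ k : Fin d, ∀ t : RamState, HasInput d ε α lam t → t.reg 3 = k →
      (∀ a ≠ 0, t.mem a = s.mem a) → t.mem 0 k = s.mem 0 k → e.eval t = g k) :
    (updateLoop e).Ensures μ S s fun t => ∀ k : Fin d,
      t.mem 0 k = clip (-Real.log (α * lam)) (s.mem 0 k + g k) := by
  refine (ensures_forEach (updateBody_keepsReg e) (fun k m => ∀ i : Fin d, m 0 i =
    if i.val < k then clip (-Real.log (α * lam)) (s.mem 0 i + g i) else s.mem 0 i)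
    (by simp) ?_).mono fun t ht k => ?_
  · intro k hk t h3 hr hm hi
    rw [h.reg0] at hk
    have hm' : ∀ a ≠ 0, t.mem a = s.mem a := fun a ha => hm a (updateBody_keepsMem e ha)
    have ht : HasInput d ε α lam t := h.of_eq (hr _ (by decide)) (hr _ (by decide))
      (hm' _ (by decide)) (hm' _ (by decide)) (hm' _ (by decide))
    refine (ensures_updateBody ht e).mono fun u hu i => ?_
    have h0 : t.mem 0 k = s.mem 0 k := by
      have := hi ⟨k, hk⟩
      simpa using this
    rw [hu, h3, he ⟨k, hk⟩ t ht h3 hm' h0, h0]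
    rcases lt_trichotomy i.val k with hik | hik | hik
    · rw [Function.update_of_ne hik.ne, hi i, if_pos hik, if_pos (by omega)]
    · obtain rfl : i = ⟨k, hk⟩ := Fin.ext hik
      simp
    · rw [Function.update_of_ne hik.ne', hi i, if_neg (by omega), if_neg (by omega)]
  · rw [ht.2.2 k, h.reg0, if_pos k.2]

/-! ### Expected effect of one step of the program -/

/-- The squared distance of the vector in array `0` to `zs`. -/
def sqDist (zs : Vec d) (s : RamState) : ENNReal :=
  ENNReal.ofReal (‖s.readVec d 0 - zs‖ ^ 2)

theorem norm_readVec_sub_sq (s : RamState) (zs : Vec d) :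
    ‖s.readVec d 0 - zs‖ ^ 2 = ∑ i : Fin d, (s.mem 0 i - zs i) ^ 2 := by
  rw [EuclideanSpace.real_norm_sq_eq]
  rfl

theorem readCube_eq {t : RamState} {a : ℕ} {y : Cube d}
    (h : ∀ i : Fin d, t.mem a i = bitVal (y i)) : t.readCube d a = y := by
  funext i
  rw [RamState.readCube, h i]
  cases y i <;> simp [bitVal]

/-- The state in a gradient step. -/
structure StepState (d : ℕ) (ε α lam : ℝ) (u : Vec d) (s : RamState) : Prop
    extends HasInput d ε α lam s where
  center : s.readVec d 6 = u
  bounded : ∀ i : Fin d, |s.mem 0 i| ≤ -Real.log (α * lam)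

-- The program tosses `y` before it draws `x`, in the same order as the nested sums of
-- `Admissible.likelihood_step`; what follows the two draws is deterministic up to the cost
-- counters.
open Classical in
theorem expect_likelihoodStep_le {zs u : Vec d} {η : ℝ}
    (h : Admissible zs S α lam) (hs : StepState d ε α lam u s)
    (hub : ∀ i, |u i| ≤ -Real.log (α * lam))
    (hu : ‖u - Admissible.meanLogit zs S α lam‖ ≤ α * lam / 4)
    (hgood : bregman u (s.readVec d 0) ≤ 1 - Real.log α)
    (hη : η = (α * lam) ^ 3 * ε ^ 2 / (320000 * d)) :
    (likelihoodStep.run (truncPMF zs S h.nonempty) S s).expect (sqDist zs) ≤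
      ENNReal.ofReal ((1 - 2 * η * Admissible.rate α lam) * ‖s.readVec d 0 - zs‖ ^ 2 +
        η ^ 2 * d) := by
  have hη0 : 0 ≤ η := by rw [hη]; have := h.beta_pos; positivity
  have hmath := h.likelihood_step hub hu (z := s.readVec d 0) hs.bounded hgood hη0
  refine le_trans ?_ (ENNReal.ofReal_le_ofReal hmath)
  rw [ENNReal.ofReal_sum_of_nonneg fun y _ => mul_nonneg (prodProb_pos _ _).le
    (Finset.sum_nonneg fun x _ => mul_nonneg (truncProb_nonneg _ _ _)
      (Finset.sum_nonneg fun i _ => sq_nonneg _))]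
  simp only [ENNReal.ofReal_mul (prodProb_pos _ _).le]
  rw [likelihoodStep, expect_seq]
  refine expect_coinLoop_le (s.readVec d 0) hs.reg0 ?_ ?_
  · intro k t h3 hr hm
    rw [RExpr.eval_sigmoid, RExpr.eval, h3, hm 0 (by decide)]
    rfl
  · intro y t hr hm hy
    rw [expect_seq, Prog.run, PMF.expect_pure, expect_seq, expect_sample,
      ENNReal.ofReal_sum_of_nonneg fun x _ => mul_nonneg (truncProb_nonneg _ _ _)
      (Finset.sum_nonneg fun i _ => sq_nonneg _)]
    refine Finset.sum_le_sum fun x _ => ?_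
    rw [ENNReal.ofReal_mul (truncProb_nonneg _ _ _)]
    refine mul_le_mul_right ?_ _
    rw [readCube_eq hy]
    set f : ℝ := if y ∈ S then 1 else 0 with hf
    set t₁ := ((((t.setMem 8 (t.reg 9) f).tick (d + 1)).countQuery.writeCube 4 x).tick
      (d + 1)).countSample with ht₁
    have h9 : t.reg 9 = 0 := (hr 9 (by decide)).trans hs.reg9
    have hin : HasInput d ε α lam t₁ := hs.toHasInput.of_eq (hr 0 (by decide)) (hr 9 (by decide))
      (hm 1 (by decide)) (hm 2 (by decide)) (hm 3 (by decide))
    have m0 : t₁.mem 0 = s.mem 0 := hm 0 (by decide)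
    have m8 : t₁.mem 8 0 = f := by
      simp [ht₁, RamState.setMem, RamState.tick, RamState.countQuery, RamState.countSample,
        RamState.writeCube, h9]
    have m4 : ∀ i : Fin d, t₁.mem 4 i = bitVal (x i) := fun i => by
      simp [ht₁, RamState.setMem, RamState.tick, RamState.countQuery, RamState.countSample,
        RamState.writeCube]
    have m5 : ∀ i : Fin d, t₁.mem 5 i = bitVal (y i) := hy
    refine PMF.expect_le fun v hv => ?_
    have := ensures_updateLoop (μ := truncPMF zs S h.nonempty) (S := S) hin
      (e := .mul .stepSize (.mul (.cell 8 9) (.sub (.cell 4 3) (.cell 5 3))))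
      (fun i => η * (f * (bitVal (x i) - bitVal (y i)))) (fun k w hw h3 hwm _ => by
        simp only [RExpr.eval, hw.eval_stepSize, hw.reg9, h3, hwm 8 (by decide),
          hwm 4 (by decide), hwm 5 (by decide), m8, m4, m5, hη]) v hv
    rw [sqDist, norm_readVec_sub_sq]
    simp only [this, m0]
    exact le_rfl

theorem expect_bregmanStep_le {zs u : Vec d} {η : ℝ}
    (h : Admissible zs S α lam) (hs : StepState d ε α lam u s)
    (hu : ‖u - Admissible.meanLogit zs S α lam‖ ≤ α * lam / 4)
    (hbad : 1 - Real.log α < bregman u (s.readVec d 0))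
    (hη : η = (α * lam) ^ 3 * ε ^ 2 / (320000 * d)) :
    (bregmanStep.run μ S s).expect (sqDist zs) ≤
      ENNReal.ofReal ((1 - 2 * η * Admissible.rate α lam) * ‖s.readVec d 0 - zs‖ ^ 2 +
        η ^ 2 * d) := by
  have hη0 : 0 ≤ η := by rw [hη]; have := h.beta_pos; positivity
  have hmath := h.bregman_step hu (z := s.readVec d 0) hs.bounded hbad hη0
  refine PMF.expect_le fun v hv => ENNReal.ofReal_le_ofReal (le_trans (le_of_eq ?_) hmath)
  have := ensures_updateLoop (μ := μ) (S := S) hs.toHasInput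
    (e := .mul .stepSize (.sub (.sigmoid (.cell 6 3)) (.sigmoid (.cell 0 3))))
    (fun i => η * (Real.sigmoid (u i) - Real.sigmoid (s.mem 0 i))) (fun k w hw h3 hwm hw0 => by
      rw [← hs.center]
      simp only [RExpr.eval, hw.eval_stepSize, RExpr.eval_sigmoid, h3, hwm 6 (by decide), hw0, hη,
        RamState.readVec_apply]) v hv
  rw [norm_readVec_sub_sq]
  simp only [this, RamState.readVec_apply]

theorem ensures_updateLoop_bounded (h : HasInput d ε α lam s) (hB : 0 ≤ -Real.log (α * lam))
    (e : RExpr) : (updateLoop e).Ensures μ S s fun t =>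
      ∀ i : Fin d, |t.mem 0 i| ≤ -Real.log (α * lam) := by
  refine (ensures_forEach (updateBody_keepsReg e) (fun k m => ∀ i : Fin d, i.val < k →
    |m 0 i| ≤ -Real.log (α * lam)) (by simp) ?_).mono
    fun t ht k => ht.2.2 k (by rw [h.reg0]; exact k.2)
  intro k hk t h3 hr hm hi
  have hm' : ∀ a ≠ 0, t.mem a = s.mem a := fun a ha => hm a (updateBody_keepsMem e ha)
  have ht : HasInput d ε α lam t := h.of_eq (hr _ (by decide)) (hr _ (by decide))
    (hm' _ (by decide)) (hm' _ (by decide)) (hm' _ (by decide))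
  refine (ensures_updateBody ht e).mono fun u hu i hik => ?_
  rw [hu, h3]
  by_cases hk' : i.val = k
  · rw [hk', Function.update_self]
    exact abs_clip_le hB _
  · rw [Function.update_of_ne hk']
    exact hi i (by omega)

theorem ensures_sumLoop_bregman (hs : StepState d ε α lam u s) :
    (sumLoop 7 .bregmanTerm).Ensures μ S s fun t => StepState d ε α lam u t ∧
      t.mem 0 = s.mem 0 ∧ t.mem 7 0 = bregman u (s.readVec d 0) := by
  have := ensures_sumLoop (μ := μ) (S := S) (a := 7) (e := .bregmanTerm) hs.reg9
    (fun k => _root_.softplus (s.mem 0 k) - _root_.softplus (s.mem 6 k) -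
      Real.sigmoid (s.mem 6 k) * (s.mem 0 k - s.mem 6 k)) fun k _ t h3 hr hm => by
        simp only [RExpr.bregmanTerm, RExpr.eval, RExpr.eval_softplus, RExpr.eval_sigmoid, h3,
          hm 0 (by decide), hm 6 (by decide)]
  refine this.mono fun t ⟨hr, hm, h7⟩ => ⟨⟨?_, ?_, ?_⟩, hm 0 (by decide), ?_⟩
  · exact hs.toHasInput.of_eq (hr 0 (by decide)) (hr 9 (by decide))
      (hm 1 (by decide)) (hm 2 (by decide)) (hm 3 (by decide))
  · rw [RamState.readVec_congr (hm 6 (by decide)), hs.center]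
  · rw [hm 0 (by decide)]
    exact hs.bounded
  · rw [h7, hs.reg0, ← hs.center, bregman, Finset.sum_range]
    rfl

theorem ensures_sgdStep (hs : StepState d ε α lam u s) (hB : 0 ≤ -Real.log (α * lam)) :
    sgdStep.Ensures μ S s (StepState d ε α lam u) := by
  refine ensures_seq ((ensures_sumLoop_bregman hs).mono fun t ht => ?_)
  have key : ∀ {p : Prog} {s : RamState}, p.KeepsReg 0 → p.KeepsReg 9 → p.KeepsMem 1 →
      p.KeepsMem 2 → p.KeepsMem 3 → p.KeepsMem 6 → StepState d ε α lam u s →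
      (p.Ensures μ S s fun t => ∀ i : Fin d, |t.mem 0 i| ≤ -Real.log (α * lam)) →
      p.Ensures μ S s (StepState d ε α lam u) := by
    intro p s h0 h9 h1 h2 h3 h6 hs hb t ht
    exact ⟨hs.toHasInput.ensures h0 h9 h1 h2 h3 t ht,
      (RamState.readVec_congr (h6.ensures s t ht)).trans hs.center, hb t ht⟩
  have hst : ∀ n, StepState d ε α lam u (t.tick n) := fun n =>
    ⟨ht.1.toHasInput.of_eq rfl rfl rfl rfl rfl, ht.1.center, ht.1.bounded⟩
  refine ensures_ifLE (fun _ => key ?_ ?_ ?_ ?_ ?_ ?_ (hst _) ?_)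
    fun _ => key ?_ ?_ ?_ ?_ ?_ ?_ (hst _) ?_
  any_goals simp [likelihoodStep, bregmanStep, coinLoop, updateLoop, updateBody, forEach,
    KeepsReg, KeepsMem]
  · refine ensures_seq (s := t.tick _) fun t₁ h₁ => ensures_seq fun t₂ h₂ => ensures_seq
      fun t₃ h₃ => ensures_updateLoop_bounded (ε := ε) ?_ hB _
    have e1 := (hst _).toHasInput.ensures
      (p := forEach (coin 5 3 (.sigmoid (.cell 0 3)))) (by simp [forEach, KeepsReg])
      (by simp [forEach, KeepsReg]) (by simp [forEach, KeepsMem]) (by simp [forEach, KeepsMem])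
      (by simp [forEach, KeepsMem]) t₁ h₁
    have e2 := e1.ensures (p := query 8 9 5) trivial trivial (by simp [KeepsMem])
      (by simp [KeepsMem]) (by simp [KeepsMem]) t₂ h₂
    exact e2.ensures (p := sample 4) trivial trivial (by simp [KeepsMem])
      (by simp [KeepsMem]) (by simp [KeepsMem]) t₃ h₃
  · exact ensures_updateLoop_bounded (hst _).toHasInput hB _

theorem expect_sgdStep_le {zs u : Vec d} {η : ℝ}
    (h : Admissible zs S α lam) (hs : StepState d ε α lam u s)
    (hub : ∀ i, |u i| ≤ -Real.log (α * lam))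
    (hu : ‖u - Admissible.meanLogit zs S α lam‖ ≤ α * lam / 4)
    (hη : η = (α * lam) ^ 3 * ε ^ 2 / (320000 * d)) :
    (sgdStep.run (truncPMF zs S h.nonempty) S s).expect (sqDist zs) ≤
      ENNReal.ofReal ((1 - 2 * η * Admissible.rate α lam) * ‖s.readVec d 0 - zs‖ ^ 2 +
        η ^ 2 * d) := by
  refine expect_seq_le ((ensures_sumLoop_bregman hs).mono fun t ⟨ht, h0, h7⟩ => ?_)
  have hst : ∀ n, StepState d ε α lam u (t.tick n) := fun n =>
    ⟨ht.toHasInput.of_eq rfl rfl rfl rfl rfl, ht.center, ht.bounded⟩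
  have hz : ∀ n, (t.tick n).readVec d 0 = s.readVec d 0 := fun n => RamState.readVec_congr h0
  have e1 : (RExpr.cell 7 9).eval t = bregman u (s.readVec d 0) := by
    simp [RExpr.eval, ht.reg9, h7]
  have e2 : ((RExpr.const 1).sub (.log (.cell 2 9))).eval t = 1 - Real.log α := by
    simp [RExpr.eval, ht.reg9, ht.alpha_eq]
  rw [Prog.run, e1, e2]
  split_ifs with hle
  · have := expect_likelihoodStep_le h (hst ((RExpr.cell 7 9).cost +
      ((RExpr.const 1).sub (.log (.cell 2 9))).cost + 1)) hub hu (by rwa [hz]) hη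
    rwa [hz] at this
  · have := expect_bregmanStep_le (μ := truncPMF zs S h.nonempty) h (hst ((RExpr.cell 7 9).cost +
      ((RExpr.const 1).sub (.log (.cell 2 9))).cost + 1)) hu (by rw [hz]; exact not_le.1 hle) hη
    rwa [hz] at this

end Prog
end

noncomputable section

namespace Prog

/-! ### The initial estimate -/

variable {d : ℕ} {μ : PMF (Cube d)} {S : Finset (Cube d)} {s : RamState} {ε α lam : ℝ} {u : Vec d}

theorem ensures_addLoop (h : HasInput d ε α lam s) :
    (forEach (assign 6 3 (.add (.cell 6 3) (.cell 5 3)))).Ensures μ S s fun t =>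
      HasInput d ε α lam t ∧ ∀ i : Fin d, t.mem 6 i = s.mem 6 i + s.mem 5 i := by
  have hin := h.ensures (μ := μ) (S := S) (p := forEach (assign 6 3 (.add (.cell 6 3) (.cell 5 3))))
    (by simp [forEach, KeepsReg]) (by simp [forEach, KeepsReg]) (by simp [forEach, KeepsMem])
    (by simp [forEach, KeepsMem]) (by simp [forEach, KeepsMem])
  refine hin.and ((ensures_forEach (fun _ => by simp [KeepsReg])
    (fun k m => ∀ i : Fin d, m 6 i = if i.val < k then s.mem 6 i + s.mem 5 i else s.mem 6 i)
    (by simp) ?_).mono fun t ht i => ?_)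
  · intro k hk t h3 hr hm hi
    refine ensures_assign fun i => ?_
    have h5 : t.mem 5 = s.mem 5 := hm 5 (by simp [KeepsMem])
    simp only [RamState.tick, RamState.setMem, Function.update_self, h3, RExpr.eval, h5]
    rcases lt_trichotomy i.val k with hik | hik | hik
    · rw [Function.update_of_ne hik.ne, hi i, if_pos hik, if_pos (by omega)]
    · rw [hik, Function.update_self, if_pos (by omega), ← hik, hi i, if_neg (by omega)]
    · rw [Function.update_of_ne hik.ne', hi i, if_neg (by omega), if_neg (by omega)]
  · rw [ht.2.2 i, h.reg0, if_pos i.2]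

/-- The sums of the first `k` samples have been computed. -/
structure SumState (d : ℕ) (ε α lam : ℝ) (k : ℕ) (s : RamState) : Prop
    extends HasInput d ε α lam s where
  nonneg : ∀ i : Fin d, 0 ≤ s.mem 6 i
  le : ∀ i : Fin d, s.mem 6 i ≤ k

theorem ensures_addLoop_sample {k : ℕ} (h : SumState d ε α lam k s) (x : Cube d) :
    (forEach (assign 6 3 (.add (.cell 6 3) (.cell 5 3)))).Ensures μ S
      (((s.writeCube 5 x).tick (d + 1)).countSample) fun t =>
        SumState d ε α lam (k + 1) t ∧ ∀ i : Fin d, t.mem 6 i = s.mem 6 i + bitVal (x i) := by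
  set s₁ := ((s.writeCube 5 x).tick (d + 1)).countSample with hs₁
  have hin : HasInput d ε α lam s₁ := h.toHasInput.of_eq rfl rfl rfl rfl rfl
  have m6 : s₁.mem 6 = s.mem 6 := rfl
  have m5 : ∀ i : Fin d, s₁.mem 5 i = bitVal (x i) := fun i => by
    simp [hs₁, RamState.tick, RamState.countSample, RamState.writeCube]
  refine (ensures_addLoop hin).mono fun t ht => ?_
  have e : ∀ i : Fin d, t.mem 6 i = s.mem 6 i + bitVal (x i) := fun i => by
    rw [ht.2 i, m6, m5]
  refine ⟨⟨ht.1, fun i => ?_, fun i => ?_⟩, e⟩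
  · rw [e]
    exact add_nonneg (h.nonneg i) (bitVal_nonneg _)
  · rw [e]
    push_cast
    exact add_le_add (h.le i) (bitVal_le_one _)

theorem ensures_sumSamples {k : ℕ} (h : SumState d ε α lam k s) :
    sumSamples.Ensures μ S s (SumState d ε α lam (k + 1)) :=
  ensures_seq (ensures_sample fun x => (ensures_addLoop_sample h x).mono fun _ ht => ht.1)

/-- The squared deviation of the sum of `k` samples from its expectation. -/
def sumDeviation (zs : Vec d) (S : Finset (Cube d)) (k : ℕ) (s : RamState) : ENNReal :=
  ENNReal.ofReal (‖s.readVec d 6 - (k : ℝ) • truncMean zs S‖ ^ 2)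

/-- The cross term averages to zero, and each of the `d` coordinates of `x - μ` is at most `1` in
size. Thus each sample adds at most `d` to the variance of the sum. -/
theorem sum_norm_add_sub_sq_le {zs : Vec d} (h : Admissible zs S α lam) (a : Vec d) :
    ∑ x, truncProb zs S x * ‖a + (x.toVec - truncMean zs S)‖ ^ 2 ≤ ‖a‖ ^ 2 + d := by
  have h1 : ∀ x : Cube d, ‖x.toVec - truncMean zs S‖ ^ 2 ≤ d := fun x => by
    rw [EuclideanSpace.real_norm_sq_eq]
    calc ∑ i, ((x.toVec - truncMean zs S) i) ^ 2 ≤ ∑ _i : Fin d, (1 : ℝ) := by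
          refine Finset.sum_le_sum fun i _ => ?_
          rw [sq_le_one_iff_abs_le_one, abs_le, PiLp.sub_apply, Cube.toVec_apply]
          have := h.beta_le_mean i
          have := h.mean_le i
          have := h.beta_pos
          constructor <;> linarith [bitVal_nonneg (x i), bitVal_le_one (x i)]
      _ = d := by simp
  calc ∑ x, truncProb zs S x * ‖a + (x.toVec - truncMean zs S)‖ ^ 2 ≤
      ∑ x, (truncProb zs S x * (‖a‖ ^ 2 + d) +
        2 * (truncProb zs S x * inner ℝ (x.toVec - truncMean zs S) a)) := by
        refine Finset.sum_le_sum fun x _ => ?_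
        rw [norm_add_sq_real, real_inner_comm a]
        have := mul_le_mul_of_nonneg_left (h1 x) (truncProb_nonneg zs S x)
        linarith
    _ = ‖a‖ ^ 2 + d := by
        rw [Finset.sum_add_distrib, ← Finset.sum_mul, sum_truncProb zs h.nonempty,
          ← Finset.mul_sum, sum_truncProb_mul_inner_sub zs h.nonempty]
        ring

theorem expect_sumSamples_le {zs : Vec d} (h : Admissible zs S α lam) {k : ℕ}
    (hs : SumState d ε α lam k s) :
    (sumSamples.run (truncPMF zs S h.nonempty) S s).expect (sumDeviation zs S (k + 1)) ≤
      1 * sumDeviation zs S k s + ENNReal.ofReal d := by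
  rw [one_mul, sumDeviation, ← ENNReal.ofReal_add (by positivity) (by positivity)]
  refine le_trans ?_ (ENNReal.ofReal_le_ofReal (sum_norm_add_sub_sq_le h _))
  rw [sumSamples, expect_seq, expect_sample, ENNReal.ofReal_sum_of_nonneg
    fun x _ => mul_nonneg (truncProb_nonneg _ _ _) (sq_nonneg _)]
  refine Finset.sum_le_sum fun x _ => ?_
  rw [ENNReal.ofReal_mul (truncProb_nonneg _ _ _)]
  refine mul_le_mul_right (PMF.expect_le fun t ht => ?_) _
  have e := (ensures_addLoop_sample (μ := truncPMF zs S h.nonempty) (S := S) hs x t ht).2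
  refine le_of_eq ?_
  rw [sumDeviation]
  congr 3
  ext i
  simp only [PiLp.sub_apply, PiLp.add_apply, PiLp.smul_apply, RamState.readVec_apply, e,
    Cube.toVec_apply, smul_eq_mul]
  push_cast
  ring

theorem expect_sumLoop_le {zs : Vec d} (h : Admissible zs S α lam)
    (hs : SumState d ε α lam 0 s) (h0 : s.readVec d 6 = 0) :
    ((loop 1 sumSamples).run (truncPMF zs S h.nonempty) S s).expect
      (sumDeviation zs S (s.reg 1)) ≤ s.reg 1 * ENNReal.ofReal d := by
  refine expect_loop_le (fun k => SumState d ε α lam k) (sumDeviation zs S)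
    (a := 1) (b := ENNReal.ofReal d) (fun k => (k : ENNReal) * ENNReal.ofReal d)
    (fun k t ht => ensures_sumSamples ?_) (fun k t ht => ?_) (fun k => ?_) ?_ ?_
  · exact ⟨ht.toHasInput.of_eq rfl rfl rfl rfl rfl, ht.nonneg, ht.le⟩
  · exact expect_sumSamples_le (s := t.tick 1) h
      ⟨ht.toHasInput.of_eq rfl rfl rfl rfl rfl, ht.nonneg, ht.le⟩
  · push_cast
    rw [one_mul, add_mul, one_mul]
  · exact ⟨hs.toHasInput.of_eq rfl rfl rfl rfl rfl, hs.nonneg, hs.le⟩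
  · have : (s.tick 1).readVec d 6 = 0 := h0
    simp [sumDeviation, this]

theorem ensures_sumSamplesLoop (hs : SumState d ε α lam 0 s) :
    (loop 1 sumSamples).Ensures μ S s fun t => SumState d ε α lam (s.reg 1) t ∧
      t.reg 1 = s.reg 1 ∧ t.reg 2 = s.reg 2 := by
  have h1 : (loop 1 sumSamples).KeepsReg 1 := by simp [KeepsReg, sumSamples, forEach]
  have h2 : (loop 1 sumSamples).KeepsReg 2 := by simp [KeepsReg, sumSamples, forEach]
  refine (ensures_loop (fun k => SumState d ε α lam k) (fun k _ t ht => ensures_sumSamples ?_)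
    ?_).and ((h1.ensures s).and (h2.ensures s))
  · exact ⟨ht.toHasInput.of_eq rfl rfl rfl rfl rfl, ht.nonneg, ht.le⟩
  · exact ⟨hs.toHasInput.of_eq rfl rfl rfl rfl rfl, hs.nonneg, hs.le⟩

theorem ensures_raiseCell (h : HasInput d ε α lam s) (a : ℕ) (ha : a ≠ 1 ∧ a ≠ 2 ∧ a ≠ 3) :
    (raiseCell a).Ensures μ S s fun t => HasInput d ε α lam t ∧ t.reg 3 = s.reg 3 ∧
      t.mem = Function.update s.mem a
        (Function.update (s.mem a) (s.reg 3) (max (s.mem a (s.reg 3)) (α * lam))) := by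
  refine ensures_ifLE (fun hle => ensures_assign ?_) fun hle => ensures_skip ?_
  · rw [h.eval_beta, RExpr.eval] at hle
    have hb : RExpr.beta.eval (s.tick ((RExpr.cell a 3).cost + RExpr.beta.cost + 1)) = α * lam :=
      h.eval_beta
    rw [hb, max_eq_right hle]
    refine ⟨h.of_eq rfl rfl ?_ ?_ ?_, rfl, rfl⟩
    · simp [RamState.tick, RamState.setMem, ha.1.symm]
    · simp [RamState.tick, RamState.setMem, ha.2.1.symm]
    · simp [RamState.tick, RamState.setMem, ha.2.2.symm]
  · rw [h.eval_beta, RExpr.eval] at hle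
    refine ⟨h.of_eq rfl rfl rfl rfl rfl, rfl, ?_⟩
    rw [max_eq_left (le_of_not_ge hle)]
    simp [RamState.tick]

theorem ensures_initBody (h : HasInput d ε α lam s) :
    initBody.Ensures μ S s fun t =>
      t.mem 6 = Function.update (s.mem 6) (s.reg 3)
        (clippedLogit (α * lam) (s.mem 6 (s.reg 3) / s.reg 1)) ∧
      t.mem 0 = Function.update (s.mem 0) (s.reg 3)
        (clippedLogit (α * lam) (s.mem 6 (s.reg 3) / s.reg 1)) := by
  refine ensures_seq (ensures_assign (ensures_seq (ensures_assign ?_)))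
  set t := ((((s.setMem 8 (s.reg 3) (((RExpr.cell 6 3).div (.ofNat 1)).eval s)).tick
    (((RExpr.cell 6 3).div (.ofNat 1)).cost + 1)).setMem 7 _ _).tick _) with ht
  have hin : HasInput d ε α lam t := h.of_eq rfl rfl rfl rfl rfl
  have h3 : t.reg 3 = s.reg 3 := rfl
  have h6 : t.mem 6 = s.mem 6 := rfl
  have h0 : t.mem 0 = s.mem 0 := rfl
  have h8 : t.mem 8 (s.reg 3) = s.mem 6 (s.reg 3) / s.reg 1 := by
    simp [ht, RamState.tick, RamState.setMem, RExpr.eval]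
  have h7 : t.mem 7 (s.reg 3) = 1 - s.mem 6 (s.reg 3) / s.reg 1 := by
    simp [ht, RamState.tick, RamState.setMem, RExpr.eval]
  refine ensures_seq ((ensures_raiseCell hin 8 (by decide)).mono fun t₁ ⟨i1, r1, e1⟩ => ?_)
  refine ensures_seq ((ensures_raiseCell i1 7 (by decide)).mono fun t₂ ⟨i2, r2, e2⟩ => ?_)
  refine ensures_seq (ensures_assign (ensures_assign ?_))
  rw [r1] at e2 r2
  simp [RamState.tick, RamState.setMem, RExpr.eval, r2, e2, e1, h3, h6, h0, h8, h7, clippedLogit]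

theorem ensures_init (h : HasInput d ε α lam s) :
    (forEach initBody).Ensures μ S s fun t => HasInput d ε α lam t ∧ t.reg 2 = s.reg 2 ∧
      ∀ i : Fin d, t.mem 6 i = clippedLogit (α * lam) (s.mem 6 i / s.reg 1) ∧
        t.mem 0 i = clippedLogit (α * lam) (s.mem 6 i / s.reg 1) := by
  have hin := h.ensures (μ := μ) (S := S) (p := forEach initBody)
    (by simp [forEach, initBody, raiseCell, KeepsReg])
    (by simp [forEach, initBody, raiseCell, KeepsReg])
    (by simp [forEach, initBody, raiseCell, KeepsMem])
    (by simp [forEach, initBody, raiseCell, KeepsMem])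
    (by simp [forEach, initBody, raiseCell, KeepsMem])
  refine hin.and ((ensures_forEach (fun _ => by simp [initBody, raiseCell, KeepsReg])
    -- The second half of the invariant says that entries not yet reached still hold sums, since
    -- array `6` is overwritten in place by logits.
    (fun k m => ∀ i : Fin d, (i.val < k →
      m 6 i = clippedLogit (α * lam) (s.mem 6 i / s.reg 1) ∧
      m 0 i = clippedLogit (α * lam) (s.mem 6 i / s.reg 1)) ∧ (k ≤ i.val → m 6 i = s.mem 6 i))
    (by simp) ?_).mono fun t ht => ⟨ht.1 2 (by decide), fun i => (ht.2.2 i).1 ?_⟩)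
  · intro k hk t h3 hr hm hi
    have ht : HasInput d ε α lam t := h.of_eq (hr _ (by decide)) (hr _ (by decide))
      (hm _ (by simp [initBody, raiseCell, KeepsMem]))
      (hm _ (by simp [initBody, raiseCell, KeepsMem]))
      (hm _ (by simp [initBody, raiseCell, KeepsMem]))
    refine (ensures_initBody ht).mono fun v hv i => ?_
    rw [hv.1, hv.2, h3, hr 1 (by decide)]
    rcases lt_trichotomy i.val k with hik | hik | hik
    · simp only [Function.update_of_ne hik.ne]
      exact ⟨fun _ => (hi i).1 hik, fun hle => by omega⟩
    · rw [← hik]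
      simp only [Function.update_self]
      rw [(hi i).2 hik.ge]
      exact ⟨fun _ => ⟨rfl, rfl⟩, fun hle => by omega⟩
    · simp only [Function.update_of_ne hik.ne']
      exact ⟨fun hlt => by omega, fun _ => (hi i).2 hik.le⟩
  · rw [h.reg0]
    exact i.2

/-- The initial estimate computed from the sums of `n` samples. -/
def initialEstimate (α lam : ℝ) (n : ℕ) (m : Vec d) : Vec d :=
  logitVec (α * lam) ((n : ℝ)⁻¹ • m)

theorem abs_initialEstimate_le {zs : Vec d} (h : Admissible zs S α lam) {n : ℕ}
    (hs : SumState d ε α lam n s) (i : Fin d) :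
    |initialEstimate α lam n (s.readVec d 6) i| ≤ -Real.log (α * lam) := by
  refine h.abs_logitVec_le (fun i => ?_) (fun i => ?_) i <;>
    simp only [PiLp.smul_apply, RamState.readVec_apply, smul_eq_mul]
  · exact mul_nonneg (by positivity) (hs.nonneg i)
  · rw [inv_mul_eq_div]
    exact div_le_one_of_le₀ (hs.le i) (by positivity)

theorem ensures_init_stepState {zs : Vec d} (h : Admissible zs S α lam) {n : ℕ}
    (hs : SumState d ε α lam n s) (hn : s.reg 1 = n) :
    (forEach initBody).Ensures μ S s fun t =>
      StepState d ε α lam (initialEstimate α lam n (s.readVec d 6)) t ∧ t.reg 2 = s.reg 2 ∧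
        t.readVec d 0 = initialEstimate α lam n (s.readVec d 6) := by
  refine (ensures_init hs.toHasInput).mono fun t ⟨h1, h2, h3⟩ => ?_
  have e : ∀ i : Fin d, clippedLogit (α * lam) (s.mem 6 i / s.reg 1) =
      initialEstimate α lam n (s.readVec d 6) i := fun i => by
    simp only [initialEstimate, logitVec, PiLp.smul_apply, RamState.readVec_apply, smul_eq_mul, hn,
      inv_mul_eq_div]
  refine ⟨⟨h1, ?_, fun i => ?_⟩, h2, ?_⟩
  · ext i
    rw [RamState.readVec_apply, (h3 i).1, e]
  · rw [(h3 i).2, e]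
    exact abs_initialEstimate_le h hs i
  · ext i
    rw [RamState.readVec_apply, (h3 i).2, e]

/-! ### Convergence -/

theorem ensures_sgdLoop (hs : StepState d ε α lam u s) (hB : 0 ≤ -Real.log (α * lam)) :
    (loop 2 sgdStep).Ensures μ S s (StepState d ε α lam u) :=
  ensures_loop (fun _ => StepState d ε α lam u)
    (fun _ _ _ ht => ensures_sgdStep
      ⟨ht.toHasInput.of_eq rfl rfl rfl rfl rfl, ht.center, ht.bounded⟩ hB)
    ⟨hs.toHasInput.of_eq rfl rfl rfl rfl rfl, hs.center, hs.bounded⟩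

theorem expect_sgdLoop_le {zs : Vec d} {η : ℝ}
    (h : Admissible zs S α lam) (hs : StepState d ε α lam u s)
    (hub : ∀ i, |u i| ≤ -Real.log (α * lam))
    (hu : ‖u - Admissible.meanLogit zs S α lam‖ ≤ α * lam / 4)
    (hη : η = (α * lam) ^ 3 * ε ^ 2 / (320000 * d))
    (ha : 0 ≤ 1 - 2 * η * Admissible.rate α lam) :
    ((loop 2 sgdStep).run (truncPMF zs S h.nonempty) S s).expect (sqDist zs) ≤
      ENNReal.ofReal ((1 - 2 * η * Admissible.rate α lam) ^ s.reg 2 * ‖s.readVec d 0 - zs‖ ^ 2 +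
        η * d / (2 * Admissible.rate α lam)) := by
  have hb := h.beta_pos
  have hη0 : 0 ≤ η := by rw [hη]; positivity
  have hr : 0 < Admissible.rate α lam := by rw [Admissible.rate]; positivity
  set a := 1 - 2 * η * Admissible.rate α lam with ha'
  set κ := Admissible.rate α lam with hκ
  have hB : 0 ≤ -Real.log (α * lam) := (abs_nonneg _).trans (h.abs_le ⟨0, h.dim_pos⟩)
  refine expect_loop_le (fun _ => StepState d ε α lam u) (fun _ => sqDist zs)
    (a := ENNReal.ofReal a) (b := ENNReal.ofReal (η ^ 2 * d))
    (fun k => ENNReal.ofReal (a ^ k * ‖s.readVec d 0 - zs‖ ^ 2 + η * d / (2 * κ)))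
    (fun k t ht => ensures_sgdStep
      ⟨ht.toHasInput.of_eq rfl rfl rfl rfl rfl, ht.center, ht.bounded⟩ hB)
    (fun k t ht => ?_) (fun k => ?_)
    ⟨hs.toHasInput.of_eq rfl rfl rfl rfl rfl, hs.center, hs.bounded⟩ ?_
  · refine (expect_sgdStep_le (s := t.tick 1) h
      ⟨ht.toHasInput.of_eq rfl rfl rfl rfl rfl, ht.center, ht.bounded⟩ hub hu hη).trans_eq ?_
    rw [ENNReal.ofReal_add (by positivity) (by positivity), ENNReal.ofReal_mul ha]
    rfl
  · rw [← ENNReal.ofReal_mul ha, ← ENNReal.ofReal_add (by positivity) (by positivity)]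
    refine ENNReal.ofReal_le_ofReal (le_of_eq ?_)
    -- The noise floor `η * d / (2 * κ)` is the fixed point of the affine recursion, so the
    -- geometric part decays separately.
    have : a * (η * d / (2 * κ)) + η ^ 2 * d = η * d / (2 * κ) := by
      rw [ha']
      field_simp
      ring
    rw [pow_succ]
    linear_combination this
  · rw [sqDist]
    refine ENNReal.ofReal_le_ofReal ?_
    have e : (s.tick 1).readVec d 0 = s.readVec d 0 := rfl
    rw [pow_zero, one_mul, e]
    exact le_add_of_nonneg_right (by positivity)

end Prog

end

noncomputable section

/-! ### Accuracy of the algorithm -/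

/-- The number of samples for the initial estimate. -/
def numSamples (d : ℕ) (ε α lam : ℝ) : ℕ :=
  if 4 * d / (α * lam) ^ 2 ≤ ε ^ 2 then 0 else ⌈1638400 * (d / ε ^ 2) / (α * lam) ^ 6⌉₊

/-- The number of gradient steps. -/
def numSteps (d : ℕ) (ε α lam : ℝ) : ℕ :=
  if 8 / (α * lam) ≤ ε then 0
  else ⌈128000000 * (d / ε ^ 2) *
      Real.log (12800 * (2 + d / ε ^ 2) / (α * lam) ^ 2) / (α * lam) ^ 6⌉₊

/-- The step size makes the noise floor exactly `ε² / 800`. The number of steps makes the geometric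
factor at most `1 / Y`, which brings the initial squared distance `(4 / b)²` below `ε² / 800` too.
-/
theorem contraction_bound {d : ℕ} {ε b D η κ : ℝ} (hd : 0 < d) (hε : 0 < ε) (hb : 0 < b)
    (hb1 : b ≤ 1 / 2) (hεb : ε < 8 / b) (hη : η = b ^ 3 * ε ^ 2 / (320000 * d))
    (hκ : κ = b ^ 3 / 800) {T : ℕ}
    (hT : 128000000 * (d / ε ^ 2) * Real.log (12800 * (2 + d / ε ^ 2) / b ^ 2) / b ^ 6 ≤ T)
    (hD0 : 0 ≤ D) (hD : D ≤ 4 / b) :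
    0 ≤ 1 - 2 * η * κ ∧
      (1 - 2 * η * κ) ^ T * D ^ 2 + η * d / (2 * κ) ≤ ε ^ 2 / 400 := by
  have hd' : (1 : ℝ) ≤ d := by exact_mod_cast hd
  have hd0 : (0 : ℝ) < d := by linarith
  set θ := 2 * η * κ with hθ
  have hθ' : θ = b ^ 6 * ε ^ 2 / (128000000 * d) := by
    rw [hθ, hη, hκ]
    field_simp
    ring
  have hθ0 : 0 < θ := by rw [hθ']; positivity
  -- Without this bound on `ε` the step could be too long for the contraction factor to stay
  -- nonnegative.
  have hbε : b * ε < 8 := by rwa [lt_div_iff₀ hb, mul_comm] at hεb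
  have hθ1 : θ ≤ 1 := by
    rw [hθ', div_le_one (by positivity)]
    have h1 : (b * ε) ^ 2 ≤ 8 ^ 2 := pow_le_pow_left₀ (by positivity) hbε.le 2
    have h2 : b ^ 4 ≤ 1 := pow_le_one₀ hb.le (by linarith)
    calc b ^ 6 * ε ^ 2 = b ^ 4 * (b * ε) ^ 2 := by ring
      _ ≤ 1 * 8 ^ 2 := by gcongr
      _ ≤ 128000000 * d := by linarith
  refine ⟨by linarith, ?_⟩
  set Y := 12800 * (2 + d / ε ^ 2) / b ^ 2 with hY
  have hY0 : 0 < Y := by positivity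
  have hlog : Real.log Y ≤ θ * T := by
    calc Real.log Y = θ * (128000000 * (d / ε ^ 2) * Real.log Y / b ^ 6) := by
          rw [hθ']
          field_simp
      _ ≤ θ * T := by gcongr
  have h1 : (1 - θ) ^ T ≤ 1 / Y := by
    calc (1 - θ) ^ T ≤ Real.exp (-θ) ^ T :=
          pow_le_pow_left₀ (by linarith) (by linarith [Real.add_one_le_exp (-θ)]) T
      _ = Real.exp (-(θ * T)) := by rw [← Real.exp_nat_mul]; ring_nf
      _ ≤ Real.exp (-Real.log Y) := Real.exp_le_exp.2 (by linarith)
      _ = 1 / Y := by rw [Real.exp_neg, Real.exp_log hY0, one_div]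
  have h2 : D ^ 2 ≤ (4 / b) ^ 2 := pow_le_pow_left₀ hD0 hD 2
  have h3 : 1 / Y * (4 / b) ^ 2 ≤ ε ^ 2 / 800 := by
    have e : 1 / Y * (4 / b) ^ 2 = 1 / (800 * (2 + d / ε ^ 2)) := by
      rw [hY]
      field_simp
      norm_num
    rw [e, div_le_div_iff₀ (by positivity) (by norm_num)]
    have : ε ^ 2 * (d / ε ^ 2) = d := by field_simp
    nlinarith [sq_nonneg ε]
  have h4 : η * d / (2 * κ) = ε ^ 2 / 800 := by
    rw [hη, hκ]
    field_simp
    norm_num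
  have h5 : (1 - θ) ^ T * D ^ 2 ≤ 1 / Y * (4 / b) ^ 2 :=
    mul_le_mul h1 h2 (sq_nonneg D) (by positivity)
  linarith

namespace Prog

variable {d : ℕ} {μ : PMF (Cube d)} {S : Finset (Cube d)} {s : RamState} {ε α lam : ℝ} {u : Vec d}

/-! ### Iteration counts and failure probability -/

/-- The cost of choosing the numbers of iterations, apart from these numbers themselves. -/
def chooseCost : ℕ :=
  (RExpr.div (.mul (.const 4) (.ofNat 0)) (.mul .beta .beta)).cost + (RExpr.mul .eps .eps).cost +
    RExpr.sampleCount.cost + (RExpr.div (.const 8) .beta).cost + RExpr.eps.cost +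
      RExpr.stepCount.cost + 6

theorem ensures_chooseCounts (h : HasInput d ε α lam s) :
    chooseCounts.Ensures μ S s fun t => t.mem = s.mem ∧ HasInput d ε α lam t ∧
      t.reg 1 = numSamples d ε α lam ∧ t.reg 2 = numSteps d ε α lam ∧
      t.time ≤ s.time + chooseCost + numSamples d ε α lam + numSteps d ε α lam ∧
      t.samples = s.samples ∧ t.queries = s.queries := by
  have e1 : (RExpr.div (.mul (.const 4) (.ofNat 0)) (.mul .beta .beta)).eval s =
      4 * d / (α * lam) ^ 2 := by
    simp [RExpr.eval, h.reg0, h.eval_beta, sq]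
  have e2 : (RExpr.mul .eps .eps).eval s = ε ^ 2 := by simp [RExpr.eval, h.eval_eps, sq]
  have h1 : (ifLE (.div (.mul (.const 4) (.ofNat 0)) (.mul .beta .beta)) (.mul .eps .eps)
      (zero 1) (ceil 1 .sampleCount)).Ensures μ S s fun t => t.mem = s.mem ∧
        HasInput d ε α lam t ∧ t.reg 1 = numSamples d ε α lam ∧
        t.time ≤ s.time + (RExpr.div (.mul (.const 4) (.ofNat 0)) (.mul .beta .beta)).cost +
          (RExpr.mul .eps .eps).cost + RExpr.sampleCount.cost + 3 + numSamples d ε α lam ∧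
        t.samples = s.samples ∧ t.queries = s.queries := by
    refine ensures_ifLE (fun hle => ensures_zero ?_) fun hle => ensures_ceil ?_
    · rw [e1, e2] at hle
      refine ⟨rfl, h.of_eq rfl rfl rfl rfl rfl, ?_, ?_, rfl, rfl⟩
      · simp [RamState.tick, RamState.setReg, numSamples, hle]
      · simp only [RamState.tick, RamState.setReg]
        omega
    · rw [e1, e2] at hle
      have hev := (h.of_eq (t := s.tick
        ((RExpr.div (.mul (.const 4) (.ofNat 0)) (.mul .beta .beta)).cost +
          (RExpr.mul .eps .eps).cost + 1)) rfl rfl rfl rfl rfl).eval_sampleCount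
      have hn : numSamples d ε α lam = ⌈1638400 * (d / ε ^ 2) / (α * lam) ^ 6⌉₊ := if_neg hle
      rw [hev, ← hn]
      refine ⟨rfl, h.of_eq rfl rfl rfl rfl rfl, ?_, ?_, rfl, rfl⟩
      · simp [RamState.tick, RamState.setReg]
      · simp only [RamState.tick, RamState.setReg]
        omega
  refine ensures_seq (h1.mono fun t ⟨m1, i1, r1, t1, s1, q1⟩ => ?_)
  have e3 : (RExpr.div (.const 8) .beta).eval t = 8 / (α * lam) := by
    simp [RExpr.eval, i1.eval_beta]
  refine ensures_ifLE (fun hle => ensures_zero ?_) fun hle => ensures_ceil ?_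
  · rw [e3, i1.eval_eps] at hle
    refine ⟨m1, i1.of_eq rfl rfl rfl rfl rfl, ?_, ?_, ?_, s1, q1⟩
    · simp [RamState.tick, RamState.setReg, r1]
    · simp [RamState.tick, RamState.setReg, numSteps, hle]
    · simp only [RamState.tick, RamState.setReg, chooseCost]
      omega
  · rw [e3, i1.eval_eps] at hle
    have hev := (i1.of_eq (t := t.tick ((RExpr.div (.const 8) .beta).cost + RExpr.eps.cost + 1))
      rfl rfl rfl rfl rfl).eval_stepCount
    have hn : numSteps d ε α lam = ⌈128000000 * (d / ε ^ 2) *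
      Real.log (12800 * (2 + d / ε ^ 2) / (α * lam) ^ 2) / (α * lam) ^ 6⌉₊ := if_neg hle
    rw [hev, ← hn]
    refine ⟨m1, i1.of_eq rfl rfl rfl rfl rfl, ?_, ?_, ?_, s1, q1⟩
    · simp [RamState.tick, RamState.setReg, r1]
    · simp [RamState.tick, RamState.setReg]
    · simp only [RamState.tick, RamState.setReg, chooseCost]
      omega

/-- Indicator of the event that the output is not within distance `ε` of `zs`. -/
def fail (zs : Vec d) (ε : ℝ) (s : RamState) : ENNReal :=
  if ‖s.readVec d 0 - zs‖ ≤ ε then 0 else 1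

theorem fail_le_one (zs : Vec d) (ε : ℝ) (s : RamState) : fail zs ε s ≤ 1 := by
  rw [fail]
  split_ifs <;> simp

/-- Both points lie in the box of half-side `-log (α * lam) ≤ 1 / (α * lam)`, whose diameter is then
at most `ε`. -/
theorem norm_sub_le_of_bounded {zs : Vec d} (h : Admissible zs S α lam) (hε : 0 < ε)
    (hle : 4 * d / (α * lam) ^ 2 ≤ ε ^ 2)
    (hs : ∀ i : Fin d, |s.mem 0 i| ≤ -Real.log (α * lam)) : ‖s.readVec d 0 - zs‖ ≤ ε := by
  have hb := h.beta_pos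
  have hB : -Real.log (α * lam) ≤ 1 / (α * lam) := by
    have := Real.log_le_sub_one_of_pos (inv_pos.2 hb)
    rw [Real.log_inv] at this
    rw [one_div]
    linarith
  rw [← sq_le_sq₀ (norm_nonneg _) hε.le, norm_readVec_sub_sq]
  calc ∑ i : Fin d, (s.mem 0 i - zs i) ^ 2 ≤ ∑ _i : Fin d, (2 / (α * lam)) ^ 2 := by
        refine Finset.sum_le_sum fun i _ => ?_
        refine sq_le_sq.2 ?_
        rw [abs_of_pos (by positivity : 0 < 2 / (α * lam))]
        have h1 := (hs i).trans hB
        have h2 := (h.abs_le i).trans hB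
        calc |s.mem 0 i - zs i| ≤ |s.mem 0 i| + |zs i| := abs_sub _ _
          _ ≤ 1 / (α * lam) + 1 / (α * lam) := add_le_add h1 h2
          _ = 2 / (α * lam) := by ring
    _ = 4 * d / (α * lam) ^ 2 := by
        simp only [Finset.sum_const, Finset.card_univ, Fintype.card_fin, nsmul_eq_mul]
        ring
    _ ≤ ε ^ 2 := hle

theorem ensures_estimate_bounded {zs : Vec d} (h : Admissible zs S α lam)
    (hs : SumState d ε α lam 0 s) :
    estimate.Ensures μ S s fun t => ∀ i : Fin d, |t.mem 0 i| ≤ -Real.log (α * lam) := by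
  have hB : 0 ≤ -Real.log (α * lam) := (abs_nonneg _).trans (h.abs_le ⟨0, h.dim_pos⟩)
  exact ensures_seq ((ensures_sumSamplesLoop hs).mono fun t ⟨ht, h1, _⟩ =>
    ensures_seq ((ensures_init_stepState h ht h1).mono fun t' ⟨ht', _, _⟩ =>
      (ensures_sgdLoop ht' hB).mono fun v hv => hv.bounded))

/-- Chebyshev: the sum of `n` samples has expected squared deviation at most `n * d`, so the mean
misses by more than `δ` with probability at most `1 / 400`. The rest adds at most `1 / 400`
otherwise. -/
theorem expect_estimate_le_of_concentration {zs : Vec d} (h : Admissible zs S α lam)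
    (hs : SumState d ε α lam 0 s) (h0 : s.readVec d 6 = 0) {δ : ℝ} (hδ : 0 < δ)
    (hn : 0 < s.reg 1) (hnd : 400 * d ≤ s.reg 1 * δ ^ 2)
    (hrest : ∀ t, SumState d ε α lam (s.reg 1) t → t.reg 1 = s.reg 1 → t.reg 2 = s.reg 2 →
      ‖((s.reg 1 : ℕ) : ℝ)⁻¹ • t.readVec d 6 - truncMean zs S‖ ≤ δ →
      ((seq (forEach initBody) (loop 2 sgdStep)).run (truncPMF zs S h.nonempty) S t).expect
        (fail zs ε) ≤ ENNReal.ofReal (1 / 400)) :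
    (estimate.run (truncPMF zs S h.nonempty) S s).expect (fail zs ε) ≤
      ENNReal.ofReal (1 / 100) := by
  set n := s.reg 1 with hn'
  have hnR : (0 : ℝ) < n := by exact_mod_cast hn
  rw [estimate, expect_seq]
  calc _ ≤ ((loop 1 sumSamples).run (truncPMF zs S h.nonempty) S s).expect fun t =>
        ENNReal.ofReal (1 / (n * δ) ^ 2) * sumDeviation zs S n t + ENNReal.ofReal (1 / 400) := by
        refine PMF.expect_mono fun t ht => ?_
        obtain ⟨h1, h2, h3⟩ := ensures_sumSamplesLoop hs t ht
        by_cases hc : ‖(n : ℝ)⁻¹ • t.readVec d 6 - truncMean zs S‖ ≤ δ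
        · exact (hrest t h1 h2 h3 hc).trans le_add_self
        · refine le_trans (PMF.expect_le fun _ _ => fail_le_one _ _ _) ?_
          refine le_trans ?_ le_self_add
          rw [sumDeviation, ← ENNReal.ofReal_mul (by positivity)]
          rw [ENNReal.one_le_ofReal]
          rw [not_le] at hc
          have e : t.readVec d 6 - (n : ℝ) • truncMean zs S =
              (n : ℝ) • ((n : ℝ)⁻¹ • t.readVec d 6 - truncMean zs S) := by
            rw [smul_sub, smul_smul, mul_inv_cancel₀ hnR.ne', one_smul]
          rw [e, norm_smul, Real.norm_of_nonneg hnR.le, one_div, inv_mul_eq_div,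
            le_div_iff₀ (by positivity), one_mul]
          gcongr
    _ = ENNReal.ofReal (1 / (n * δ) ^ 2) *
          ((loop 1 sumSamples).run (truncPMF zs S h.nonempty) S s).expect (sumDeviation zs S n) +
          ENNReal.ofReal (1 / 400) := PMF.expect_affine _ _ _ _
    _ ≤ ENNReal.ofReal (1 / (n * δ) ^ 2) * (n * ENNReal.ofReal d) + ENNReal.ofReal (1 / 400) := by
        gcongr
        exact expect_sumLoop_le h hs h0
    _ ≤ ENNReal.ofReal (1 / 100) := by
        rw [← ENNReal.ofReal_natCast, ← ENNReal.ofReal_mul (by positivity),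
          ← ENNReal.ofReal_mul (by positivity), ← ENNReal.ofReal_add (by positivity) (by norm_num)]
        refine ENNReal.ofReal_le_ofReal ?_
        have : 1 / (n * δ) ^ 2 * (n * d) ≤ 1 / 400 := by
          rw [one_div, inv_mul_eq_div, div_le_div_iff₀ (by positivity) (by norm_num)]
          nlinarith
        linarith

/-- Three regimes of `ε`: the whole box is good enough; the initial estimate is; or the gradient
steps start from an estimate within `b / 4` of the mean logits. -/
theorem expect_estimate_le {zs : Vec d} (h : Admissible zs S α lam) (hε : 0 < ε)
    (hs : SumState d ε α lam 0 s) (h0 : s.readVec d 6 = 0)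
    (h1 : s.reg 1 = numSamples d ε α lam) (h2 : s.reg 2 = numSteps d ε α lam) :
    (estimate.run (truncPMF zs S h.nonempty) S s).expect (fail zs ε) ≤
      ENNReal.ofReal (1 / 100) := by
  have hb := h.beta_pos
  have hb1 := h.beta_le_half
  have hd : (1 : ℝ) ≤ d := by exact_mod_cast h.dim_pos
  by_cases hA : 4 * d / (α * lam) ^ 2 ≤ ε ^ 2
  · refine PMF.expect_le fun t ht => ?_
    rw [fail, if_pos (norm_sub_le_of_bounded h hε hA (ensures_estimate_bounded h hs t ht))]
    exact zero_le
  have hn : 1638400 * (d / ε ^ 2) / (α * lam) ^ 6 ≤ (s.reg 1 : ℝ) := by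
    rw [h1, numSamples, if_neg hA]
    exact Nat.le_ceil _
  set b := α * lam with hbdef
  have hn0 : 0 < s.reg 1 := by
    have : (0 : ℝ) < s.reg 1 := lt_of_lt_of_le (by positivity) hn
    exact_mod_cast this
  have hn' : 1638400 * d ≤ s.reg 1 * (b ^ 6 * ε ^ 2) := by
    rw [div_le_iff₀ (by positivity)] at hn
    calc 1638400 * (d : ℝ) = 1638400 * (d / ε ^ 2) * ε ^ 2 := by field_simp
      _ ≤ s.reg 1 * b ^ 6 * ε ^ 2 := by gcongr
      _ = _ := by ring
  have hinit : ∀ t, SumState d ε α lam (s.reg 1) t → ∀ δ, 2 / b *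
      ‖((s.reg 1 : ℕ) : ℝ)⁻¹ • t.readVec d 6 - truncMean zs S‖ ≤ δ →
      ‖initialEstimate α lam (s.reg 1) (t.readVec d 6) - Admissible.meanLogit zs S α lam‖ ≤ δ :=
    fun t _ δ hδ => (h.norm_logitVec_sub_le _).trans hδ
  by_cases hB : 8 / b ≤ ε
  -- The clipped logit is `2 / b`-Lipschitz at the true mean, so this gives logit error `ε / 2`; the
  -- bias `3 / b` of the mean logits is also at most `ε / 2`.
  · refine expect_estimate_le_of_concentration h hs h0 (δ := b * ε / 4) (by positivity) hn0 ?_ ?_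
    · have h4 : b ^ 6 ≤ b ^ 2 := pow_le_pow_of_le_one hb.le (by linarith) (by norm_num)
      have h5 : (s.reg 1 : ℝ) * (b ^ 6 * ε ^ 2) ≤ s.reg 1 * (b ^ 2 * ε ^ 2) := by gcongr
      nlinarith
    · intro t ht ht1 ht2 hc
      refine expect_seq_le ((ensures_init_stepState h ht ht1).mono fun t' ⟨ht', hr, hz⟩ => ?_)
      have hT : t'.reg 2 = 0 := by rw [hr, ht2, h2, numSteps, if_pos hB]
      rw [run_loop, hT, iter_zero, PMF.expect_pure, fail, if_pos]
      · exact zero_le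
      · have e : (t'.tick 1).readVec d 0 = initialEstimate α lam (s.reg 1) (t.readVec d 6) := hz
        rw [e]
        have h6 := hinit t ht (ε / 2) (by
          calc 2 / b * _ ≤ 2 / b * (b * ε / 4) := by gcongr
            _ = ε / 2 := by field_simp; norm_num)
        have h7 := h.norm_meanLogit_sub_le
        have h8 : 3 / b ≤ ε / 2 := by
          have : 3 / b = 3 / 8 * (8 / b) := by ring
          rw [this]
          linarith
        calc _ = ‖(initialEstimate α lam (s.reg 1) (t.readVec d 6) -
              Admissible.meanLogit zs S α lam) + (Admissible.meanLogit zs S α lam - zs)‖ := by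
              congr 1; abel
          _ ≤ ε / 2 + ε / 2 := (norm_add_le _ _).trans (add_le_add h6 (h7.trans h8))
          _ = ε := by ring
  · have hεb := not_le.1 hB
    -- Gives logit error `b / 4`. With `b * ε < 8` the sample count meets the requirement, since
    -- `1638400 = 400 * 64 * 64`.
    refine expect_estimate_le_of_concentration h hs h0 (δ := b ^ 2 / 8) (by positivity) hn0 ?_ ?_
    · have h3 : b * ε < 8 := by rwa [lt_div_iff₀ hb, mul_comm] at hεb
      have h4 : (b * ε) ^ 2 ≤ 64 := by
        calc (b * ε) ^ 2 ≤ 8 ^ 2 := pow_le_pow_left₀ (by positivity) h3.le 2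
          _ = 64 := by norm_num
      have h5 : (s.reg 1 : ℝ) * (b ^ 6 * ε ^ 2) ≤ s.reg 1 * (b ^ 4 * 64) := by
        calc (s.reg 1 : ℝ) * (b ^ 6 * ε ^ 2) = s.reg 1 * (b ^ 4 * (b * ε) ^ 2) := by ring
          _ ≤ _ := by gcongr
      nlinarith
    · intro t ht ht1 ht2 hc
      refine expect_seq_le ((ensures_init_stepState h ht ht1).mono fun t' ⟨ht', hr, hz⟩ => ?_)
      set v := initialEstimate α lam (s.reg 1) (t.readVec d 6) with hv
      have hnear := hinit t ht (b / 4) (by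
          calc 2 / b * _ ≤ 2 / b * (b ^ 2 / 8) := by gcongr
            _ = b / 4 := by field_simp; norm_num)
      have hT : 128000000 * (d / ε ^ 2) * Real.log (12800 * (2 + d / ε ^ 2) / b ^ 2) / b ^ 6 ≤
          (t'.reg 2 : ℝ) := by
        rw [hr, ht2, h2, numSteps, if_neg hB]
        exact Nat.le_ceil _
      obtain ⟨ha, hfin⟩ := contraction_bound (κ := Admissible.rate α lam) h.dim_pos hε hb hb1 hεb
        rfl rfl hT (norm_nonneg _) (h.norm_sub_le_of_near hnear)
      have hconv := expect_sgdLoop_le h ht' (abs_initialEstimate_le h ht) hnear rfl ha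
      rw [hz] at hconv
      calc _ ≤ ((loop 2 sgdStep).run (truncPMF zs S h.nonempty) S t').expect fun w =>
            ENNReal.ofReal (1 / ε ^ 2) * sqDist zs w + 0 := by
            refine PMF.expect_mono fun w _ => ?_
            rw [fail]
            split_ifs with hw
            · exact zero_le
            · rw [add_zero, sqDist, ← ENNReal.ofReal_mul (by positivity), ENNReal.one_le_ofReal,
                one_div, inv_mul_eq_div, le_div_iff₀ (by positivity), one_mul]
              exact pow_le_pow_left₀ hε.le (not_le.1 hw).le 2
        _ = ENNReal.ofReal (1 / ε ^ 2) *
            ((loop 2 sgdStep).run (truncPMF zs S h.nonempty) S t').expect (sqDist zs) + 0 :=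
            PMF.expect_affine _ _ _ _
        _ ≤ ENNReal.ofReal (1 / ε ^ 2) * ENNReal.ofReal (ε ^ 2 / 400) := by
            rw [add_zero]
            gcongr
            exact hconv.trans (ENNReal.ofReal_le_ofReal hfin)
        _ = ENNReal.ofReal (1 / 400) := by
            rw [← ENNReal.ofReal_mul (by positivity)]
            congr 1
            field_simp

theorem hasInput_init (d : ℕ) (ε α lam : ℝ) : HasInput d ε α lam (RamState.init d ε α lam) :=
  ⟨rfl, rfl, rfl, rfl, rfl⟩

theorem expect_learn_le {zs : Vec d} (h : Admissible zs S α lam) (hε : 0 < ε) :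
    (learn.run (truncPMF zs S h.nonempty) S (RamState.init d ε α lam)).expect (fail zs ε) ≤
      ENNReal.ofReal (1 / 100) := by
  refine expect_seq_le ((ensures_chooseCounts (hasInput_init d ε α lam)).mono
    fun t ⟨hm, hi, h1, h2, _⟩ => ?_)
  have h6 : ∀ i, t.mem 6 i = 0 := fun i => by
    rw [hm]
    simp [RamState.init]
  refine expect_estimate_le h hε ⟨hi, fun i => (h6 i).ge, fun i => ?_⟩ ?_ h1 h2
  · rw [h6]
    simp
  · ext i
    rw [RamState.readVec_apply, h6]
    rfl

end Prog

end

noncomputable section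

/-! ### Resources -/

namespace Prog

theorem timeBound_estimate_le (d : ℕ) (R : ℕ → ℕ) (h : R 0 = d) :
    estimate.timeBound d R ≤ 1000 * (1 + d) * (1 + R 1 + R 2) := by
  simp only [estimate, sumSamples, forEach, initBody, raiseCell, sgdStep, sumLoop, likelihoodStep,
    coinLoop, bregmanStep, updateLoop, updateBody, timeBound, RExpr.cost, RExpr.bregmanTerm,
    RExpr.softplus, RExpr.sigmoid, RExpr.beta, RExpr.bound, RExpr.stepSize, RExpr.eps, h]
  ring_nf
  omega

theorem oracleBound_estimate (R : ℕ → ℕ) : estimate.oracleBound R = R 1 + 2 * R 2 := by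
  simp [estimate, sumSamples, forEach, initBody, raiseCell, sgdStep, sumLoop, likelihoodStep,
    coinLoop, bregmanStep, updateLoop, updateBody, oracleBound, mul_comm]

theorem static_estimate : estimate.Static fun r => r = 0 ∨ r = 1 ∨ r = 2 := by
  simp [estimate, sumSamples, forEach, initBody, raiseCell, sgdStep, sumLoop, likelihoodStep,
    coinLoop, bregmanStep, updateLoop, updateBody, Static]

theorem ensures_learn {d : ℕ} (μ : PMF (Cube d)) (S : Finset (Cube d)) (ε α lam : ℝ) :
    learn.Ensures μ S (RamState.init d ε α lam) fun t =>
      t.samples + t.queries ≤ numSamples d ε α lam + 2 * numSteps d ε α lam ∧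
      t.time ≤ chooseCost +
        1001 * (1 + d) * (1 + (numSamples d ε α lam + 2 * numSteps d ε α lam)) := by
  refine ensures_seq ((ensures_chooseCounts (hasInput_init d ε α lam)).mono
    fun t ⟨_, hi, h1, h2, ht, hs, hq⟩ => ?_)
  -- The counts are already in registers `1` and `2` here, so the register contents at this moment
  -- bound the whole remaining run.
  refine (static_estimate.ensures (R := t.reg) t fun _ _ => rfl).mono fun u ⟨_, hu, hu'⟩ => ?_
  have e := timeBound_estimate_le d t.reg hi.reg0
  rw [oracleBound_estimate, hs, hq, h1, h2] at hu'
  rw [h1, h2] at e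
  have i1 : (RamState.init d ε α lam).samples = 0 := rfl
  have i2 : (RamState.init d ε α lam).queries = 0 := rfl
  have i3 : (RamState.init d ε α lam).time = 0 := rfl
  refine ⟨by omega, ?_⟩
  generalize numSamples d ε α lam = n at *
  generalize numSteps d ε α lam = T at *
  ring_nf at e ⊢
  nlinarith [Nat.zero_le (d * n), Nat.zero_le (d * T)]

theorem half_le_log_two_add {u : ℝ} (hu : 0 ≤ u) : 1 / 2 ≤ Real.log (2 + u) :=
  calc (1 : ℝ) / 2 ≤ Real.log 2 := by linarith [Real.log_two_gt_d9]
    _ ≤ _ := Real.log_le_log (by norm_num) (by linarith)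

theorem numSamples_add_numSteps_le {d : ℕ} {ε α lam : ℝ} (hd : 0 < d) (hε : 0 < ε)
    (hb : 0 < α * lam) (hb1 : α * lam ≤ 1 / 2) :
    ((numSamples d ε α lam + 2 * numSteps d ε α lam : ℕ) : ℝ) ≤
      7000000000000 * (d / ε ^ 2 * Real.log (2 + d / ε ^ 2)) * (1 / (α * lam)) ^ 8 := by
  have hdR : (1 : ℝ) ≤ d := by exact_mod_cast hd
  rw [numSamples, numSteps]
  set b := α * lam with hbdef
  set u := (d : ℝ) / ε ^ 2 with hu
  have hu0 : 0 < u := by positivity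
  set L := Real.log (2 + u) with hL
  have hLh : 1 / 2 ≤ L := half_le_log_two_add hu0.le
  obtain ⟨v, hv⟩ : ∃ v, v = 1 / b := ⟨_, rfl⟩
  have hbv : b = 1 / v := by rw [hv, one_div_one_div]
  have hv2 : 2 ≤ v := by
    rw [hv, le_div_iff₀ hb]
    linarith
  have hv0 : 0 < v := by linarith
  have huv : ∀ j ≤ 8, v ^ j ≤ v ^ 8 := fun j hj => pow_le_pow_right₀ (by linarith) hj
  have hw : 0 < u * v ^ 8 := by positivity
  have hwL : u * v ^ 8 ≤ 2 * (u * v ^ 8 * L) := by nlinarith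
  have h1 : ((if 4 * d / b ^ 2 ≤ ε ^ 2 then 0 else ⌈1638400 * u / b ^ 6⌉₊ : ℕ) : ℝ) ≤
      1638404 * (u * v ^ 8) := by
    split_ifs with hc
    · simp only [Nat.cast_zero]
      positivity
    -- The `+ 1` from rounding up is absorbed because this branch is taken only for `ε² < 4 * d /
    -- b²`. The count of steps is treated alike.
    · have hone : 1 ≤ 4 * (u * v ^ 2) := by
        have : 4 * (u * v ^ 2) = 4 * d / b ^ 2 / ε ^ 2 := by
          rw [hu, hbv]
          field_simp
        rw [this, one_le_div₀ (by positivity)]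
        exact (not_le.1 hc).le
      have e : 1638400 * u / b ^ 6 = 1638400 * (u * v ^ 6) := by
        rw [hbv]
        field_simp
      have := (Nat.ceil_lt_add_one (a := 1638400 * u / b ^ 6) (by positivity)).le
      have e1 : u * v ^ 6 ≤ u * v ^ 8 := by gcongr ?_ * ?_; exact huv 6 (by norm_num)
      have e2 : u * v ^ 2 ≤ u * v ^ 8 := by gcongr ?_ * ?_; exact huv 2 (by norm_num)
      linarith
  have h2 : ((if 8 / b ≤ ε then 0
      else ⌈128000000 * u * Real.log (12800 * (2 + u) / b ^ 2) / b ^ 6⌉₊ : ℕ) : ℝ) ≤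
      128000000 * 25601 * (u * v ^ 8 * L) + 64 * (u * v ^ 8) := by
    split_ifs with hc
    · simp only [Nat.cast_zero]
      positivity
    · have hone : 1 ≤ 64 * (u * v ^ 2) := by
        have h3 : ε < 8 * v := by
          rw [hv, mul_one_div]
          exact not_le.1 hc
        have h4 : ε ^ 2 ≤ 64 * v ^ 2 := by nlinarith
        rw [hu, div_mul_eq_mul_div, mul_div_assoc', one_le_div₀ (by positivity)]
        nlinarith [sq_nonneg v]
      have elog : Real.log (12800 * (2 + u) / b ^ 2) ≤ 25601 * (L * v ^ 2) := by
        have : 12800 * (2 + u) / b ^ 2 = (12800 * v ^ 2) * (2 + u) := by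
          rw [hbv]
          field_simp
        rw [this, Real.log_mul (by positivity) (by positivity)]
        have h5 := Real.log_le_sub_one_of_pos (show 0 < 12800 * v ^ 2 by positivity)
        nlinarith [mul_nonneg (show 0 ≤ L - 1 / 2 by linarith) (sq_nonneg v),
          mul_nonneg (show 0 ≤ L by linarith) (show 0 ≤ v ^ 2 - 1 by nlinarith)]
      have hlog0 : 0 ≤ Real.log (12800 * (2 + u) / b ^ 2) := by
        refine Real.log_nonneg ?_
        rw [one_le_div₀ (by positivity)]
        nlinarith
      have e : 128000000 * u * Real.log (12800 * (2 + u) / b ^ 2) / b ^ 6 ≤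
          128000000 * 25601 * (u * v ^ 8 * L) := by
        calc _ = 128000000 * u * Real.log (12800 * (2 + u) / b ^ 2) * v ^ 6 := by
              rw [hbv]
              field_simp
          _ ≤ 128000000 * u * (25601 * (L * v ^ 2)) * v ^ 6 := by gcongr
          _ = _ := by ring
      have := (Nat.ceil_lt_add_one
        (a := 128000000 * u * Real.log (12800 * (2 + u) / b ^ 2) / b ^ 6) (by positivity)).le
      have e2 : u * v ^ 2 ≤ u * v ^ 8 := by gcongr ?_ * ?_; exact huv 2 (by norm_num)
      linarith
  rw [← hv]
  push_cast at h1 h2 ⊢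
  nlinarith

theorem counts_of_dim_zero (ε α lam : ℝ) :
    numSamples 0 ε α lam + 2 * numSteps 0 ε α lam = 0 := by
  simp [numSamples, numSteps, sq_nonneg]

/-- One exponent has to serve all bounds, and the running time dictates `23`. Powers are raised at
the cost of a constant, as `1 / (α * lam) ≥ 1` and twice the logarithm is at least `1`. -/
theorem oracleCalls_le {d : ℕ} {ε α lam : ℝ} (hd : 0 < d) (hε : 0 < ε) (hα : 0 < α)
    (hlam : 0 < lam) (hb1 : α * lam ≤ 1 / 2) :
    ((numSamples d ε α lam + 2 * numSteps d ε α lam : ℕ) : ℝ) ≤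
      100000000000000000000 * (1 / α) ^ 23 * (1 / lam) ^ 23 *
        (d / ε ^ 2 * Real.log (2 + d / ε ^ 2) ^ 23) := by
  refine (numSamples_add_numSteps_le hd hε (mul_pos hα hlam) hb1).trans ?_
  set u := (d : ℝ) / ε ^ 2 with hu
  have hu0 : 0 ≤ u := by positivity
  have hLh := half_le_log_two_add hu0
  set L := Real.log (2 + u)
  have hv1 : 1 ≤ 1 / (α * lam) := by
    rw [one_le_div₀ (by positivity)]
    linarith
  have e1 : (1 / (α * lam)) ^ 8 ≤ (1 / α) ^ 23 * (1 / lam) ^ 23 := by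
    rw [← mul_pow, one_div_mul_one_div]
    exact pow_le_pow_right₀ hv1 (by norm_num)
  have e2 : L ≤ 2 ^ 22 * L ^ 23 := by
    have : 1 ≤ (2 * L) ^ 22 := one_le_pow₀ (by linarith)
    calc L = L * 1 := (mul_one L).symm
      _ ≤ L * (2 * L) ^ 22 := by gcongr
      _ = _ := by ring
  calc 7000000000000 * (u * L) * (1 / (α * lam)) ^ 8
      ≤ 7000000000000 * (u * (2 ^ 22 * L ^ 23)) * ((1 / α) ^ 23 * (1 / lam) ^ 23) := by gcongr
    _ = 7000000000000 * 2 ^ 22 * ((1 / α) ^ 23 * (1 / lam) ^ 23 * (u * L ^ 23)) := by ring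
    _ ≤ 100000000000000000000 * ((1 / α) ^ 23 * (1 / lam) ^ 23 * (u * L ^ 23)) := by
        gcongr
        norm_num
    _ = _ := by ring

theorem oracleCalls_le_pow {d : ℕ} {ε α lam : ℝ} (hd : 0 < d) (hε : 0 < ε) (hα : 0 < α)
    (hlam : 0 < lam) (hb1 : α * lam ≤ 1 / 2) :
    ((numSamples d ε α lam + 2 * numSteps d ε α lam : ℕ) : ℝ) ≤
      14000000000000 * (1 + d + 1 / ε + 1 / α + 1 / lam) ^ 22 := by
  refine (numSamples_add_numSteps_le hd hε (mul_pos hα hlam) hb1).trans ?_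
  set X := 1 + (d : ℝ) + 1 / ε + 1 / α + 1 / lam with hX
  have p1 : 0 ≤ (d : ℝ) := d.cast_nonneg
  have p2 : 0 < 1 / ε := by positivity
  have p3 : 0 < 1 / α := by positivity
  have p4 : 0 < 1 / lam := by positivity
  have hX1 : 1 ≤ X := by linarith
  have hu : (d : ℝ) / ε ^ 2 ≤ X ^ 3 := by
    calc (d : ℝ) / ε ^ 2 = d * (1 / ε) ^ 2 := by rw [one_div, inv_pow, div_eq_mul_inv]
      _ ≤ X * X ^ 2 := by gcongr <;> linarith
      _ = X ^ 3 := by ring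
  have hu0 : 0 ≤ (d : ℝ) / ε ^ 2 := by positivity
  set u := (d : ℝ) / ε ^ 2
  have hL : Real.log (2 + u) ≤ 2 * X ^ 3 := by
    have := Real.log_le_sub_one_of_pos (show 0 < 2 + u by linarith)
    have : 1 ≤ X ^ 3 := one_le_pow₀ hX1
    linarith
  have hL0 := half_le_log_two_add hu0
  have hb : 1 / (α * lam) ≤ X ^ 2 := by
    rw [← one_div_mul_one_div, sq]
    gcongr <;> linarith
  clear_value X
  calc 7000000000000 * (u * Real.log (2 + u)) * (1 / (α * lam)) ^ 8
      ≤ 7000000000000 * (X ^ 3 * (2 * X ^ 3)) * (X ^ 2) ^ 8 := by gcongr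
    _ = _ := by ring

theorem time_le_pow {X d N : ℝ} (hX : 1 ≤ X) (hd : 1 + d ≤ X) (hN0 : 0 ≤ N)
    (hN : N ≤ 14000000000000 * X ^ 22) :
    chooseCost + 1001 * (1 + d) * (1 + N) ≤
      (chooseCost + 100000000000000000000) * X ^ 23 := by
  have h1 : 1 ≤ X ^ 22 := one_le_pow₀ hX
  have h2 : 1 ≤ X ^ 23 := one_le_pow₀ hX
  have h3 : (0 : ℝ) ≤ chooseCost := Nat.cast_nonneg _
  calc chooseCost + 1001 * (1 + d) * (1 + N)
      ≤ chooseCost * X ^ 23 + 1001 * X * (X ^ 22 + 14000000000000 * X ^ 22) := by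
        gcongr
        exact le_mul_of_one_le_right h3 h2
    _ = (chooseCost + 1001 * 14000000000001) * X ^ 23 := by ring
    _ ≤ _ := by
        gcongr
        norm_num

/-! ### The upper bound -/

theorem le_toOuterMeasure_learn {d : ℕ} {zs : Vec d} {S : Finset (Cube d)} (hS : S.Nonempty)
    {ε α lam K : ℝ} (hε : 0 < ε) (hα : 0 < α) (hlam : 0 < lam) (hm : α ≤ prodMass zs S)
    (ha : Anticoncentrated zs S lam) (hK : 1 ≤ K) :
    (99 / 100 : ENNReal) ≤
      (learn.run (truncPMF zs S hS) S (RamState.init d ε α lam)).toOuterMeasure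
        {s | ‖zs - s.readVec d 0‖ ≤ ε ∧ tvDist zs (s.readVec d 0) ≤ K * ε} := by
  refine PMF.le_toOuterMeasure _ _ (c := ENNReal.ofReal (1 / 100)) ?_ ?_
  · rw [← ENNReal.ofReal_one, ← ENNReal.ofReal_sub _ (by norm_num)]
    rw [show (1 : ℝ) - 1 / 100 = 99 / 100 by norm_num, ENNReal.ofReal_div_of_pos (by norm_num)]
    norm_num
  have key : (learn.run (truncPMF zs S hS) S (RamState.init d ε α lam)).expect (fail zs ε) ≤
      ENNReal.ofReal (1 / 100) := by
    rcases d.eq_zero_or_pos with rfl | hd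
    · refine PMF.expect_le fun s _ => ?_
      rw [fail, if_pos]
      · exact zero_le
      · rw [Subsingleton.elim (s.readVec 0 0 - zs) 0, norm_zero]
        exact hε.le
    · exact expect_learn_le ⟨hd, hS, hα, hlam, hm, ha⟩ hε
  refine (PMF.expect_mono fun s _ => ?_).trans key
  rw [fail]
  split_ifs with h1 h2 h2
  · exact le_rfl
  · exact zero_le
  · refine absurd ?_ h1
    have h3 : ‖zs - s.readVec d 0‖ ≤ ε := by rwa [norm_sub_rev]
    exact ⟨h3, (tvDist_le_norm _ _).trans (h3.trans (le_mul_of_one_le_left hε.le hK))⟩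
  · exact le_rfl

theorem exists_algorithm : ∃ (P : Prog) (K : ℝ) (k : ℕ),
    ∀ (d : ℕ) (zstar : Vec d) (S : Finset (Cube d)) (hS : S.Nonempty) (ε α lam : ℝ),
      0 < ε → 0 < α → 0 < lam → α ≤ prodMass zstar S → Anticoncentrated zstar S lam →
      (99 / 100 : ENNReal) ≤
        (P.run (truncPMF zstar S hS) S (RamState.init d ε α lam)).toOuterMeasure
          {s | ‖zstar - s.readVec d 0‖ ≤ ε ∧ tvDist zstar (s.readVec d 0) ≤ K * ε} ∧
      ∀ s ∈ (P.run (truncPMF zstar S hS) S (RamState.init d ε α lam)).support,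
        (s.samples + s.queries : ℝ) ≤
          K * (1 / α) ^ k * (1 / lam) ^ k *
            ((d : ℝ) / ε ^ 2 * Real.log (2 + (d : ℝ) / ε ^ 2) ^ k) ∧
        (s.time : ℝ) ≤ K * (1 + d + 1 / ε + 1 / α + 1 / lam) ^ k := by
  have hC : (0 : ℝ) ≤ chooseCost := Nat.cast_nonneg _
  refine ⟨learn, chooseCost + 100000000000000000000, 23,
    fun d zs S hS ε α lam hε hα hlam hm ha =>
      ⟨le_toOuterMeasure_learn hS hε hα hlam hm ha (by linarith), fun s hs => ?_⟩⟩
  obtain ⟨h1, h2⟩ := ensures_learn (truncPMF zs S hS) S ε α lam s hs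
  have h1' : (s.samples + s.queries : ℝ) ≤
      (numSamples d ε α lam + 2 * numSteps d ε α lam : ℕ) := by exact_mod_cast h1
  have h2' : (s.time : ℝ) ≤ chooseCost +
      1001 * (1 + d) * (1 + (numSamples d ε α lam + 2 * numSteps d ε α lam : ℕ)) := by
    exact_mod_cast h2
  have p2 : 0 < 1 / ε := by positivity
  have p3 : 0 < 1 / α := by positivity
  have p4 : 0 < 1 / lam := by positivity
  have p5 : (0 : ℝ) ≤ d := Nat.cast_nonneg _
  rcases d.eq_zero_or_pos with rfl | hd
  · rw [counts_of_dim_zero] at h1' h2'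
    refine ⟨h1'.trans (by simp), h2'.trans (time_le_pow ?_ ?_ (Nat.cast_nonneg _) ?_)⟩
    · linarith
    · linarith
    · rw [Nat.cast_zero]
      positivity
  · have hb1 := Admissible.beta_le_half ⟨hd, hS, hα, hlam, hm, ha⟩
    refine ⟨(h1'.trans (oracleCalls_le hd hε hα hlam hb1)).trans ?_,
      h2'.trans (time_le_pow ?_ ?_ (Nat.cast_nonneg _) (oracleCalls_le_pow hd hε hα hlam hb1))⟩
    · have := half_le_log_two_add (u := d / ε ^ 2) (by positivity)
      gcongr
      linarith
    · linarith
    · linarith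

end Prog

end

noncomputable section

/-! ### Anticoncentration without truncation -/

theorem truncProb_univ {d : ℕ} (z : Vec d) (x : Cube d) :
    truncProb z Finset.univ x = prodProb z x := by
  rw [truncProb, if_pos (Finset.mem_univ x), prodMass, sum_prodProb, div_one]

theorem sum_prodProb_mul_exp {d : ℕ} (z w : Vec d) :
    ∑ x : Cube d, (prodProb z x : ℂ) * Complex.exp ((inner ℝ w x.toVec : ℝ) * Complex.I) =
      ∏ i, (1 - (Real.sigmoid (z i) : ℂ) + Real.sigmoid (z i) * Complex.exp (w i * Complex.I)) := by
  have h : ∀ x : Cube d,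
      (prodProb z x : ℂ) * Complex.exp ((inner ℝ w x.toVec : ℝ) * Complex.I) =
        ∏ i, ((bern (z i) (x i) : ℂ) * Complex.exp ((bitVal (x i) * w i : ℝ) * Complex.I)) :=
    fun x => by
      rw [Finset.prod_mul_distrib, ← Complex.exp_sum, ← Finset.sum_mul, prodProb_eq_prod,
        real_inner_comm, inner_toVec]
      push_cast
      rfl
  simp only [h, Fintype.sum_prod_apply
    (fun i b => (bern (z i) b : ℂ) * Complex.exp ((bitVal b * w i : ℝ) * Complex.I))]
  refine Finset.prod_congr rfl fun i _ => ?_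
  simp [bern, bitVal]
  ring

theorem norm_bern_charFun_sq (p t : ℝ) :
    ‖(1 - (p : ℂ) + p * Complex.exp (t * Complex.I))‖ ^ 2 =
      1 - 2 * (p * (1 - p)) * (1 - Real.cos t) := by
  rw [← Complex.normSq_eq_norm_sq, Complex.exp_mul_I, Complex.normSq_apply]
  simp [← Complex.ofReal_cos, ← Complex.ofReal_sin]
  linear_combination p ^ 2 * Real.sin_sq_add_cos_sq t

/-- By independence the characteristic function is a product. Each bit has variance at least `1 /
32` and `1 - cos t ≥ t² / 5`, so factor `i` has squared modulus at most `exp (-w_i² / 80)`; the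
exponents add up because `w` is a unit vector. -/
theorem norm_charFun_sq_le {d : ℕ} {z w : Vec d} (hz : ∀ i, |z i| ≤ 2) (hw : ‖w‖ = 1) :
    ‖∑ x : Cube d, (prodProb z x : ℂ) * Complex.exp ((inner ℝ w x.toVec : ℝ) * Complex.I)‖ ^ 2 ≤
      Real.exp (-(1 / 80)) := by
  have hsum : ∑ i, w i ^ 2 = 1 := by
    rw [← EuclideanSpace.real_norm_sq_eq, hw, one_pow]
  rw [sum_prodProb_mul_exp, norm_prod, ← Finset.prod_pow]
  have hi : ∀ i, ‖(1 - (Real.sigmoid (z i) : ℂ) +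
      Real.sigmoid (z i) * Complex.exp (w i * Complex.I))‖ ^ 2 ≤ Real.exp (-(1 / 80) * w i ^ 2) := by
    intro i
    rw [norm_bern_charFun_sq]
    have hw1 : w i ^ 2 ≤ 1 := by
      rw [← hsum]
      exact Finset.single_le_sum (f := fun i => w i ^ 2) (fun j _ => sq_nonneg _)
        (Finset.mem_univ i)
    have hpi := Real.pi_gt_three
    have hpi' := Real.pi_lt_d2
    have habs : |w i| ≤ Real.pi := by
      have : |w i| ≤ 1 := (sq_le_one_iff_abs_le_one _).1 hw1
      linarith
    have hcos : (1 / 5) * w i ^ 2 ≤ 1 - Real.cos (w i) := by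
      have h1 := Real.cos_le_one_sub_mul_cos_sq habs
      have h2 : 1 / 5 ≤ 2 / Real.pi ^ 2 := by
        rw [div_le_div_iff₀ (by norm_num) (by positivity)]
        nlinarith
      nlinarith [mul_le_mul_of_nonneg_right h2 (sq_nonneg (w i))]
    have hp : 1 / 32 ≤ Real.sigmoid (z i) * (1 - Real.sigmoid (z i)) := by
      refine le_trans ?_ (exp_neg_div_four_le_sigmoid_deriv (hz i))
      have h1 : Real.exp 2 ≤ 8 := by
        have : Real.exp 2 = Real.exp 1 ^ 2 := by rw [← Real.exp_nat_mul]; norm_num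
        rw [this]
        nlinarith [Real.exp_one_lt_d9, Real.exp_pos 1]
      rw [Real.exp_neg]
      have : (8 : ℝ)⁻¹ ≤ (Real.exp 2)⁻¹ := inv_anti₀ (Real.exp_pos 2) h1
      linarith
    have hmul : 1 / 32 * (1 / 5 * w i ^ 2) ≤
        Real.sigmoid (z i) * (1 - Real.sigmoid (z i)) * (1 - Real.cos (w i)) :=
      mul_le_mul hp hcos (by positivity) (by linarith)
    linarith [Real.add_one_le_exp (-(1 / 80) * w i ^ 2)]
  calc _ ≤ ∏ i, Real.exp (-(1 / 80) * w i ^ 2) :=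
        Finset.prod_le_prod (fun i _ => by positivity) fun i _ => hi i
    _ = _ := by rw [← Real.exp_sum, ← Finset.mul_sum, hsum, mul_one]

/-- If the projection were almost always within `1 / 1000` of `c`, the mean of its cosine around `c`
would be nearly `1`, and so would the modulus of the characteristic function. -/
theorem anticoncentrated_univ {d : ℕ} {z : Vec d} (hz : ∀ i, |z i| ≤ 2) :
    Anticoncentrated z Finset.univ (1 / 1000) := by
  intro w hw c
  by_contra! hlt
  simp only [truncProb_univ] at hlt
  have hφ := norm_charFun_sq_le hz hw
  set φ := ∑ x : Cube d, (prodProb z x : ℂ) * Complex.exp ((inner ℝ w x.toVec : ℝ) * Complex.I)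
  have hre : (φ * Complex.exp (-(c * Complex.I))).re =
      ∑ x : Cube d, prodProb z x * Real.cos (inner ℝ w x.toVec - c) := by
    rw [Finset.sum_mul, Complex.re_sum]
    refine Finset.sum_congr rfl fun x _ => ?_
    rw [mul_assoc, ← Complex.exp_add, Complex.re_ofReal_mul, ← Complex.exp_ofReal_mul_I_re]
    congr 3
    push_cast
    ring
  have hle : (φ * Complex.exp (-(c * Complex.I))).re ≤ ‖φ‖ := by
    refine (Complex.re_le_norm _).trans_eq ?_
    rw [norm_mul, show -(c * Complex.I) = ((-c : ℝ) : ℂ) * Complex.I by push_cast; ring,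
      Complex.norm_exp_ofReal_mul_I, mul_one]
  have hge : 1 - 1 / 1000 ^ 2 / 2 - 2 * (1 / 1000) ≤
      ∑ x : Cube d, prodProb z x * Real.cos (inner ℝ w x.toVec - c) := by
    have hpt : ∀ x : Cube d, prodProb z x * (1 - 1 / 1000 ^ 2 / 2) - 2 *
        (if inner ℝ w x.toVec ∉ Set.Ioo (c - 1 / 1000) (c + 1 / 1000) then prodProb z x else 0) ≤
        prodProb z x * Real.cos (inner ℝ w x.toVec - c) := by
      intro x
      have hp := prodProb_pos z x
      split_ifs with hx
      · rw [Set.mem_Ioo] at hx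
        have h1 := Real.one_sub_sq_div_two_le_cos (x := inner ℝ w x.toVec - c)
        have h2 : (inner ℝ w x.toVec - c) ^ 2 ≤ 1 / 1000 ^ 2 := by nlinarith
        nlinarith
      · nlinarith [Real.neg_one_le_cos (inner ℝ w x.toVec - c)]
    refine le_trans ?_ (Finset.sum_le_sum fun x _ => hpt x)
    rw [Finset.sum_sub_distrib, ← Finset.sum_mul, sum_prodProb, ← Finset.mul_sum,
      ← Finset.sum_filter]
    linarith
  have hexp : Real.exp (-(1 / 80)) ≤ 80 / 81 := by
    rw [Real.exp_neg, inv_le_comm₀ (Real.exp_pos _) (by norm_num)]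
    linarith [Real.add_one_le_exp (1 / 80 : ℝ)]
  have : (99 / 100 : ℝ) + 7 / 1000 ≤ ‖φ‖ := by linarith
  nlinarith

end

noncomputable section

open MeasureTheory

/-! ### The lower bound -/

/-- The probability of `n` independent samples. -/
def sampleProb {d n : ℕ} (z : Vec d) (X : Fin n → Cube d) : ℝ := ∏ j, prodProb z (X j)

theorem sampleProb_nonneg {d n : ℕ} (z : Vec d) (X : Fin n → Cube d) : 0 ≤ sampleProb z X :=
  Finset.prod_nonneg fun _ _ => (prodProb_pos _ _).le

theorem sum_sampleProb {d n : ℕ} (z : Vec d) : ∑ X : Fin n → Cube d, sampleProb z X = 1 := by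
  simp only [sampleProb, Fintype.sum_prod_apply (fun _ x => prodProb z x), sum_prodProb,
    Finset.prod_const_one]

theorem affinity_sampleProb {d n : ℕ} (z z' : Vec d) :
    Real.exp (-‖z - z'‖ ^ 2 / 16) ^ n ≤
      ∑ X : Fin n → Cube d, Real.sqrt (sampleProb z X * sampleProb z' X) := by
  have h : ∀ X : Fin n → Cube d, Real.sqrt (sampleProb z X * sampleProb z' X) =
      ∏ j, Real.sqrt (prodProb z (X j) * prodProb z' (X j)) := fun X => by
    rw [sampleProb, sampleProb, ← Finset.prod_mul_distrib, Real.sqrt_prod]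
    exact fun j _ => mul_nonneg (prodProb_pos _ _).le (prodProb_pos _ _).le
  simp only [h, Fintype.sum_prod_apply (fun _ x => Real.sqrt (prodProb z x * prodProb z' x)),
    Finset.prod_const, Finset.card_univ, Fintype.card_fin]
  exact pow_le_pow_left₀ (Real.exp_pos _).le (affinity_prodProb z z') n

/-- Affinities multiply over samples, so the squared distance grows linearly in `n`. Adding total
variations would make it quadratic and lose the sharp rate. -/
theorem sum_abs_sampleProb_sub_sq_le {d n : ℕ} (z z' : Vec d) :
    (∑ X : Fin n → Cube d, |sampleProb z X - sampleProb z' X|) ^ 2 ≤ n * ‖z - z'‖ ^ 2 / 2 := by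
  refine (sum_abs_sub_sq_le (sampleProb_nonneg z) (sampleProb_nonneg z') (sum_sampleProb z)
    (sum_sampleProb z')).trans ?_
  have h := pow_le_pow_left₀ (by positivity) (affinity_sampleProb (n := n) z z') 2
  rw [← pow_mul, ← Real.exp_nat_mul] at h
  have h2 := Real.add_one_le_exp (((n * 2 : ℕ) : ℝ) * (-‖z - z'‖ ^ 2 / 16))
  push_cast at h h2
  linarith

/-- The total error of any test between two parameters that are close is large. -/
theorem test_error_ge {d n : ℕ} {z z' : Vec d} (h : n * ‖z - z'‖ ^ 2 ≤ 1 / 2)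
    {q q' : (Fin n → Cube d) → ℝ} (hq : ∀ X, 0 ≤ q X) (hq' : ∀ X, 0 ≤ q' X)
    (hqq : ∀ X, q X + q' X = 1) :
    3 / 4 ≤ ∑ X, sampleProb z X * q X + ∑ X, sampleProb z' X * q' X := by
  have h1 := sum_abs_sampleProb_sub_sq_le (n := n) z z'
  have h2 : ∑ X : Fin n → Cube d, |sampleProb z X - sampleProb z' X| ≤ 1 / 2 :=
    le_of_sq_le_sq (h1.trans (by linarith)) (by norm_num)
  -- The left side is the smaller of the two probabilities, which every randomised test pays at `X`.
  have hpt : ∀ X, (sampleProb z X + sampleProb z' X - |sampleProb z X - sampleProb z' X|) / 2 ≤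
      sampleProb z X * q X + sampleProb z' X * q' X := fun X => by
    have e : q' X = 1 - q X := by linarith [hqq X]
    have e0 := hq' X
    rw [e] at e0 ⊢
    rcases abs_cases (sampleProb z X - sampleProb z' X) with ⟨ha, hb⟩ | ⟨ha, hb⟩
    · rw [ha]
      nlinarith [mul_nonneg hb (hq X)]
    · rw [ha]
      nlinarith [mul_nonneg (neg_nonneg.2 hb.le) e0]
  have h3 := Finset.sum_le_sum fun X (_ : X ∈ Finset.univ) => hpt X
  rw [← Finset.sum_div, Finset.sum_sub_distrib, Finset.sum_add_distrib, Finset.sum_add_distrib,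
    sum_sampleProb, sum_sampleProb] at h3
  linarith

/-- The vertices of the cube of side `2 * h` around the origin. -/
def vertex {d : ℕ} (h : ℝ) (s : Cube d) : Vec d := WithLp.toLp 2 fun i => if s i then h else -h

/-- The points at which the sign of coordinate `i` is not the one that `b` says. -/
def wrongSign {d : ℕ} (i : Fin d) (b : Bool) : Set (Vec d) := {v | ¬ (0 < v i ↔ b = true)}

theorem measurableSet_wrongSign {d : ℕ} (i : Fin d) (b : Bool) :
    MeasurableSet (wrongSign i b) := by
  have h : MeasurableSet {v : Vec d | 0 < v i} :=
    measurableSet_lt measurable_const (by fun_prop)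
  cases b
  · simpa [wrongSign] using h
  · have e : wrongSign i true = {v : Vec d | 0 < v i}ᶜ := by
      ext v
      simp [wrongSign]
    rw [e]
    exact h.compl

theorem compl_wrongSign {d : ℕ} (i : Fin d) (b : Bool) :
    (wrongSign i b)ᶜ = wrongSign i (!b) := by
  ext v
  cases b <;> simp [wrongSign]

/-- Each wrong sign contributes at least `h²` to the squared distance from the vertex, so a point of
the ball has at most `d / 4` of them; elsewhere the trivial bound `d` is used. -/
theorem sum_indicator_wrongSign_le {d : ℕ} {h ε : ℝ} (hh : 0 < h) (hd : ε ^ 2 ≤ h ^ 2 * (d / 4))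
    (s : Cube d) (v : Vec d) :
    ∑ i, (wrongSign i (s i)).indicator (1 : Vec d → ℝ) v ≤
      d / 4 + d * (Metric.closedBall (vertex h s) ε)ᶜ.indicator 1 v := by
  by_cases hv : v ∈ Metric.closedBall (vertex h s) ε
  · rw [Set.indicator_of_notMem (Set.notMem_compl_iff.2 hv), mul_zero, add_zero]
    have h1 : ‖v - vertex h s‖ ^ 2 ≤ ε ^ 2 :=
      pow_le_pow_left₀ (norm_nonneg _) (mem_closedBall_iff_norm.1 hv) 2
    rw [EuclideanSpace.real_norm_sq_eq] at h1
    have h2 : ∑ i, h ^ 2 * (wrongSign i (s i)).indicator (1 : Vec d → ℝ) v ≤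
        ∑ i, (v - vertex h s) i ^ 2 := by
      refine Finset.sum_le_sum fun i _ => ?_
      by_cases hi : v ∈ wrongSign i (s i)
      · rw [Set.indicator_of_mem hi, Pi.one_apply, mul_one, PiLp.sub_apply]
        cases hs : s i
        · have : 0 < v i := by simpa [wrongSign, hs] using hi
          simp only [vertex, hs]
          norm_num
          nlinarith
        · have : v i ≤ 0 := by simpa [wrongSign, hs] using hi
          simp only [vertex, hs]
          norm_num
          nlinarith
      · rw [Set.indicator_of_notMem hi, mul_zero]
        positivity
    rw [← Finset.mul_sum] at h2
    exact le_of_mul_le_mul_left ((h2.trans h1).trans hd) (by positivity)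
  · rw [Set.indicator_of_mem (Set.mem_compl hv), Pi.one_apply, mul_one]
    calc ∑ i, (wrongSign i (s i)).indicator (1 : Vec d → ℝ) v ≤ ∑ _i : Fin d, (1 : ℝ) :=
          Finset.sum_le_sum fun i _ => Set.indicator_le_self' (fun _ _ => zero_le_one) v
      _ = d := by simp
      _ ≤ _ := by linarith [(Nat.cast_nonneg d : (0 : ℝ) ≤ d)]

theorem sum_measure_wrongSign_le {d : ℕ} {h ε : ℝ} (hh : 0 < h) (hd : ε ^ 2 ≤ h ^ 2 * (d / 4))
    (s : Cube d) (q : Measure (Vec d)) [IsProbabilityMeasure q] :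
    ∑ i, q.real (wrongSign i (s i)) ≤
      d / 4 + d * (1 - q.real (Metric.closedBall (vertex h s) ε)) := by
  have hB : MeasurableSet (Metric.closedBall (vertex h s) ε)ᶜ :=
    Metric.isClosed_closedBall.measurableSet.compl
  have hint : ∀ {A : Set (Vec d)}, MeasurableSet A →
      Integrable (A.indicator (1 : Vec d → ℝ)) q := fun hA =>
    (integrable_const (1 : ℝ)).indicator hA
  calc ∑ i, q.real (wrongSign i (s i)) =
        ∫ v, ∑ i, (wrongSign i (s i)).indicator (1 : Vec d → ℝ) v ∂q := by
        rw [integral_finsetSum _ fun i _ => hint (measurableSet_wrongSign i (s i))]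
        exact Finset.sum_congr rfl fun i _ =>
          (integral_indicator_one (measurableSet_wrongSign i (s i))).symm
    _ ≤ ∫ v, (d / 4 + d * (Metric.closedBall (vertex h s) ε)ᶜ.indicator (1 : Vec d → ℝ) v) ∂q := by
        refine integral_mono
          (integrable_finsetSum _ fun i _ => hint (measurableSet_wrongSign i (s i)))
          ((integrable_const _).add ((hint hB).const_mul _))
          (sum_indicator_wrongSign_le hh hd s)
    _ = _ := by
        rw [integral_add (integrable_const _) ((hint hB).const_mul _), integral_const_mul,
          integral_indicator_one hB, probReal_compl_eq_one_sub hB.of_compl]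
        simp

theorem dist_vertex_update {d : ℕ} (h : ℝ) (s : Cube d) (i : Fin d) :
    ‖vertex h s - vertex h (Function.update s i (!s i))‖ ^ 2 = 4 * h ^ 2 := by
  rw [EuclideanSpace.real_norm_sq_eq, Finset.sum_eq_single i]
  · cases hs : s i <;> simp [vertex, hs] <;> ring
  · intro j _ hj
    simp [vertex, hj]
  · simp

/-- Any estimator that succeeds at all vertices needs many samples. -/
theorem samples_ge_of_estimates_vertices {d n : ℕ} {h ε : ℝ} (hpos : 0 < d) (hh : 0 < h)
    (hd : ε ^ 2 ≤ h ^ 2 * (d / 4)) (Q : (Fin n → Cube d) → Measure (Vec d))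
    [∀ X, IsProbabilityMeasure (Q X)]
    (hQ : ∀ s : Cube d, 99 / 100 ≤
      ∑ X, sampleProb (vertex h s) X * (Q X).real (Metric.closedBall (vertex h s) ε)) :
    1 / 8 < n * h ^ 2 := by
  by_contra! hn
  have hdR : (0 : ℝ) < d := by exact_mod_cast hpos
  let err : Cube d → Fin d → ℝ := fun s i =>
    ∑ X, sampleProb (vertex h s) X * (Q X).real (wrongSign i (s i))
  -- Success costs `d / 4` wrong signs and failure, of probability `1 / 100`, at most `d` more.
  -- Testing forces an average of `3 / 8` per coordinate, which is the contradiction.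
  have hup : ∀ s, ∑ i, err s i ≤ 26 / 100 * d := fun s => by
    rw [Finset.sum_comm]
    simp only [← Finset.mul_sum]
    calc _ ≤ ∑ X, sampleProb (vertex h s) X *
          (d / 4 + d * (1 - (Q X).real (Metric.closedBall (vertex h s) ε))) :=
          Finset.sum_le_sum fun X _ => mul_le_mul_of_nonneg_left
            (sum_measure_wrongSign_le hh hd s (Q X)) (sampleProb_nonneg _ _)
      _ = 5 * d / 4 * ∑ X, sampleProb (vertex h s) X -
          d * ∑ X, sampleProb (vertex h s) X *
            (Q X).real (Metric.closedBall (vertex h s) ε) := by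
          rw [Finset.mul_sum, Finset.mul_sum, ← Finset.sum_sub_distrib]
          exact Finset.sum_congr rfl fun X _ => by ring
      _ ≤ _ := by
          rw [sum_sampleProb]
          nlinarith [hQ s]
  have hlow : ∀ i, ∀ s, 3 / 4 ≤ err s i + err (Function.update s i (!s i)) i := fun i s => by
    refine test_error_ge ?_ (fun _ => measureReal_nonneg) (fun _ => measureReal_nonneg) fun X => ?_
    · rw [dist_vertex_update]
      linarith
    · rw [Function.update_self, ← compl_wrongSign,
        probReal_compl_eq_one_sub (measurableSet_wrongSign _ _)]
      ring
  -- Flipping a sign permutes the vertices, so averaging `hlow` over them counts every error twice.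
  have hflip : ∀ i, ∑ s, err (Function.update s i (!s i)) i = ∑ s, err s i := fun i => by
    have hinv : Function.Involutive fun s : Cube d => Function.update s i (!s i) := fun s => by
      simp
    exact Equiv.sum_comp hinv.toPerm fun s => err s i
  have h1 : ∑ _s : Cube d, ∑ _i : Fin d, (3 / 4 : ℝ) ≤ 2 * ∑ s, ∑ i, err s i := by
    rw [Finset.sum_comm, Finset.sum_comm (f := err), Finset.mul_sum]
    refine Finset.sum_le_sum fun i _ => ?_
    rw [two_mul]
    nth_rewrite 2 [← hflip i]
    rw [← Finset.sum_add_distrib]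
    exact Finset.sum_le_sum fun s _ => hlow i s
  have h2 : ∑ s, ∑ i, err s i ≤ ∑ _s : Cube d, 26 / 100 * (d : ℝ) :=
    Finset.sum_le_sum fun s _ => hup s
  simp only [Finset.sum_const, nsmul_eq_mul, Finset.card_univ, Fintype.card_fin] at h1 h2
  have hN : (0 : ℝ) < Fintype.card (Cube d) := by exact_mod_cast Fintype.card_pos
  nlinarith [mul_pos hN hdR]

/-- The side `h = 2ε/√d` turns the requirement on `ε` into an equality, and `ε ≤ √d` keeps all
logits within `2`, where anticoncentration is known. -/
theorem sample_lower_bound (d n : ℕ) (ε : ℝ) (Q : (Fin n → Cube d) → Measure (Vec d))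
    (hε : 0 < ε) (hεd : ε ≤ Real.sqrt d) (hprob : ∀ X, IsProbabilityMeasure (Q X))
    (hQ : ∀ zstar : Vec d, Anticoncentrated zstar Finset.univ (1 / 1000) →
      99 / 100 ≤ ∑ X : Fin n → Cube d,
        (∏ j, prodProb zstar (X j)) * (Q X).real (Metric.closedBall zstar ε)) :
    1 / 32 * (d : ℝ) / ε ^ 2 ≤ n := by
  have hsq : 0 < Real.sqrt d := hε.trans_le hεd
  have hdR : (0 : ℝ) < d := Real.sqrt_pos.1 hsq
  have hs2 : Real.sqrt d ^ 2 = d := Real.sq_sqrt hdR.le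
  set h := 2 * ε / Real.sqrt d with hh
  have hh0 : 0 < h := by positivity
  have hh2 : h ≤ 2 := by
    rw [hh, div_le_iff₀ hsq]
    linarith
  have hsqh : h ^ 2 = 4 * ε ^ 2 / d := by
    rw [hh, div_pow, hs2]
    ring
  have key := samples_ge_of_estimates_vertices (ε := ε) (Nat.cast_pos.1 hdR) hh0
    (by rw [hsqh]; apply le_of_eq; field_simp) Q fun s => hQ _ (anticoncentrated_univ fun i => by
      have : |vertex h s i| = h := by
        simp only [vertex]
        split_ifs <;> simp [abs_of_pos hh0]
      rw [this]
      exact hh2)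
  rw [hsqh, mul_div_assoc', lt_div_iff₀ hdR] at key
  rw [div_le_iff₀ (by positivity)]
  linarith

end

theorem mainTheorem1 :
    -- the algorithm
    (∃ (P : Prog) (K : ℝ) (k : ℕ),
      ∀ (d : ℕ) (zstar : Vec d) (S : Finset (Cube d)) (hS : S.Nonempty) (ε α lam : ℝ),
        0 < ε → 0 < α → 0 < lam → α ≤ prodMass zstar S → Anticoncentrated zstar S lam →
        -- accuracy, with probability 99%
        (99 / 100 : ENNReal) ≤
          (P.run (truncPMF zstar S hS) S (RamState.init d ε α lam)).toOuterMeasure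
            {s | ‖zstar - s.readVec d 0‖ ≤ ε ∧ tvDist zstar (s.readVec d 0) ≤ K * ε} ∧
        -- resources, on every run
        ∀ s ∈ (P.run (truncPMF zstar S hS) S (RamState.init d ε α lam)).support,
          (s.samples + s.queries : ℝ) ≤
            K * (1 / α) ^ k * (1 / lam) ^ k *
              ((d : ℝ) / ε ^ 2 * Real.log (2 + (d : ℝ) / ε ^ 2) ^ k) ∧
          (s.time : ℝ) ≤ K * (1 + d + 1 / ε + 1 / α + 1 / lam) ^ k) ∧
    -- optimality in `d` and `ε`, already without truncation, against all randomised estimators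
    (∃ c lam₀ : ℝ, 0 < c ∧ 0 < lam₀ ∧
      ∀ (d n : ℕ) (ε : ℝ) (Q : (Fin n → Cube d) → MeasureTheory.Measure (Vec d)),
        0 < ε → ε ≤ Real.sqrt d → (∀ X, MeasureTheory.IsProbabilityMeasure (Q X)) →
        (∀ zstar : Vec d, Anticoncentrated zstar Finset.univ lam₀ →
          99 / 100 ≤ ∑ X : Fin n → Cube d,
            (∏ j, prodProb zstar (X j)) * (Q X).real (Metric.closedBall zstar ε)) →
        c * (d : ℝ) / ε ^ 2 ≤ n) := by
  exact ⟨Prog.exists_algorithm, 1 / 32, 1 / 1000, by norm_num, by norm_num, sample_lower_bound⟩
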